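/- **Setting.** All objects are smooth. A *hyperbolic Monge–Ampère system* is a differential ideal $\mathcal I$ on a 5-manifold $M$ which near every point has the form $\mathcal I=\langle\theta,\eta^1\wedge\eta^2,\eta^3\wedge\eta^4\rangle_{\rm alg}$ for a coframing $(\theta,\eta^1,\dots,\eta^4)$ with $\theta\wedge(d\theta)^2\neq0$. A *rank 2 Bäcklund transformation* $(N,\mathcal B;\pi,\bar\pi)$ relating $(M,\mathcal I)$ and $(\bar M,\bar{\mathcal I})$ is a 7-manifold $N$ with a differential ideal $\mathcal B$ and submersions $\pi:N\to M$, $\bar\pi:N\to\bar M$ which are both integrable extensions: near each point $\mathcal B$ is algebraically generated by $\pi^*\mathcal I$ and the sections of a rank 2 bundle $\Theta\subset T^*N$ with $\Theta^\perp\cap\ker\pi_*=0$, and similarly for $\bar\pi$. Let $I^1$, $\bar I^1$, $B^1$ be the bundles spanned by the degree 1 parts of the ideals. An ordered pair of characteristic systems $\chi_{10},\chi_{01}$ of $\mathcal B$ is fixed: near every point there is a coframing $(\kappa^0,\kappa^1,\kappa^2,\eta^1,\dots,\eta^4)$ with $\mathcal B=\langle\kappa^0,\kappa^1,\kappa^2,\eta^1\wedge\eta^2,\eta^3\wedge\eta^4\rangle_{\rm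 alg}$, $\chi_{10}=[\![\kappa^0,\kappa^1,\kappa^2,\eta^1,\eta^2]\!]$ and $\chi_{01}=[\![\kappa^0,\kappa^1,\kappa^2,\eta^3,\eta^4]\!]$. The transformation is of *Type $\mathscr B$* if $\pi^*I^1\cap\bar\pi^*\bar I^1=0$ and, at every point, $d\theta$ and $d\bar\theta$ are linearly dependent modulo $B^1$, where $\theta,\bar\theta$ are local generators of $\pi^*I^1$, $\bar\pi^*\bar I^1$. A coframing $\omega=(\omega^0,\bar\omega^0,\gamma,\omega^1,\dots,\omega^4)$ on an open $U\subset N$ is *0-adapted* if $[\![\omega^0]\!]=\pi^*I^1$, $[\![\bar\omega^0]\!]=\bar\pi^*\bar I^1$, $[\![\omega^0,\bar\omega^0,\gamma]\!]=B^1$, $\chi_{10}=[\![\omega^0,\bar\omega^0,\gamma,\omega^1,\omega^2]\!]$, $\chi_{01}=[\![\omega^0,\bar\omega^0,\gamma,\omega^3,\omega^4]\!]$ and, for some functions $B_1,\dots,B_4$, $$\begin{aligned}d\gamma&\equiv\omega^1\wedge\omega^2-\omega^3\wedge\omega^4 &&\bmod \omega^0,\bar\omega^0,\gamma,\\ d\omega^0&\equiv\omega^1\wedge\omega^2+\omega^3\wedge\omega^4+(B_3\omega^3+B_4\omega^4)\wedge\gamma&&\bmod\omega^0,\\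 d\bar\omega^0&\equiv\omega^1\wedge\omega^2+\omega^3\wedge\omega^4+(B_1\omega^1+B_2\omega^2)\wedge\gamma&&\bmod\bar\omega^0.\end{aligned}$$ It is *1-adapted* if $(B_1,B_2)=(B_3,B_4)=(1,0)$. The transformation is of *Type $\mathscr B_1$* if it is of Type $\mathscr B$, $\mathcal B$ is Pfaffian (differentially generated by its degree 1 part), and near every point there is a 0-adapted coframing for which $(B_1,B_2)$ and $(B_3,B_4)$ vanish nowhere. Its 1-adapted coframings are the local sections of a $G$-structure, where $G\subset GL(7,\mathbb R)$ consists of the matrices $$g=\begin{pmatrix} r&0&0&0&0&0&0\\0&r&0&0&0&0&0\\c&-c&r&0&0&0&0\\0&0&0&1&0&0&0\\-c&0&0&a&r&0&0\\0&0&0&0&0&1&0\\0&c&0&0&0&b&r\end{pmatrix},\qquad a,b,c,r\in\mathbb R,\ r\ne0,$$ acting by $\omega\cdot g=g^{-1}\omega$. A 1-adapted coframing satisfies structure equations (with 1-forms $\phi,\varpi,\alpha,\beta$) $$\begin{aligned} d\omega^0&=-\phi\wedge\omega^0+\Omega^0, & d\bar\omega^0&=-\phi\wedge\bar\omega^0+\bar\Omega^0,\\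 d\gamma&=-\varpi\wedge(\omega^0-\bar\omega^0)-\phi\wedge\gamma+\Gamma,\\ d\omega^1&=\Omega^1,& d\omega^2&=\varpi\wedge\omega^0-\alpha\wedge\omega^1-\phi\wedge\omega^2+\Omega^2,\\ d\omega^3&=\Omega^3,& d\omega^4&=-\varpi\wedge\bar\omega^0-\beta\wedge\omega^3-\phi\wedge\omega^4+\Omega^4, \end{aligned}$$ where, writing $\sigma=\gamma+\omega^2+\omega^4$ and $K=\tfrac14(P_4-P_2)$, $$\begin{aligned} \Omega^0&=\omega^1\wedge\omega^2+\omega^3\wedge(\omega^4+\gamma)+(K\gamma+P_i\omega^i)\wedge\omega^0,\\ \bar\Omega^0&=\omega^1\wedge(\omega^2+\gamma)+\omega^3\wedge\omega^4+(-K\gamma+P_i\omega^i+\omega^1+\omega^3)\wedge\bar\omega^0,\\ \Gamma&=\omega^1\wedge\omega^2-\omega^3\wedge\omega^4+C_1(\omega^1-\omega^3)\wedge(\omega^0+\bar\omega^0),\\ \Omega^1&=T^1_0\,\omega^0\wedge\bar\omega^0+\omega^0\wedge(T^1_1\omega^1+T^1_2(\omega^2+\gamma))+\bar\omega^0\wedge(\bar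 T^1_1\omega^1+\bar T^1_2\omega^2)+\gamma\wedge(R^1_1\omega^1+R^1_2\omega^2)\\&\quad+\tfrac{P_2}2\omega^3\wedge\sigma-\tfrac{P_2}2\omega^1\wedge\omega^2-\tfrac{P_1+P_3+1}2\omega^1\wedge\omega^3-\tfrac{P_4}2\omega^1\wedge\omega^4,\\ \Omega^2&=T^2_0\,\omega^0\wedge\bar\omega^0-\omega^0\wedge(C_1\omega^3+T^1_1(\omega^2+\gamma))-\bar T^1_1\bar\omega^0\wedge\omega^2-\bigl(R^1_1+\tfrac{P_2+P_4}4\bigr)\gamma\wedge\omega^2-\bigl(C_1+\tfrac{P_1}2\bigr)\omega^3\wedge\sigma,\\ \Omega^3&=T^3_0\,\bar\omega^0\wedge\omega^0+\bar\omega^0\wedge(\bar T^3_3\omega^3+\bar T^3_4(\omega^4+\gamma))+\omega^0\wedge(T^3_3\omega^3+T^3_4\omega^4)+\gamma\wedge(R^3_3\omega^3+R^3_4\omega^4)\\&\quad+\tfrac{P_4}2\omega^1\wedge\sigma+\tfrac{P_1+P_3+1}2\omega^1\wedge\omega^3+\tfrac{P_2}2\omega^2\wedge\omega^3-\tfrac{P_4}2\omega^3\wedge\omega^4,\\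 \Omega^4&=-T^2_0\,\bar\omega^0\wedge\omega^0+\bar\omega^0\wedge(C_1\omega^1-\bar T^3_3(\omega^4+\gamma))-T^3_3\omega^0\wedge\omega^4-\bigl(R^3_3+\tfrac{P_2+P_4}4\bigr)\gamma\wedge\omega^4-\bigl(C_1+\tfrac{P_3+1}2\bigr)\omega^1\wedge\sigma, \end{aligned}$$ with 20 uniquely determined *torsion functions* $C_1,P_1,\dots,P_4,R^1_1,R^1_2,R^3_3,R^3_4,T^1_0,T^2_0,T^3_0,T^1_1,T^1_2,\bar T^1_1,\bar T^1_2,\bar T^3_3,\bar T^3_4,T^3_3,T^3_4$. The *$G$-orbit* of $\omega$ at $p\in U$ is the set of the values in $\mathbb R^{20}$ at $p$ of the torsion functions of the coframings $\omega\cdot g$, $g\in G$. **Proposition.** For a Type $\mathscr B_1$ rank 2 Bäcklund transformation, the $G$-orbits in $\mathbb R^{20}$ (of all 1-adapted coframings, at all points) are all of dimension at most $2$ if and only if $\omega^1$ and $\omega^3$ are both integrable, that is, $d\omega^1\equiv0 \bmod\omega^1$ and $d\omega^3\equiv0\bmod\omega^3$ for every 1-adapted coframing. -/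

import Mathlib

open scoped Manifold ContDiff

noncomputable section

namespace Backlund

/-! ## Forms of degree one and two on a smooth manifold -/

/-- Covectors at `x` on an `n`-dimensional manifold. -/
abbrev Covector (n : ℕ) {X : Type*} [TopologicalSpace X]
    [ChartedSpace (EuclideanSpace ℝ (Fin n)) X] (x : X) : Type :=
  TangentSpace (𝓡 n) x →L[ℝ] ℝ

/-- Bilinear forms on the tangent space at `x`; two-forms take values here. -/
abbrev TwoTensor (n : ℕ) {X : Type*} [TopologicalSpace X]
    [ChartedSpace (EuclideanSpace ℝ (Fin n)) X] (x : X) : Type :=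
  LinearMap.BilinForm ℝ (TangentSpace (𝓡 n) x)

/-- (Not necessarily smooth) fields of covectors. -/
abbrev OneForm (n : ℕ) (X : Type*) [TopologicalSpace X]
    [ChartedSpace (EuclideanSpace ℝ (Fin n)) X] : Type _ :=
  ∀ x : X, Covector n x

section Forms

variable {n : ℕ} {X : Type*} [TopologicalSpace X] [ChartedSpace (EuclideanSpace ℝ (Fin n)) X]

/-- `(κ ∧ β)(v, w) = κ(v) β(w) - β(v) κ(w)`. -/
def wedge {x : X} (κ β : Covector n x) : TwoTensor n x :=
  LinearMap.mk₂ ℝ (fun v u => κ v * β u - β v * κ u)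
    (fun _ _ _ => by simp only [map_add]; ring)
    (fun _ _ _ => by simp only [map_smul, smul_eq_mul]; ring)
    (fun _ _ _ => by simp only [map_add]; ring)
    (fun _ _ _ => by simp only [map_smul, smul_eq_mul]; ring)

/-- `σ` is smooth on `U`, as a section of the cotangent bundle. -/
def SmoothOn [IsManifold (𝓡 n) ∞ X] (U : Set X) (σ : OneForm n X) : Prop :=
  ContMDiffOn (𝓡 n) ((𝓡 n).prod 𝓘(ℝ, EuclideanSpace ℝ (Fin n) →L[ℝ] ℝ)) ∞
    (fun x => Bundle.TotalSpace.mk' (EuclideanSpace ℝ (Fin n) →L[ℝ] ℝ)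
      (E := fun x : X => TangentSpace (𝓡 n) x →L[ℝ] Bundle.Trivial X ℝ x) x (σ x)) U

/-- The expression of `σ` in the preferred chart at `p`. -/
def coordRep (σ : OneForm n X) (p : X) (y : EuclideanSpace ℝ (Fin n)) :
    EuclideanSpace ℝ (Fin n) →L[ℝ] ℝ :=
  (σ ((extChartAt (𝓡 n) p).symm y)).comp
    (mfderiv 𝓘(ℝ, EuclideanSpace ℝ (Fin n)) (𝓡 n) (extChartAt (𝓡 n) p).symm y)

/-- The exterior derivative of a one-form: in the chart at `p` it is
`dσ(v, w) = (D_v σ)(w) - (D_w σ)(v)`. -/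
def extD (σ : OneForm n X) (p : X) : TwoTensor n p :=
  let L : EuclideanSpace ℝ (Fin n) →L[ℝ] EuclideanSpace ℝ (Fin n) →L[ℝ] ℝ :=
    fderiv ℝ (coordRep σ p) (extChartAt (𝓡 n) p p)
  let D : TangentSpace (𝓡 n) p →L[ℝ] EuclideanSpace ℝ (Fin n) :=
    mfderiv (𝓡 n) 𝓘(ℝ, EuclideanSpace ℝ (Fin n)) (extChartAt (𝓡 n) p) p
  LinearMap.mk₂ ℝ (fun v u => L (D v) (D u) - L (D u) (D v))
    (fun _ _ _ => by simp only [map_add, add_apply]; ring)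
    (fun _ _ _ => by
      simp only [map_smul, smul_apply, smul_eq_mul]; ring)
    (fun _ _ _ => by simp only [map_add, add_apply]; ring)
    (fun _ _ _ => by
      simp only [map_smul, smul_apply, smul_eq_mul]; ring)

/-- The degree two part of the algebraic ideal generated by the space `W` of covectors. -/
def wedgeSpan {x : X} (W : Submodule ℝ (Covector n x)) : Submodule ℝ (TwoTensor n x) :=
  Submodule.span ℝ {Ψ | ∃ κ ∈ W, ∃ β : Covector n x, Ψ = wedge κ β}

/-- `Ψ ≡ Ψ'` modulo the covectors in `s`. -/
def CongrMod {x : X} (Ψ Ψ' : TwoTensor n x) (s : Set (Covector n x)) : Prop :=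
  Ψ - Ψ' ∈ wedgeSpan (Submodule.span ℝ s)

/-- A smooth coframing on the open set `U`. -/
structure IsCoframing [IsManifold (𝓡 n) ∞ X] (U : Set X) (w : Fin n → OneForm n X) : Prop where
  isOpen : IsOpen U
  smooth : ∀ i, SmoothOn U (w i)
  independent : ∀ q ∈ U, LinearIndependent ℝ (fun i => w i q)

end Forms

/-! ## Exterior differential systems

All the ideals below are algebraically generated by one-forms and two-forms of locally constant
rank, so they are recorded by the bundles spanned by their parts of degree one and two.
For each of them the quotient by the degree one part is generated by `η¹ ∧ η²` and `η³ ∧ η⁴` in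
four variables, so that the ideal contains every form of degree three, and closure under `d` is a
condition on the degree one part alone. -/

/-- The bundles spanned by the degree one part and the degree two part of an ideal of forms. -/
structure FormIdeal (n : ℕ) (X : Type*) [TopologicalSpace X]
    [ChartedSpace (EuclideanSpace ℝ (Fin n)) X] where
  deg1 : ∀ x : X, Submodule ℝ (Covector n x)
  deg2 : ∀ x : X, Submodule ℝ (TwoTensor n x)

/-- `dσ` lies in the ideal whenever the local one-form `σ` does. -/
def FormIdeal.IsDifferential {n : ℕ} {X : Type*} [TopologicalSpace X]
    [ChartedSpace (EuclideanSpace ℝ (Fin n)) X] [IsManifold (𝓡 n) ∞ X]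
    (I : FormIdeal n X) : Prop :=
  ∀ (U : Set X) (σ : OneForm n X), IsOpen U → SmoothOn U σ →
    (∀ q ∈ U, σ q ∈ I.deg1 q) → ∀ q ∈ U, extD σ q ∈ I.deg2 q

/-- Hyperbolic Monge-Ampère systems on a five-manifold: locally there is a coframing
`(θ, η¹, …, η⁴)` with `θ` a contact form and `I = ⟨θ, η¹ ∧ η², η³ ∧ η⁴⟩` (algebraically), and
`I` is differentially closed. The contact condition `θ ∧ (dθ)² ≠ 0` is written as nondegeneracy
of `dθ` on `ker θ`. -/
def IsHyperbolicMongeAmpere {M : Type*} [TopologicalSpace M]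
    [ChartedSpace (EuclideanSpace ℝ (Fin 5)) M] [IsManifold (𝓡 5) ∞ M]
    (I : FormIdeal 5 M) : Prop :=
  I.IsDifferential ∧
  ∀ x : M, ∃ (U : Set M) (η : Fin 5 → OneForm 5 M), x ∈ U ∧ IsCoframing U η ∧ ∀ y ∈ U,
    I.deg1 y = Submodule.span ℝ {η 0 y} ∧
    I.deg2 y = wedgeSpan (I.deg1 y) ⊔
      Submodule.span ℝ {wedge (η 1 y) (η 2 y), wedge (η 3 y) (η 4 y)} ∧
    ∀ v : TangentSpace (𝓡 5) y, η 0 y v = 0 →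
      (∀ u : TangentSpace (𝓡 5) y, η 0 y u = 0 → extD (η 0) y v u = 0) → v = 0

section Maps

variable {m n : ℕ} {N M : Type*} [TopologicalSpace N] [TopologicalSpace M]
  [ChartedSpace (EuclideanSpace ℝ (Fin m)) N] [ChartedSpace (EuclideanSpace ℝ (Fin n)) M]

/-- The fibre at `p` of the pulled back bundle `π^* I¹`. -/
def pullback1 (π : N → M) (I : FormIdeal n M) (p : N) : Submodule ℝ (Covector m p) :=
  Submodule.span ℝ {κ | ∃ β ∈ I.deg1 (π p), κ = β.comp (mfderiv (𝓡 m) (𝓡 n) π p)}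

/-- The fibre at `p` of the pulled back bundle `π^* I²`. -/
def pullback2 (π : N → M) (I : FormIdeal n M) (p : N) : Submodule ℝ (TwoTensor m p) :=
  let D : TangentSpace (𝓡 m) p →L[ℝ] TangentSpace (𝓡 n) (π p) := mfderiv (𝓡 m) (𝓡 n) π p
  Submodule.span ℝ {Ψ | ∃ Φ ∈ I.deg2 (π p),
    Ψ = LinearMap.mk₂ ℝ (fun v u => Φ (D v) (D u))
      (fun _ _ _ => by simp only [map_add, LinearMap.add_apply])
      (fun _ _ _ => by simp only [map_smul, LinearMap.smul_apply])
      (fun _ _ _ => by simp only [map_add])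
      (fun _ _ _ => by simp only [map_smul])}

/-- `π : (N, J) → (M, I)` is an integrable extension of rank `k`: a submersion with
`k`-dimensional fibres such that, locally, `J` is algebraically generated by `π^* I` and the
sections of a rank `k` bundle `Θ` (spanned by `θ¹, …, θᵏ`) with `Θ^⊥ ∩ ker π_* = 0`. -/
structure IsIntegrableExtension [IsManifold (𝓡 m) ∞ N] [IsManifold (𝓡 n) ∞ M]
    (k : ℕ) (π : N → M) (J : FormIdeal m N) (I : FormIdeal n M) : Prop where
  smooth : ContMDiff (𝓡 m) (𝓡 n) ∞ π
  submersion : ∀ p, Function.Surjective (mfderiv (𝓡 m) (𝓡 n) π p)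
  fibre_dim : m = n + k
  local_form : ∀ p : N, ∃ (U : Set N) (θ : Fin k → OneForm m N), IsOpen U ∧ p ∈ U ∧
    (∀ i, SmoothOn U (θ i)) ∧ ∀ q ∈ U,
      LinearIndependent ℝ (fun i => θ i q) ∧
      J.deg1 q = pullback1 π I q ⊔ Submodule.span ℝ (Set.range fun i => θ i q) ∧
      J.deg2 q = wedgeSpan (J.deg1 q) ⊔ pullback2 π I q ∧
      ∀ v : TangentSpace (𝓡 m) q,
        mfderiv (𝓡 m) (𝓡 n) π q v = 0 → (∀ i, θ i q v = 0) → v = 0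

end Maps

/-- `(χ₁₀, χ₀₁)` is an ordered pair of characteristic systems of the hyperbolic system `(N, B)`
of class three: locally `B = ⟨κ⁰, κ¹, κ², η¹ ∧ η², η³ ∧ η⁴⟩` (algebraically) for a coframing
`(κ⁰, κ¹, κ², η¹, …, η⁴)`, and `χ₁₀ = [[κ⁰, κ¹, κ², η¹, η²]]`, `χ₀₁ = [[κ⁰, κ¹, κ², η³, η⁴]]`. -/
def IsCharacteristicPair {N : Type*} [TopologicalSpace N]
    [ChartedSpace (EuclideanSpace ℝ (Fin 7)) N] [IsManifold (𝓡 7) ∞ N]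
    (B : FormIdeal 7 N) (χ₁₀ χ₀₁ : ∀ p : N, Submodule ℝ (Covector (X := N) 7 p)) : Prop :=
  ∀ p : N, ∃ (U : Set N) (κ : Fin 7 → OneForm 7 N), p ∈ U ∧ IsCoframing U κ ∧ ∀ q ∈ U,
    B.deg1 q = Submodule.span ℝ {κ 0 q, κ 1 q, κ 2 q} ∧
    B.deg2 q = wedgeSpan (B.deg1 q) ⊔
      Submodule.span ℝ {wedge (κ 3 q) (κ 4 q), wedge (κ 5 q) (κ 6 q)} ∧
    χ₁₀ q = Submodule.span ℝ {κ 0 q, κ 1 q, κ 2 q, κ 3 q, κ 4 q} ∧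
    χ₀₁ q = Submodule.span ℝ {κ 0 q, κ 1 q, κ 2 q, κ 5 q, κ 6 q}

/-- A rank two Bäcklund transformation `(N, B; π, π')` relating two hyperbolic Monge-Ampère
systems `(M, I)` and `(M', I')`, with an ordered pair of characteristic systems of `(N, B)`. -/
structure RankTwoBacklund (N M M' : Type*)
    [TopologicalSpace N] [ChartedSpace (EuclideanSpace ℝ (Fin 7)) N] [IsManifold (𝓡 7) ∞ N]
    [TopologicalSpace M] [ChartedSpace (EuclideanSpace ℝ (Fin 5)) M] [IsManifold (𝓡 5) ∞ M]
    [TopologicalSpace M'] [ChartedSpace (EuclideanSpace ℝ (Fin 5)) M']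
    [IsManifold (𝓡 5) ∞ M'] where
  B : FormIdeal 7 N
  I : FormIdeal 5 M
  I' : FormIdeal 5 M'
  π : N → M
  π' : N → M'
  χ₁₀ : ∀ p : N, Submodule ℝ (Covector 7 p)
  χ₀₁ : ∀ p : N, Submodule ℝ (Covector 7 p)
  closed : B.IsDifferential
  mongeAmpere : IsHyperbolicMongeAmpere I
  mongeAmpere' : IsHyperbolicMongeAmpere I'
  extension : IsIntegrableExtension 2 π B I
  extension' : IsIntegrableExtension 2 π' B I'
  characteristic : IsCharacteristicPair B χ₁₀ χ₀₁

namespace RankTwoBacklund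

variable {N M M' : Type*}
  [TopologicalSpace N] [ChartedSpace (EuclideanSpace ℝ (Fin 7)) N] [IsManifold (𝓡 7) ∞ N]
  [TopologicalSpace M] [ChartedSpace (EuclideanSpace ℝ (Fin 5)) M] [IsManifold (𝓡 5) ∞ M]
  [TopologicalSpace M'] [ChartedSpace (EuclideanSpace ℝ (Fin 5)) M'] [IsManifold (𝓡 5) ∞ M']

/-- First genericity condition: `π^* I¹ ∩ π'^* I'¹ = 0`. -/
def FirstGenericity (𝔅 : RankTwoBacklund N M M') : Prop :=
  ∀ p : N, pullback1 (m := 7) 𝔅.π 𝔅.I p ⊓ pullback1 𝔅.π' 𝔅.I' p = ⊥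

/-- Second genericity condition at `p`: for local generators `θ` of `π^* I¹` and `θ'` of
`π'^* I'¹`, the forms `dθ` and `dθ'` are linearly independent at `p` modulo `B¹`. -/
def SecondGenericityAt (𝔅 : RankTwoBacklund N M M') (p : N) : Prop :=
  ∀ (U : Set N) (θ θ' : OneForm 7 N), IsOpen U → p ∈ U → SmoothOn U θ → SmoothOn U θ' →
    (∀ q ∈ U, Submodule.span ℝ {θ q} = pullback1 𝔅.π 𝔅.I q ∧
      Submodule.span ℝ {θ' q} = pullback1 𝔅.π' 𝔅.I' q) →
    ∀ s t : ℝ, s • extD θ p + t • extD θ' p ∈ wedgeSpan (𝔅.B.deg1 p) → s = 0 ∧ t = 0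

/-- Type `𝓑`: the first genericity condition holds and the second one fails (everywhere). -/
def IsTypeB (𝔅 : RankTwoBacklund N M M') : Prop :=
  𝔅.FirstGenericity ∧ ∀ p : N, ¬ 𝔅.SecondGenericityAt p

/-- `B` is Pfaffian: it is differentially generated by its degree one part. -/
def IsPfaffian (𝔅 : RankTwoBacklund N M M') : Prop :=
  ∀ p : N, 𝔅.B.deg2 p = wedgeSpan (𝔅.B.deg1 p) ⊔
    Submodule.span ℝ {Ψ | ∃ (U : Set N) (σ : OneForm 7 N), IsOpen U ∧ p ∈ U ∧ SmoothOn U σ ∧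
      (∀ q ∈ U, σ q ∈ 𝔅.B.deg1 q) ∧ Ψ = extD σ p}

/-- The coframing `w = (ω⁰, ω̄⁰, γ, ω¹, ω², ω³, ω⁴)` on `U` is `0`-adapted, with
`b = (B₁, B₂, B₃, B₄)` the functions in the congruences for `dω⁰` and `dω̄⁰`. -/
structure IsZeroAdapted (𝔅 : RankTwoBacklund N M M') (U : Set N) (w : Fin 7 → OneForm 7 N)
    (b : Fin 4 → N → ℝ) : Prop where
  coframing : IsCoframing U w
  span_omega : ∀ q ∈ U, Submodule.span ℝ {w 0 q} = pullback1 𝔅.π 𝔅.I q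
  span_omegaBar : ∀ q ∈ U, Submodule.span ℝ {w 1 q} = pullback1 𝔅.π' 𝔅.I' q
  span_gamma : ∀ q ∈ U, Submodule.span ℝ {w 0 q, w 1 q, w 2 q} = 𝔅.B.deg1 q
  char₁₀ : ∀ q ∈ U, 𝔅.χ₁₀ q = Submodule.span ℝ {w 0 q, w 1 q, w 2 q, w 3 q, w 4 q}
  char₀₁ : ∀ q ∈ U, 𝔅.χ₀₁ q = Submodule.span ℝ {w 0 q, w 1 q, w 2 q, w 5 q, w 6 q}
  d_gamma : ∀ q ∈ U, CongrMod (extD (w 2) q)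
    (wedge (w 3 q) (w 4 q) - wedge (w 5 q) (w 6 q)) {w 0 q, w 1 q, w 2 q}
  d_omega : ∀ q ∈ U, CongrMod (extD (w 0) q)
    (wedge (w 3 q) (w 4 q) + wedge (w 5 q) (w 6 q)
      + wedge (b 2 q • w 5 q + b 3 q • w 6 q) (w 2 q)) {w 0 q}
  d_omegaBar : ∀ q ∈ U, CongrMod (extD (w 1) q)
    (wedge (w 3 q) (w 4 q) + wedge (w 5 q) (w 6 q)
      + wedge (b 0 q • w 3 q + b 1 q • w 4 q) (w 2 q)) {w 1 q}

/-- Type `𝓑₁`: Type `𝓑` with `B` Pfaffian, where around every point there is a `0`-adapted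
coframing for which `(B₁, B₂)` and `(B₃, B₄)` vanish nowhere. -/
def IsTypeB₁ (𝔅 : RankTwoBacklund N M M') : Prop :=
  𝔅.IsTypeB ∧ 𝔅.IsPfaffian ∧
  ∀ p : N, ∃ (U : Set N) (w : Fin 7 → OneForm 7 N) (b : Fin 4 → N → ℝ), p ∈ U ∧
    𝔅.IsZeroAdapted U w b ∧
    ∀ q ∈ U, (b 0 q ≠ 0 ∨ b 1 q ≠ 0) ∧ (b 2 q ≠ 0 ∨ b 3 q ≠ 0)

/-- `1`-adapted coframings: `0`-adapted with `(B₁, B₂) = (B₃, B₄) = (1, 0)`. These are the local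
sections of the `G`-structure of a Type `𝓑₁` transformation. -/
def IsOneAdapted (𝔅 : RankTwoBacklund N M M') (U : Set N) (w : Fin 7 → OneForm 7 N) : Prop :=
  𝔅.IsZeroAdapted U w ![fun _ => 1, fun _ => 0, fun _ => 1, fun _ => 0]

end RankTwoBacklund

/-! ## The structure group -/

/-- The group `G` of the structure. -/
def structureGroup : Set (Matrix (Fin 7) (Fin 7) ℝ) :=
  {g | ∃ r a b c : ℝ, r ≠ 0 ∧
    g = !![r, 0, 0, 0, 0, 0, 0;
           0, r, 0, 0, 0, 0, 0;
           c, -c, r, 0, 0, 0, 0;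
           0, 0, 0, 1, 0, 0, 0;
           -c, 0, 0, a, r, 0, 0;
           0, 0, 0, 0, 0, 1, 0;
           0, c, 0, 0, 0, b, r]}

/-- The right action `ω ↦ ω · g = g⁻¹ ω` on coframings (written as columns). -/
def coframeAct {N : Type*} [TopologicalSpace N] [ChartedSpace (EuclideanSpace ℝ (Fin 7)) N]
    (w : Fin 7 → OneForm 7 N) (g : Matrix (Fin 7) (Fin 7) ℝ) : Fin 7 → OneForm 7 N :=
  fun i x => ∑ j, (g⁻¹) i j • w j x

/-! ## The structure equations and the torsion functions -/

/-- All the coefficients in the torsion two-forms. `Tⁱ_jk` and `Tbⁱ_j` stand for `T^i_{jk}` and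
`\bar T^i_j`; the coefficients which are absorbed into the pseudo-connection, and
`T⁴₀ = - T²₀`, are left out. -/
structure TorsionCoefficients where
  (P₀ K P₁ P₂ P₃ P₄ Q₁ Q₂ Q₃ Q₄ C₁ C₂ C₃ C₄ S₁ S₂ S₃ S₄ : ℝ)
  (T1_0 T1_1 T1_2 Tb1_1 Tb1_2 R1_1 R1_2 T1_12 T1_13 T1_14 : ℝ)
  (T2_0 T2_2 Tb2_2 R2_2 : ℝ)
  (T3_0 T3_3 T3_4 Tb3_3 Tb3_4 R3_3 R3_4 T3_13 T3_23 T3_34 : ℝ)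
  (T4_4 Tb4_4 R4_4 : ℝ)

section StructureEquations

variable {N : Type*} [TopologicalSpace N] [ChartedSpace (EuclideanSpace ℝ (Fin 7)) N]

/-- The torsion two-forms `(Ω⁰, Ω̄⁰, Γ, Ω¹, Ω², Ω³, Ω⁴)` in terms of the coframe
`(o, o', γ, w1, w2, w3, w4)`. -/
def torsionForms (T : TorsionCoefficients) {p : N} (o o' γ w1 w2 w3 w4 : Covector 7 p) :
    Fin 7 → TwoTensor 7 p :=
  ![wedge w1 w2 + wedge w3 (w4 + γ)
      + wedge (T.P₀ • o' + T.K • γ + T.P₁ • w1 + T.P₂ • w2 + T.P₃ • w3 + T.P₄ • w4) o,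
    wedge w1 (w2 + γ) + wedge w3 w4
      + wedge (T.P₀ • o - T.K • γ + T.Q₁ • w1 + T.Q₂ • w2 + T.Q₃ • w3 + T.Q₄ • w4) o',
    wedge w1 w2 - wedge w3 w4
      + wedge (T.C₁ • w1 + T.C₂ • w2 + T.C₃ • w3 + T.C₄ • w4) (o + o'),
    T.T1_0 • wedge o o' + wedge o (T.T1_1 • w1 + T.T1_2 • (w2 + γ))
      + wedge o' (T.Tb1_1 • w1 + T.Tb1_2 • w2)
      + wedge γ (T.R1_1 • w1 + T.R1_2 • w2)
      + T.S₁ • wedge w3 (γ + w2 + w4)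
      + T.T1_12 • wedge w1 w2 + T.T1_13 • wedge w1 w3 + T.T1_14 • wedge w1 w4,
    T.T2_0 • wedge o o' + wedge o (T.C₃ • w3 + T.C₄ • w4 + T.T2_2 • (w2 + γ))
      + T.Tb2_2 • wedge o' w2
      + wedge γ (T.C₂ • o + T.R2_2 • w2)
      + T.S₂ • wedge w3 (γ + w2 + w4),
    T.T3_0 • wedge o' o + wedge o' (T.Tb3_3 • w3 + T.Tb3_4 • (w4 + γ))
      + wedge o (T.T3_3 • w3 + T.T3_4 • w4)
      + wedge γ (T.R3_3 • w3 + T.R3_4 • w4)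
      + T.S₃ • wedge w1 (γ + w2 + w4)
      + T.T3_13 • wedge w1 w3 + T.T3_23 • wedge w2 w3 + T.T3_34 • wedge w3 w4,
    (-T.T2_0) • wedge o' o + wedge o' (T.C₁ • w1 + T.C₂ • w2 + T.Tb4_4 • (w4 + γ))
      + T.T4_4 • wedge o w4
      + wedge γ (T.C₄ • o' + T.R4_4 • w4)
      + T.S₄ • wedge w1 (γ + w2 + w4)]

/-- The structure equations `dω = -φ ∧ ω + Ω` at the point `p`, for some pseudo-connection forms
`φ, ϖ, α, β` and the torsion coefficients `T`. -/
def StructureEquationsAt (w : Fin 7 → OneForm 7 N) (p : N) (T : TorsionCoefficients) : Prop :=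
  ∃ φ ϖ α β : Covector 7 p,
    (fun i => extD (w i) p) =
      ![-wedge φ (w 0 p),
        -wedge φ (w 1 p),
        -(wedge ϖ (w 0 p) - wedge ϖ (w 1 p) + wedge φ (w 2 p)),
        0,
        -(-wedge ϖ (w 0 p) + wedge α (w 3 p) + wedge φ (w 4 p)),
        0,
        -(wedge ϖ (w 1 p) + wedge β (w 5 p) + wedge φ (w 6 p))]
      + torsionForms T (w 0 p) (w 1 p) (w 2 p) (w 3 p) (w 4 p) (w 5 p) (w 6 p)

/-- All torsion coefficients in terms of the twenty torsion functions that remain after the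
relations given by `d² = 0`. The twenty functions are listed in the order
`C₁, P₁, P₂, P₃, P₄, R¹₁, R¹₂, R³₃, R³₄, T¹₀, T²₀, T³₀, T¹₁, T¹₂, T̄¹₁, T̄¹₂, T̄³₃, T̄³₄, T³₃, T³₄`. -/
def fullTorsion (τ : Fin 20 → ℝ) : TorsionCoefficients :=
  let C₁ := τ 0
  let P₁ := τ 1
  let P₂ := τ 2
  let P₃ := τ 3
  let P₄ := τ 4
  let C₂ := 0
  let C₃ := -C₁
  let C₄ := 0
  let P₀ := 0
  let K := (P₄ - P₂) / 4
  { P₀ := P₀, K := K, P₁ := P₁, P₂ := P₂, P₃ := P₃, P₄ := P₄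
    Q₁ := P₁ + 1, Q₂ := P₂, Q₃ := P₃ + 1, Q₄ := P₄
    C₁ := C₁, C₂ := C₂, C₃ := C₃, C₄ := C₄
    S₁ := C₂ + P₂ / 2, S₂ := -C₁ - P₁ / 2, S₃ := -C₄ + P₄ / 2, S₄ := C₃ - (P₃ + 1) / 2
    T1_0 := τ 9, T1_1 := τ 12, T1_2 := τ 13, Tb1_1 := τ 14, Tb1_2 := τ 15
    R1_1 := τ 5, R1_2 := τ 6
    T1_12 := -2 * K - P₂ - C₄ + P₄ / 2
    T1_13 := -C₃ - C₁ - (P₁ + P₃ + 1) / 2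
    T1_14 := -C₄ - P₄ / 2
    T2_0 := τ 10
    T2_2 := P₀ - τ 12 + C₂
    Tb2_2 := P₀ - τ 14
    R2_2 := K + C₄ - τ 5 - P₄ / 2
    T3_0 := τ 11, T3_3 := τ 18, T3_4 := τ 19, Tb3_3 := τ 16, Tb3_4 := τ 17
    R3_3 := τ 7, R3_4 := τ 8
    T3_13 := -C₁ - C₃ + (P₁ + P₃ + 1) / 2
    T3_23 := -C₂ + P₂ / 2
    T3_34 := 2 * K - P₄ + C₂ + P₂ / 2
    T4_4 := P₀ - τ 18
    Tb4_4 := P₀ - τ 16 + C₄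
    R4_4 := -K - C₂ - τ 7 - P₂ / 2 }

/-- `τ` is the value at `p` of the twenty torsion functions of the coframing `w`. -/
def HasTorsionAt (w : Fin 7 → OneForm 7 N) (p : N) (τ : Fin 20 → ℝ) : Prop :=
  StructureEquationsAt w p (fullTorsion τ)

/-- The `G`-orbit, in the space `ℝ²⁰` of torsion values, of the torsion of `w` at `p`: the torsion
values at `p` of all the coframings `w · g`, `g ∈ G`. -/
def torsionOrbit (w : Fin 7 → OneForm 7 N) (p : N) : Set (Fin 20 → ℝ) :=
  {τ | ∃ g ∈ structureGroup, HasTorsionAt (coframeAct w g) p τ}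

/-- The one-form `σ` is integrable at every point of `U`: `dσ ≡ 0` modulo `σ`. -/
def IsIntegrableOn (σ : OneForm 7 N) (U : Set N) : Prop :=
  ∀ q ∈ U, CongrMod (extD σ q) 0 {σ q}

end StructureEquations

end Backlund

end

open scoped Manifold ContDiff

noncomputable section

namespace Backlund

set_option maxSynthPendingDepth 3
set_option linter.unusedSimpArgs false
set_option linter.flexible false

/-! The indices 0, ..., 6 stand for ω⁰, ω̄⁰, γ, ω¹, ω², ω³, ω⁴, so ω¹ and ω³ are `w 3` and `w 5`.
Apart from multiples of ω¹, the form dω¹ involves only P₂, R¹₂, T¹₀, T¹₂, T̄¹₂ (entries 2, 6, 9, 13,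
15 of `τ`); apart from multiples of ω³, dω³ involves only P₄, R³₄, T³₀, T³₄, T̄³₄ (entries 4, 8, 11,
19, 17). Hence ω¹ and ω³ are integrable exactly when these ten functions vanish
(`HasTorsionAt.congrMod_three`, `HasTorsionAt.congrMod_five`, `HasTorsionAt.eq_zero_of_congrMod`).

With c = r k, the group acts on the torsion by the polynomial formulas of `torsionAct`
(`torsionOrbit_eq`). Every term containing a or b has one of the ten functions as a factor. If all
ten vanish, an orbit depends on r and k alone and lies in a C¹ image of ℝ², so its dimension is at
most 2 (`dimH_setOf_torsionAct_le`). If one of them is nonzero, then, taking them in a suitable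
order, r rescales it, a or b moves a second torsion function freely and k moves P₁ or P₃. The orbit
then projects onto a set with interior in ℝ³ and has dimension at least 3 (`eq_zero_of_dimH_le`).

What remains is that a 1-adapted coframing has torsion functions of the stated form at all; with no
torsion values the orbit would be empty and the bound on its dimension would say nothing. Let `c i j
k` be the coefficients of the forms dωⁱ in the dual frame. Three sources give enough relations among
them. The congruences that define adaptedness fix some coefficients as constants. Each of the two
integrable extensions forces the coframing to be compatible with its fibres: the semi-basic factors
of the two decomposable generators of the pulled back system are preserved along the fibres
(`IsFibreCoframing.extD_eq_zero`). Finally d² = 0 (`IsDualFrameAt.jacobi`) is used in those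
components, or combinations of components, in which the derivatives of the unknown coefficients drop
out: where the coefficients are constants (`LinearRelations`), where those of dω⁰ and dω̄⁰ differ by
constants (`SecondRelations`), and in one combination for γ
(`RankTwoBacklund.IsOneAdapted.gammaRelation`). Together they put the structure equations in normal
form (`exists_hasTorsionAt`). -/

/-! ## Exterior calculus in a normed space -/

section Curl

variable {E F : Type*} [NormedAddCommGroup E] [NormedSpace ℝ E]
  [NormedAddCommGroup F] [NormedSpace ℝ F]

/-- The exterior derivative of a one-form on a normed space. -/
def curl (s : E → E →L[ℝ] ℝ) (y v u : E) : ℝ := fderiv ℝ s y v u - fderiv ℝ s y u v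

theorem curl_swap (s : E → E →L[ℝ] ℝ) (y v u : E) : curl s y v u = -curl s y u v := by
  simp only [curl]; ring

theorem curl_congr {s t : E → E →L[ℝ] ℝ} {y : E} (h : s =ᶠ[nhds y] t) (v u : E) :
    curl s y v u = curl t y v u := by
  simp only [curl, h.fderiv_eq]

/-- The exterior derivative commutes with pullback. -/
theorem curl_pullback {f : E → F} {s : F → F →L[ℝ] ℝ} {y : E} (hf : ContDiffAt ℝ 2 f y)
    (hs : DifferentiableAt ℝ s (f y)) (v u : E) :
    curl (fun z => (s (f z)).comp (fderiv ℝ f z)) y v u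
      = curl s (f y) (fderiv ℝ f y v) (fderiv ℝ f y u) := by
  have hf1 : DifferentiableAt ℝ f y := hf.differentiableAt (by norm_num)
  have hf2 : DifferentiableAt ℝ (fderiv ℝ f) y :=
    (hf.fderiv_right (m := 1) (by norm_num)).differentiableAt (by norm_num)
  have hsymm : IsSymmSndFDerivAt ℝ f y := hf.isSymmSndFDerivAt (by simp)
  have hd : HasFDerivAt (fun z => s (f z)) ((fderiv ℝ s (f y)).comp (fderiv ℝ f y)) y :=
    hs.hasFDerivAt.comp y hf1.hasFDerivAt
  have h := hd.clm_comp hf2.hasFDerivAt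
  simp only [curl, h.fderiv]
  -- The only extra term is `s (f y)` applied to the second derivative of `f`, which is symmetric
  -- and disappears on antisymmetrizing.
  have := hsymm v u
  simp [this]

theorem curl_smul {α s : E → E →L[ℝ] ℝ} {h : E → ℝ} {y : E} (hα : α =ᶠ[nhds y] fun z => h z • s z)
    (hh : DifferentiableAt ℝ h y) (hs : DifferentiableAt ℝ s y) (v u : E) :
    curl α y v u = fderiv ℝ h y v * s y u - fderiv ℝ h y u * s y v + h y * curl s y v u := by
  have h1 : HasFDerivAt (fun z => h z • s z) _ y := hh.hasFDerivAt.smul hs.hasFDerivAt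
  rw [curl_congr hα]
  simp only [curl, h1.fderiv]
  simp
  ring

/-- The structure functions of the coframe `s` with respect to the dual frame `e`. -/
def structureFn {ι : Type*} (s : ι → E → E →L[ℝ] ℝ) (e : ι → E → E) (i j k : ι) (y : E) : ℝ :=
  curl (s i) y (e j y) (e k y)

theorem structureFn_swap {ι : Type*} (s : ι → E → E →L[ℝ] ℝ) (e : ι → E → E) (y : E) (i j k : ι) : structureFn s e i j k y = -structureFn s e i k j y :=
  curl_swap _ _ _ _

variable {ι : Type*} [Fintype ι] [DecidableEq ι]

/-- At `y`, the vector fields `e` form a differentiable local frame dual to the one-forms `s`. -/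
structure IsDualFrameAt (s : ι → E → E →L[ℝ] ℝ) (e : ι → E → E) (y : E) : Prop where
  diff_form : ∀ i, DifferentiableAt ℝ (s i) y
  diff_frame : ∀ i, DifferentiableAt ℝ (e i) y
  dual : ∀ᶠ z in nhds y, ∀ i j, s i z (e j z) = if i = j then 1 else 0
  expand : ∀ v, v = ∑ i, s i y v • e i y

variable {s : ι → E → E →L[ℝ] ℝ} {e : ι → E → E} {y : E}

/-- Differentiating the constant pairings sᵢ(eⱼ) trades derivatives of the frame for derivatives of
the coframe. This is how the brackets of the frame fields become structure functions. -/
theorem IsDualFrameAt.fderiv_frame (h : IsDualFrameAt s e y) (i j : ι) (v : E) :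
    s i y (fderiv ℝ (e j) y v) = -fderiv ℝ (s i) y v (e j y) := by
  have h1 := ((h.diff_form i).hasFDerivAt.clm_apply (h.diff_frame j).hasFDerivAt)
  have h2 : (fun z => s i z (e j z)) =ᶠ[nhds y] fun _ => if i = j then (1 : ℝ) else 0 :=
    h.dual.mono fun z hz => hz i j
  have h3 := h2.fderiv_eq (𝕜 := ℝ)
  rw [h1.fderiv] at h3
  have h4 := congrArg (fun L : E →L[ℝ] ℝ => L v) h3
  simp at h4
  linarith

/-- The bracket of the frame fields. -/
theorem IsDualFrameAt.bracket (h : IsDualFrameAt s e y) (j k : ι) :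
    fderiv ℝ (e k) y (e j y) - fderiv ℝ (e j) y (e k y)
      = -∑ m, curl (s m) y (e j y) (e k y) • e m y := by
  rw [h.expand (fderiv ℝ (e k) y (e j y) - fderiv ℝ (e j) y (e k y)), ← Finset.sum_neg_distrib]
  refine Finset.sum_congr rfl fun m _ => ?_
  rw [map_sub, h.fderiv_frame, h.fderiv_frame, ← neg_smul]
  congr 1
  simp only [curl]; ring

/-- The exterior derivative of a two-form in terms of a frame. -/
theorem IsDualFrameAt.cyclic (h : IsDualFrameAt s e y) {Φ : E → E →L[ℝ] E →L[ℝ] ℝ}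
    (hΦ : DifferentiableAt ℝ Φ y) (hanti : ∀ v u, Φ y v u = -Φ y u v) (a b d : ι) :
    fderiv ℝ Φ y (e a y) (e b y) (e d y) + fderiv ℝ Φ y (e b y) (e d y) (e a y)
        + fderiv ℝ Φ y (e d y) (e a y) (e b y)
      = (fderiv ℝ (fun z => Φ z (e b z) (e d z)) y (e a y)
          + ∑ m, curl (s m) y (e a y) (e b y) * Φ y (e m y) (e d y))
        + (fderiv ℝ (fun z => Φ z (e d z) (e a z)) y (e b y)
          + ∑ m, curl (s m) y (e b y) (e d y) * Φ y (e m y) (e a y))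
        + (fderiv ℝ (fun z => Φ z (e a z) (e b z)) y (e d y)
          + ∑ m, curl (s m) y (e d y) (e a y) * Φ y (e m y) (e b y)) := by
  have h1 : ∀ j k l, fderiv ℝ (fun z => Φ z (e j z) (e k z)) y (e l y)
      = fderiv ℝ Φ y (e l y) (e j y) (e k y) + Φ y (fderiv ℝ (e j) y (e l y)) (e k y)
        + Φ y (e j y) (fderiv ℝ (e k) y (e l y)) := by
    intro j k l
    rw [((hΦ.hasFDerivAt.clm_apply (h.diff_frame j).hasFDerivAt).clm_apply
      (h.diff_frame k).hasFDerivAt).fderiv]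
    simp
    ring
  have h2 : ∀ j k l, ∑ m, curl (s m) y (e j y) (e k y) * Φ y (e m y) (e l y)
      = Φ y (fderiv ℝ (e j) y (e k y)) (e l y) - Φ y (fderiv ℝ (e k) y (e j y)) (e l y) := by
    intro j k l
    have h3 := congrArg (fun v => Φ y v (e l y)) (h.bracket j k)
    simp only [map_sub, map_neg, map_sum, map_smul, sub_apply, neg_apply, sum_apply, smul_apply,
      smul_eq_mul] at h3
    linarith
  rw [h1, h1, h1, h2, h2, h2]
  -- After three transpositions, the terms with differentiated frame fields coming from the Leibniz
  -- rule cancel those coming from the brackets.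
  rw [hanti (e b y) (fderiv ℝ (e d) y (e a y)), hanti (e d y) (fderiv ℝ (e a) y (e b y)),
    hanti (e a y) (fderiv ℝ (e b) y (e d y))]
  ring

theorem differentiableAt_structureFn (h : IsDualFrameAt s e y) {i : ι} (hs : ContDiffAt ℝ 2 (s i) y)
    (j k : ι) : DifferentiableAt ℝ (structureFn s e i j k) y := by
  have hf2 : DifferentiableAt ℝ (fderiv ℝ (s i)) y :=
    (hs.fderiv_right (m := 1) (by norm_num)).differentiableAt (by norm_num)
  have hj := h.diff_frame j
  have hk := h.diff_frame k
  exact ((hf2.clm_apply hj).clm_apply hk).sub ((hf2.clm_apply hk).clm_apply hj)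

/-- The identity `d² = 0` in terms of the structure functions. -/
theorem IsDualFrameAt.jacobi (h : IsDualFrameAt s e y) {i : ι} (hs : ContDiffAt ℝ 2 (s i) y)
    (a b d : ι) :
    (fderiv ℝ (structureFn s e i b d) y (e a y)
        + ∑ m, structureFn s e m a b y * structureFn s e i m d y)
      + (fderiv ℝ (structureFn s e i d a) y (e b y)
        + ∑ m, structureFn s e m b d y * structureFn s e i m a y)
      + (fderiv ℝ (structureFn s e i a b) y (e d y)
        + ∑ m, structureFn s e m d a y * structureFn s e i m b y) = 0 := by
  have hf2 : DifferentiableAt ℝ (fderiv ℝ (s i)) y :=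
    (hs.fderiv_right (m := 1) (by norm_num)).differentiableAt (by norm_num)
  have hsymm : IsSymmSndFDerivAt ℝ (s i) y := hs.isSymmSndFDerivAt (by simp)
  -- The two-form ds is the derivative of s minus its transpose. Its cyclic sum vanishes by the
  -- symmetry of the second derivative of s, which leaves the frame expression equal to zero.
  let Fl : (E →L[ℝ] E →L[ℝ] ℝ) →L[ℝ] (E →L[ℝ] E →L[ℝ] ℝ) :=
    (ContinuousLinearMap.flipₗᵢ ℝ E E ℝ).toContinuousLinearEquiv.toContinuousLinearMap
  have hΦ : HasFDerivAt (fun z => fderiv ℝ (s i) z - Fl (fderiv ℝ (s i) z))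
      (fderiv ℝ (fderiv ℝ (s i)) y - Fl.comp (fderiv ℝ (fderiv ℝ (s i)) y)) y :=
    hf2.hasFDerivAt.sub (Fl.hasFDerivAt.comp y hf2.hasFDerivAt)
  have key := h.cyclic hΦ.differentiableAt (by intro v u; simp [Fl]) a b d
  rw [hΦ.fderiv] at key
  have hs1 := congrArg (fun L : E →L[ℝ] ℝ => L (e d y)) (hsymm (e a y) (e b y))
  have hs2 := congrArg (fun L : E →L[ℝ] ℝ => L (e a y)) (hsymm (e b y) (e d y))
  have hs3 := congrArg (fun L : E →L[ℝ] ℝ => L (e b y)) (hsymm (e d y) (e a y))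
  have hz : ∀ j k, (fun z => (fderiv ℝ (s i) z - Fl (fderiv ℝ (s i) z)) (e j z) (e k z))
      = structureFn s e i j k := by
    intro j k; ext z; simp [Fl, structureFn, curl]
  simp only [hz] at key
  have hz' : ∀ j k, (fderiv ℝ (s i) y - Fl (fderiv ℝ (s i) y)) (e j y) (e k y)
      = structureFn s e i j k y := fun j k => congrFun (hz j k) y
  simp only [hz'] at key
  have hz2 : ∀ m j k, curl (s m) y (e j y) (e k y) = structureFn s e m j k y := fun _ _ _ => rfl
  simp only [hz2] at key
  rw [← key]
  simp [Fl] at hs1 hs2 hs3 ⊢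
  linarith

/-- The frame formula for the exterior derivative of `α ∧ β` when both factors and their
derivatives are annihilated by the frame field `e a`. -/
theorem IsDualFrameAt.cyclic_wedge (h : IsDualFrameAt s e y) {α β : E → E →L[ℝ] ℝ}
    (hα : DifferentiableAt ℝ α y) (hβ : DifferentiableAt ℝ β y) {a : ι}
    (hαa : α y (e a y) = 0) (hβa : β y (e a y) = 0)
    (hdα : ∀ u, curl α y (e a y) u = 0) (hdβ : ∀ u, curl β y (e a y) u = 0)
    {A : ι → ι → E → ℝ}
    (hA : ∀ j k, A j k = fun z => α z (e j z) * β z (e k z) - β z (e j z) * α z (e k z))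
    (b d : ι) :
    (fderiv ℝ (A b d) y (e a y) + ∑ m, structureFn s e m a b y * A m d y)
      + (fderiv ℝ (A d a) y (e b y) + ∑ m, structureFn s e m b d y * A m a y)
      + (fderiv ℝ (A a b) y (e d y) + ∑ m, structureFn s e m d a y * A m b y) = 0 := by
  let S : (E →L[ℝ] ℝ) →L[ℝ] (E →L[ℝ] ℝ) →L[ℝ] (E →L[ℝ] E →L[ℝ] ℝ) :=
    ContinuousLinearMap.smulRightL ℝ E (E →L[ℝ] ℝ)
  have hS : ∀ (α β : E →L[ℝ] ℝ) (v u : E), S α β v u = α v * β u := fun α β v u => by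
    simp [S]
  have hd : ∀ {α β : E → E →L[ℝ] ℝ}, DifferentiableAt ℝ α y → DifferentiableAt ℝ β y →
      HasFDerivAt (fun z => S (α z) (β z))
        ((S (α y)).comp (fderiv ℝ β y) + ((S.comp (fderiv ℝ α y)).flip (β y))) y := by
    intro α β hα hβ
    exact ((S.hasFDerivAt.comp y hα.hasFDerivAt).clm_apply hβ.hasFDerivAt)
  have hΦ := (hd hα hβ).sub (hd hβ hα)
  have key := h.cyclic hΦ.differentiableAt (by intro v u; simp [hS]; ring) a b d
  have e1 : ∀ j k, (fun z => ((fun z => S (α z) (β z)) - fun z => S (β z) (α z)) z (e j z) (e k z))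
      = A j k := by
    intro j k; rw [hA]; ext z; simp [hS]
  have e2 : ∀ j k, ((fun z => S (α z) (β z)) - fun z => S (β z) (α z)) y (e j y) (e k y)
      = A j k y := fun j k => congrFun (e1 j k) y
  rw [hΦ.fderiv] at key
  simp only [e1, e2] at key
  have hz2 : ∀ m j k, curl (s m) y (e j y) (e k y) = structureFn s e m j k y := fun _ _ _ => rfl
  simp only [hz2] at key
  rw [← key]
  -- The derivative d(α ∧ β) = dα ∧ β - α ∧ dβ, contracted with `e a`, only involves the
  -- contractions of α, β, dα, dβ with `e a`, all of which vanish.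
  have a1 := hdα (e b y)
  have a2 := hdα (e d y)
  have b1 := hdβ (e b y)
  have b2 := hdβ (e d y)
  simp only [curl] at a1 a2 b1 b2
  simp [hS, hαa, hβa]
  linear_combination β y (e d y) * a1 - β y (e b y) * a2 - α y (e d y) * b1 + α y (e b y) * b2

end Curl

/-! ## Forms on a manifold in charts -/

section Charts

variable {n m : ℕ} {X Y : Type*} [TopologicalSpace X] [ChartedSpace (EuclideanSpace ℝ (Fin n)) X]
  [TopologicalSpace Y] [ChartedSpace (EuclideanSpace ℝ (Fin m)) Y]

/-- The pullback of a field of covectors. -/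
def pullForm (f : X → Y) (η : OneForm m Y) : OneForm n X :=
  fun q => (η (f q)).comp (mfderiv (𝓡 n) (𝓡 m) f q)

/-- The derivative of the inverse of the chart at `p`. -/
def chartInv (p : X) (y : EuclideanSpace ℝ (Fin n)) :
    EuclideanSpace ℝ (Fin n) →L[ℝ] EuclideanSpace ℝ (Fin n) :=
  mfderiv 𝓘(ℝ, EuclideanSpace ℝ (Fin n)) (𝓡 n) (extChartAt (𝓡 n) p).symm y

/-- The derivative of the chart at `p`. -/
def chartDer (p q : X) : EuclideanSpace ℝ (Fin n) →L[ℝ] EuclideanSpace ℝ (Fin n) :=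
  mfderiv (𝓡 n) 𝓘(ℝ, EuclideanSpace ℝ (Fin n)) (extChartAt (𝓡 n) p) q

theorem coordRep_apply (η : OneForm n X) {p z : X} (hz : z ∈ (extChartAt (𝓡 n) p).source)
    (v : EuclideanSpace ℝ (Fin n)) :
    coordRep η p (extChartAt (𝓡 n) p z) v = η z (chartInv p (extChartAt (𝓡 n) p z) v) := by
  -- The type of the covector depends on its base point; in the model space all these types agree
  -- and the two base points can be identified.
  have h : ∀ (z' : X) (w : EuclideanSpace ℝ (Fin n)), z' = z →
      (η z' : EuclideanSpace ℝ (Fin n) →L[ℝ] ℝ) w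
        = (η z : EuclideanSpace ℝ (Fin n) →L[ℝ] ℝ) w := by
    rintro z' w rfl; rfl
  exact h _ _ ((extChartAt (𝓡 n) p).left_inv hz)

theorem extD_apply (σ : OneForm n X) (p : X) (v u : TangentSpace (𝓡 n) p) :
    extD σ p v u = curl (coordRep σ p) (extChartAt (𝓡 n) p p) (chartDer p p v) (chartDer p p u) :=
  rfl

variable [IsManifold (𝓡 n) ∞ X] [IsManifold (𝓡 m) ∞ Y]

theorem mdifferentiableAt_symm {p z : X} (hz : z ∈ (extChartAt (𝓡 n) p).source) :
    MDifferentiableAt 𝓘(ℝ, EuclideanSpace ℝ (Fin n)) (𝓡 n) (extChartAt (𝓡 n) p).symm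
      (extChartAt (𝓡 n) p z) := by
  have h := mdifferentiableWithinAt_extChartAt_symm (I := 𝓡 n) ((extChartAt (𝓡 n) p).map_source hz)
  rwa [ModelWithCorners.range_eq_univ, mdifferentiableWithinAt_univ] at h

theorem chartInv_comp_chartDer {p z : X} (hz : z ∈ (extChartAt (𝓡 n) p).source) :
    (chartInv p (extChartAt (𝓡 n) p z)).comp (chartDer p z)
      = ContinuousLinearMap.id ℝ (EuclideanSpace ℝ (Fin n)) := by
  have h := mfderivWithin_extChartAt_symm_comp_mfderiv_extChartAt' (I := 𝓡 n) hz
  rw [ModelWithCorners.range_eq_univ, mfderivWithin_univ] at h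
  exact h

/-- A map written in charts. -/
def chartMap (f : X → Y) (p : X) (x : Y) : EuclideanSpace ℝ (Fin n) → EuclideanSpace ℝ (Fin m) :=
  extChartAt (𝓡 m) x ∘ f ∘ (extChartAt (𝓡 n) p).symm

theorem contDiffAt_chartMap {f : X → Y} {p q : X} {x : Y}
    (hf : ContMDiffAt (𝓡 n) (𝓡 m) ∞ f q) (hq : q ∈ (extChartAt (𝓡 n) p).source)
    (hfq : f q ∈ (extChartAt (𝓡 m) x).source) :
    ContDiffAt ℝ ∞ (chartMap (n := n) (m := m) f p x) (extChartAt (𝓡 n) p q) := by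
  rw [extChartAt_source] at hq hfq
  have h := (contMDiffAt_iff_of_mem_source (x := p) (y := x) hq hfq).1 hf
  have h2 := h.2
  rwa [ModelWithCorners.range_eq_univ, contDiffWithinAt_univ] at h2

theorem fderiv_chartMap {f : X → Y} {p q : X} {x : Y}
    (hf : MDifferentiableAt (𝓡 n) (𝓡 m) f q) (hq : q ∈ (extChartAt (𝓡 n) p).source)
    (hfq : f q ∈ (extChartAt (𝓡 m) x).source) (v : EuclideanSpace ℝ (Fin n)) :
    fderiv ℝ (chartMap f p x) (extChartAt (𝓡 n) p q) v
      = chartDer x (f q) (mfderiv (𝓡 n) (𝓡 m) f q (chartInv p (extChartAt (𝓡 n) p q) v)) := by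
  have h1 := (mdifferentiableAt_symm hq).hasMFDerivAt
  have hq' := (extChartAt (𝓡 n) p).left_inv hq
  have h2 : HasMFDerivAt (𝓡 n) (𝓡 m) f ((extChartAt (𝓡 n) p).symm (extChartAt (𝓡 n) p q))
      (mfderiv (𝓡 n) (𝓡 m) f q) := by
    rw [hq']; exact hf.hasMFDerivAt
  have h3 : HasMFDerivAt (𝓡 m) 𝓘(ℝ, EuclideanSpace ℝ (Fin m)) (extChartAt (𝓡 m) x)
      (f ((extChartAt (𝓡 n) p).symm (extChartAt (𝓡 n) p q))) (chartDer x (f q)) := by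
    rw [hq']
    exact (mdifferentiableAt_extChartAt (by simpa using hfq)).hasMFDerivAt
  have h4 : HasMFDerivAt 𝓘(ℝ, EuclideanSpace ℝ (Fin n)) 𝓘(ℝ, EuclideanSpace ℝ (Fin m))
      (chartMap f p x) (extChartAt (𝓡 n) p q) _ :=
    HasMFDerivAt.comp (f := f ∘ (extChartAt (𝓡 n) p).symm) (extChartAt (𝓡 n) p q) h3
      (h2.comp (extChartAt (𝓡 n) p q) h1)
  have h5 : HasFDerivAt (chartMap (n := n) (m := m) f p x)
      ((chartDer x (f q)).comp ((mfderiv (𝓡 n) (𝓡 m) f q :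
        EuclideanSpace ℝ (Fin n) →L[ℝ] EuclideanSpace ℝ (Fin m)).comp
          (chartInv p (extChartAt (𝓡 n) p q)))) (extChartAt (𝓡 n) p q) :=
    h4.hasFDerivAt
  rw [h5.fderiv]
  rfl

/-- Inserting the identity `chartInv ∘ chartDer` of the target chart after the derivative of `f`
turns the pullback along `f` into the pullback along its chart expression. The equality holds near
the point only, where `f` stays in the domain of the chart at `x`. -/
theorem coordRep_pullForm {f : X → Y} {p q : X} {x : Y} (η : OneForm m Y)
    (hf : ContMDiffAt (𝓡 n) (𝓡 m) ∞ f q) (hq : q ∈ (extChartAt (𝓡 n) p).source)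
    (hfq : f q ∈ (extChartAt (𝓡 m) x).source) :
    coordRep (pullForm f η) p =ᶠ[nhds (extChartAt (𝓡 n) p q)]
      fun y => (coordRep η x (chartMap f p x y)).comp (fderiv ℝ (chartMap f p x) y) := by
  have h1 : ∀ᶠ z in nhds q, MDifferentiableAt (𝓡 n) (𝓡 m) f z ∧
      f z ∈ (extChartAt (𝓡 m) x).source := by
    have h2 : ∀ᶠ z in nhds q, ContMDiffAt (𝓡 n) (𝓡 m) 1 f z :=
      (contMDiffAt_iff_contMDiffAt_nhds (by simp)).1 (hf.of_le (by simp))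
    refine (h2.mono fun z hz => hz.mdifferentiableAt (by simp)).and ?_
    exact hf.continuousAt.preimage_mem_nhds ((isOpen_extChartAt_source x).mem_nhds hfq)
  have h3 : ContinuousAt (extChartAt (𝓡 n) p).symm (extChartAt (𝓡 n) p q) :=
    (mdifferentiableAt_symm hq).continuousAt
  have h4 : (extChartAt (𝓡 n) p).target ∈ nhds (extChartAt (𝓡 n) p q) :=
    (isOpen_extChartAt_target p).mem_nhds ((extChartAt (𝓡 n) p).map_source hq)
  have h5 : Filter.Tendsto (extChartAt (𝓡 n) p).symm (nhds (extChartAt (𝓡 n) p q)) (nhds q) := by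
    have := h3.tendsto
    rwa [(extChartAt (𝓡 n) p).left_inv hq] at this
  filter_upwards [h5.eventually h1, h4] with y hy hyt
  obtain ⟨z, hz, rfl⟩ : ∃ z ∈ (extChartAt (𝓡 n) p).source, extChartAt (𝓡 n) p z = y :=
    ⟨_, (extChartAt (𝓡 n) p).map_target hyt, (extChartAt (𝓡 n) p).right_inv hyt⟩
  rw [(extChartAt (𝓡 n) p).left_inv hz] at hy
  ext1 v
  have h6 : chartMap f p x (extChartAt (𝓡 n) p z) = extChartAt (𝓡 m) x (f z) := by
    simp only [chartMap, Function.comp_apply, (extChartAt (𝓡 n) p).left_inv hz]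
  rw [coordRep_apply _ hz, ContinuousLinearMap.comp_apply, h6, coordRep_apply _ hy.2,
    fderiv_chartMap hy.1 hz hy.2]
  have h7 := congrArg (fun L => L (mfderiv (𝓡 n) (𝓡 m) f z (chartInv p (extChartAt (𝓡 n) p z) v)))
    (chartInv_comp_chartDer hy.2)
  exact congrArg (η (f z)) h7.symm

theorem pullForm_id {X : Type*} [TopologicalSpace X]
    [ChartedSpace (EuclideanSpace ℝ (Fin n)) X] (σ : OneForm n X) : pullForm (id : X → X) σ = σ := by
  ext q v
  simp [pullForm]

/-- Over the chart domain of `q`, the trivialization of the tangent bundle centred at `q` is given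
by the derivative of that chart. The section in the induced trivialization of the cotangent bundle
is therefore `coordRep σ q`. -/
theorem SmoothOn.contDiffAt_self {U : Set X} {σ : OneForm n X} (hU : IsOpen U) (hσ : SmoothOn U σ)
    {q : X} (hq : q ∈ U) : ContDiffAt ℝ ∞ (coordRep σ q) (extChartAt (𝓡 n) q q) := by
  have h1 := (hσ q hq).contMDiffAt (hU.mem_nhds hq)
  have h2 := ((contMDiffAt_hom_bundle _).1 h1).2
  have h3 := (contMDiffAt_iff.1 h2).2
  rw [ModelWithCorners.range_eq_univ, contDiffWithinAt_univ, extChartAt_model_space_eq_id] at h3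
  refine h3.congr_of_eventuallyEq ?_
  filter_upwards [(isOpen_extChartAt_target q).mem_nhds (mem_extChartAt_target (I := 𝓡 n) q)]
    with y hy
  have hs := (extChartAt (𝓡 n) q).map_target hy
  ext1 v
  rw [extChartAt_source] at hs
  have h4 := TangentBundle.symmL_trivializationAt (I := 𝓡 n) hs
  rw [ModelWithCorners.range_eq_univ, mfderivWithin_univ, (extChartAt (𝓡 n) q).right_inv hy] at h4
  simp only [Function.comp_apply, ContinuousLinearMap.inCoordinates]
  erw [h4]
  simp [coordRep]

/-- A smooth form is smooth in every chart. -/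
theorem SmoothOn.contDiffAt {U : Set X} {σ : OneForm n X} (hU : IsOpen U) (hσ : SmoothOn U σ)
    {p q : X} (hq : q ∈ U) (hqp : q ∈ (extChartAt (𝓡 n) p).source) :
    ContDiffAt ℝ ∞ (coordRep σ p) (extChartAt (𝓡 n) p q) := by
  -- The identity map, read from the chart at `p` to the chart at `q`, is the transition map, so a
  -- change of chart is a special case of a pullback.
  have h1 := coordRep_pullForm (f := (id : X → X)) (x := q) σ contMDiffAt_id hqp
    (mem_extChartAt_source q)
  rw [pullForm_id] at h1
  refine ContDiffAt.congr_of_eventuallyEq ?_ h1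
  have h2 := contDiffAt_chartMap (f := (id : X → X)) (x := q) contMDiffAt_id hqp
    (mem_extChartAt_source q)
  have h3 : chartMap (id : X → X) p q (extChartAt (𝓡 n) p q) = extChartAt (𝓡 n) q q := by
    simp only [chartMap, Function.comp_apply, (extChartAt (𝓡 n) p).left_inv hqp, id]
  exact ContDiffAt.clm_comp (ContDiffAt.comp (g := coordRep σ q) _ (h3 ▸ hσ.contDiffAt_self hU hq) h2)
    (h2.fderiv_right (m := ∞) (by simp))

/-- Naturality of the exterior derivative, in charts. -/
theorem curl_coordRep_pullForm {f : X → Y} {p q : X} {U : Set Y} {η : OneForm m Y} (hU : IsOpen U)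
    (hη : SmoothOn U η) (hf : ContMDiffAt (𝓡 n) (𝓡 m) ∞ f q)
    (hq : q ∈ (extChartAt (𝓡 n) p).source) (hfq : f q ∈ U) (v u : EuclideanSpace ℝ (Fin n)) :
    curl (coordRep (pullForm f η) p) (extChartAt (𝓡 n) p q) v u
      = extD η (f q) (mfderiv (𝓡 n) (𝓡 m) f q (chartInv p (extChartAt (𝓡 n) p q) v))
          (mfderiv (𝓡 n) (𝓡 m) f q (chartInv p (extChartAt (𝓡 n) p q) u)) := by
  have h0 := mem_extChartAt_source (I := 𝓡 m) (f q)
  have h2 := contDiffAt_chartMap hf hq h0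
  have h6 : chartMap f p (f q) (extChartAt (𝓡 n) p q) = extChartAt (𝓡 m) (f q) (f q) := by
    simp only [chartMap, Function.comp_apply, (extChartAt (𝓡 n) p).left_inv hq]
  have h7 := (hη.contDiffAt hU hfq h0).differentiableAt (by simp)
  rw [curl_congr (coordRep_pullForm η hf hq h0),
    curl_pullback (h2.of_le ENat.LEInfty.out) (h6 ▸ h7), h6,
    fderiv_chartMap (hf.mdifferentiableAt (by simp)) hq h0,
    fderiv_chartMap (hf.mdifferentiableAt (by simp)) hq h0]
  rfl

/-- The exterior derivative may be computed in any chart. -/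
theorem curl_coordRep {U : Set X} {σ : OneForm n X} (hU : IsOpen U) (hσ : SmoothOn U σ) {p q : X}
    (hq : q ∈ U) (hqp : q ∈ (extChartAt (𝓡 n) p).source) (v u : EuclideanSpace ℝ (Fin n)) :
    curl (coordRep σ p) (extChartAt (𝓡 n) p q) v u
      = extD σ q (chartInv p (extChartAt (𝓡 n) p q) v)
          (chartInv p (extChartAt (𝓡 n) p q) u) := by
  have h := curl_coordRep_pullForm (f := (id : X → X)) hU hσ contMDiffAt_id hqp hq v u
  rw [pullForm_id, mfderiv_id] at h
  exact h

theorem contDiffAt_coordRep_pullForm {f : X → Y} {p q : X} {U : Set Y} {η : OneForm m Y}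
    (hU : IsOpen U) (hη : SmoothOn U η) (hf : ContMDiffAt (𝓡 n) (𝓡 m) ∞ f q)
    (hq : q ∈ (extChartAt (𝓡 n) p).source) (hfq : f q ∈ U) :
    ContDiffAt ℝ ∞ (coordRep (pullForm f η) p) (extChartAt (𝓡 n) p q) := by
  have h0 := mem_extChartAt_source (I := 𝓡 m) (f q)
  refine ContDiffAt.congr_of_eventuallyEq ?_ (coordRep_pullForm η hf hq h0)
  have h2 := contDiffAt_chartMap hf hq h0
  have h3 : chartMap f p (f q) (extChartAt (𝓡 n) p q) = extChartAt (𝓡 m) (f q) (f q) := by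
    simp only [chartMap, Function.comp_apply, (extChartAt (𝓡 n) p).left_inv hq]
  exact ContDiffAt.clm_comp (ContDiffAt.comp (g := coordRep η (f q)) _ (h3 ▸ hη.contDiffAt hU hfq h0) h2)
    (h2.fderiv_right (m := ∞) (by simp))

end Charts

/-! ## Dual frames of a coframing -/

section DualFrames

variable {E : Type*} [NormedAddCommGroup E] [NormedSpace ℝ E] [FiniteDimensional ℝ E] {n : ℕ}

/-- The covectors `κ` as the components of a map to `ℝⁿ`. -/
def coframeMap (κ : Fin n → E →L[ℝ] ℝ) : E →L[ℝ] (Fin n → ℝ) := ContinuousLinearMap.pi κ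

/-- In dimension n, n independent covectors span the dual space and so separate vectors; injectivity
then suffices by equality of dimensions. -/
theorem isInvertible_coframeMap (hn : Module.finrank ℝ E = n) {κ : Fin n → E →L[ℝ] ℝ}
    (hκ : LinearIndependent ℝ κ) : (coframeMap κ).IsInvertible := by
  have hfr : Module.finrank ℝ (E →L[ℝ] ℝ) = n := by
    rw [← (LinearMap.toContinuousLinearMap (𝕜 := ℝ) (E := E) (F' := ℝ)).finrank_eq,
      Module.finrank_linearMap, hn]
    simp
  have hspan := hκ.span_eq_top_of_card_eq_finrank' (by simp [hfr])
  have hinj : Function.Injective (coframeMap κ) := by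
    rw [injective_iff_map_eq_zero]
    intro v hv
    have h1 : ∀ f : E →L[ℝ] ℝ, f v = 0 := by
      intro f
      have hf : f ∈ Submodule.span ℝ (Set.range κ) := hspan ▸ Submodule.mem_top
      induction hf using Submodule.span_induction with
      | mem x hx =>
        obtain ⟨i, rfl⟩ := hx
        exact congrFun hv i
      | zero => simp
      | add x y _ _ hx hy => simp [hx, hy]
      | smul a x _ hx => simp [hx]
    exact SeparatingDual.eq_zero_of_forall_dual_eq_zero h1
  have hdim : Module.finrank ℝ E = Module.finrank ℝ (Fin n → ℝ) := by simp [hn]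
  refine ⟨(LinearEquiv.ofInjectiveOfFinrankEq (coframeMap κ : E →ₗ[ℝ] (Fin n → ℝ)) hinj
    hdim).toContinuousLinearEquiv, ?_⟩
  ext v
  rfl

/-- The frame dual to the one-forms `s`. -/
def dualFrame (s : Fin n → E → E →L[ℝ] ℝ) (j : Fin n) (y : E) : E :=
  (coframeMap fun i => s i y).inverse (Pi.single j 1)

theorem isDualFrameAt_dualFrame (hn : Module.finrank ℝ E = n) {s : Fin n → E → E →L[ℝ] ℝ} {y : E}
    (hs : ∀ i, DifferentiableAt ℝ (s i) y)
    (hind : ∀ᶠ z in nhds y, LinearIndependent ℝ fun i => s i z) :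
    IsDualFrameAt s (dualFrame s) y := by
  refine ⟨hs, fun j => ?_, ?_, fun v => ?_⟩
  · obtain ⟨A, hA⟩ := isInvertible_coframeMap hn hind.self_of_nhds
    have h1 : DifferentiableAt ℝ (fun z => coframeMap fun i => s i z) y := by
      have : (fun z => coframeMap fun i => s i z)
          = fun z => ∑ i, (ContinuousLinearMap.smulRightL ℝ E (Fin n → ℝ)) (s i z)
              (Pi.single i (1 : ℝ)) := by
        ext z v k
        simp [coframeMap, Pi.single_apply]
      rw [this]
      refine DifferentiableAt.fun_sum fun i _ => ?_
      exact ((ContinuousLinearMap.differentiableAt _).comp y (hs i)).clm_apply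
        (differentiableAt_const _)
    -- The dual frame is a column of the inverse of the coframe matrix, and inversion is smooth at
    -- invertible maps.
    have h2 : DifferentiableAt ℝ ContinuousLinearMap.inverse (coframeMap fun i => s i y) := by
      rw [← hA]
      exact (contDiffAt_map_inverse (n := 1) A).differentiableAt (by simp)
    exact (h2.comp y h1).clm_apply (differentiableAt_const _)
  · filter_upwards [hind] with z hz i j
    obtain ⟨A, hA⟩ := isInvertible_coframeMap hn hz
    have h1 : coframeMap (fun i => s i z) (dualFrame s j z) = Pi.single j 1 := by
      simp [dualFrame, ← hA]
    have h2 := congrFun h1 i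
    simp only [coframeMap, ContinuousLinearMap.coe_pi', Pi.single_apply] at h2
    exact h2
  · obtain ⟨A, hA⟩ := isInvertible_coframeMap hn hind.self_of_nhds
    apply A.injective
    have h1 : ∀ j, A (dualFrame s j y) = Pi.single j 1 := fun j => by
      simp [dualFrame, ← hA]
    rw [map_sum]
    simp only [map_smul, h1]
    have h2 : A v = fun i => s i y v := by
      have := congrArg (fun L => L v) hA
      exact this
    rw [h2]
    ext k
    simp [Pi.single_apply]

end DualFrames

/-! ### Coframings of a manifold and their dual frames in a chart. -/

section Frames

variable {n : ℕ} {X : Type*} [TopologicalSpace X] [ChartedSpace (EuclideanSpace ℝ (Fin n)) X]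

/-- The expression of a coframing in the chart at `p`. -/
def coordCoframe (w : Fin n → OneForm n X) (p : X) (i : Fin n) :
    EuclideanSpace ℝ (Fin n) → EuclideanSpace ℝ (Fin n) →L[ℝ] ℝ :=
  coordRep (w i) p

/-- The structure functions of a coframing, in the chart at `p`. -/
def structFn (w : Fin n → OneForm n X) (p : X) :
    Fin n → Fin n → Fin n → EuclideanSpace ℝ (Fin n) → ℝ :=
  structureFn (coordCoframe w p) (dualFrame (coordCoframe w p))

/-- The frame dual to the coframing `w`, computed in the chart at `p`. -/
def frameVec (w : Fin n → OneForm n X) (p q : X) (j : Fin n) : TangentSpace (𝓡 n) q :=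
  chartInv p (extChartAt (𝓡 n) p q) (dualFrame (coordCoframe w p) j (extChartAt (𝓡 n) p q))

/-- The forms in the ideal vanish on pairs of vectors from the common kernel of its generators.
Congruences are used only through such evaluations. -/
theorem CongrMod.apply_eq {x : X} {Ψ Ψ' : TwoTensor n x} {s : Set (Covector n x)}
    (h : CongrMod Ψ Ψ' s) {v u : TangentSpace (𝓡 n) x} (hv : ∀ κ ∈ s, κ v = 0)
    (hu : ∀ κ ∈ s, κ u = 0) : Ψ v u = Ψ' v u := by
  have h2 : ∀ κ ∈ Submodule.span ℝ s, ∀ t : TangentSpace (𝓡 n) x, (∀ κ ∈ s, κ t = 0) → κ t = 0 := by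
    intro κ hκ t ht
    induction hκ using Submodule.span_induction with
    | mem x hx => exact ht x hx
    | zero => simp
    | add x y _ _ hx hy => simp [hx, hy]
    | smul a x _ hx => simp [hx]
  have h1 : ∀ Φ ∈ wedgeSpan (Submodule.span ℝ s), Φ v u = 0 := by
    intro Φ hΦ
    induction hΦ using Submodule.span_induction with
    | mem x hx =>
      obtain ⟨κ, hκ, β, rfl⟩ := hx
      simp [wedge, h2 κ hκ v hv, h2 κ hκ u hu]
    | zero => simp
    | add x y _ _ hx hy => simp [hx, hy]
    | smul a x _ hx => simp [hx]
  have := h1 _ h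
  simpa [sub_eq_zero] using this

theorem fderiv_structFn_swap (w : Fin n → OneForm n X) (p : X) (i j k : Fin n)
    (y : EuclideanSpace ℝ (Fin n)) :
    fderiv ℝ (structFn w p i j k) y = -fderiv ℝ (structFn w p i k j) y := by
  have h : structFn w p i j k = -structFn w p i k j :=
    funext fun z => structureFn_swap _ _ z i j k
  rw [h, fderiv_neg]

variable [IsManifold (𝓡 n) ∞ X] {U : Set X} {w : Fin n → OneForm n X} {p q : X}

theorem IsCoframing.contDiffAt (hw : IsCoframing U w) (hq : q ∈ U)
    (hqp : q ∈ (extChartAt (𝓡 n) p).source) (i : Fin n) :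
    ContDiffAt ℝ ∞ (coordCoframe w p i) (extChartAt (𝓡 n) p q) :=
  (hw.smooth i).contDiffAt hw.isOpen hq hqp

/-- Relations holding on an open set of the manifold have to be differentiated in the chart; this
transfers them to a neighbourhood of the image point. -/
theorem eventually_chart {P : X → Prop} (hqp : q ∈ (extChartAt (𝓡 n) p).source)
    (h : ∀ᶠ z in nhds q, P z) : ∀ᶠ y in nhds (extChartAt (𝓡 n) p q),
      ∃ z, z ∈ (extChartAt (𝓡 n) p).source ∧ extChartAt (𝓡 n) p z = y ∧ P z := by
  have h3 : Filter.Tendsto (extChartAt (𝓡 n) p).symm (nhds (extChartAt (𝓡 n) p q)) (nhds q) := by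
    have := (mdifferentiableAt_symm hqp).continuousAt.tendsto
    rwa [(extChartAt (𝓡 n) p).left_inv hqp] at this
  filter_upwards [h3.eventually h, (isOpen_extChartAt_target p).mem_nhds
    ((extChartAt (𝓡 n) p).map_source hqp)] with y hy hyt
  exact ⟨_, (extChartAt (𝓡 n) p).map_target hyt, (extChartAt (𝓡 n) p).right_inv hyt, hy⟩

theorem IsCoframing.isDualFrameAt (hw : IsCoframing U w) (hq : q ∈ U)
    (hqp : q ∈ (extChartAt (𝓡 n) p).source) :
    IsDualFrameAt (coordCoframe w p) (dualFrame (coordCoframe w p)) (extChartAt (𝓡 n) p q) := by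
  refine isDualFrameAt_dualFrame (by simp)
    (fun i => (hw.contDiffAt hq hqp i).differentiableAt (by simp)) ?_
  filter_upwards [eventually_chart hqp (hw.isOpen.mem_nhds hq)] with y hy
  obtain ⟨z, hz, rfl, hzU⟩ := hy
  have h := hw.independent z hzU
  rw [Fintype.linearIndependent_iff] at h ⊢
  intro g hg
  refine h g ?_
  have hg' : ∀ v, ∑ i, g i * w i z (chartInv p (extChartAt (𝓡 n) p z) v) = 0 := fun v => by
    have := congrArg (fun L : EuclideanSpace ℝ (Fin n) →L[ℝ] ℝ => L v) hg
    simpa only [coordCoframe, sum_apply, smul_apply, smul_eq_mul,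
      zero_apply, coordRep_apply _ hz] using this
  ext v
  have h1 := hg' (chartDer p z v)
  have h2 : chartInv p (extChartAt (𝓡 n) p z) (chartDer p z v) = v :=
    congrArg (fun L => L v) (chartInv_comp_chartDer hz)
  rw [h2] at h1
  simpa using h1

theorem IsCoframing.apply_frameVec (hw : IsCoframing U w) (hq : q ∈ U)
    (hqp : q ∈ (extChartAt (𝓡 n) p).source) (i j : Fin n) :
    w i q (frameVec w p q j) = if i = j then 1 else 0 := by
  have h := (hw.isDualFrameAt hq hqp).dual.self_of_nhds i j
  rw [← h, coordCoframe, coordRep_apply _ hqp]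
  rfl

theorem IsCoframing.expand (hw : IsCoframing U w) (hq : q ∈ U)
    (hqp : q ∈ (extChartAt (𝓡 n) p).source) (v : TangentSpace (𝓡 n) q) :
    v = ∑ i, w i q v • frameVec w p q i := by
  have h := (hw.isDualFrameAt hq hqp).expand (chartDer p q v)
  have h2 : chartInv p (extChartAt (𝓡 n) p q) (chartDer p q v) = v :=
    congrArg (fun L => L v) (chartInv_comp_chartDer hqp)
  have h3 := congrArg (chartInv p (extChartAt (𝓡 n) p q)) h
  rw [h2, map_sum] at h3
  simp only [map_smul, coordCoframe, coordRep_apply _ hqp, h2] at h3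
  exact h3

theorem IsCoframing.extD_frameVec (hw : IsCoframing U w) (hq : q ∈ U)
    (hqp : q ∈ (extChartAt (𝓡 n) p).source) (i j k : Fin n) :
    extD (w i) q (frameVec w p q j) (frameVec w p q k)
      = structFn w p i j k (extChartAt (𝓡 n) p q) :=
  (curl_coordRep hw.isOpen (hw.smooth i) hq hqp _ _).symm

end Frames

/-! ## The fibres of an integrable extension -/

section Fibres

variable {N M : Type*}
  [TopologicalSpace N] [ChartedSpace (EuclideanSpace ℝ (Fin 7)) N]
  [TopologicalSpace M] [ChartedSpace (EuclideanSpace ℝ (Fin 5)) M]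

variable {π : N → M} {I : FormIdeal 5 M}

theorem pullback1_eq_span {q : N} {η : OneForm 5 M}
    (h : I.deg1 (π q) = Submodule.span ℝ {η (π q)}) :
    pullback1 (m := 7) π I q = Submodule.span ℝ {pullForm (n := 7) π η q} := by
  apply le_antisymm
  · refine Submodule.span_le.2 ?_
    rintro κ ⟨β, hβ, rfl⟩
    rw [h] at hβ
    obtain ⟨c, rfl⟩ := Submodule.mem_span_singleton.1 hβ
    exact Submodule.mem_span_singleton.2 ⟨c, by ext v; simp [pullForm]⟩
  · refine Submodule.span_le.2 ?_
    rintro κ rfl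
    exact Submodule.subset_span ⟨_, h ▸ Submodule.mem_span_singleton_self _, rfl⟩

/-- Elements of the pullback of a Monge-Ampère ideal, restricted to the kernel of the contact
form. -/
theorem exists_apply_of_mem_pullback2 {q : N} {η : Fin 5 → OneForm 5 M}
    (h1 : I.deg1 (π q) = Submodule.span ℝ {η 0 (π q)})
    (h2 : I.deg2 (π q) = wedgeSpan (I.deg1 (π q)) ⊔ Submodule.span ℝ
      {wedge (η 1 (π q)) (η 2 (π q)), wedge (η 3 (π q)) (η 4 (π q))})
    {Ψ : TwoTensor 7 q} (hΨ : Ψ ∈ pullback2 π I q) :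
    ∃ f g : ℝ, ∀ v u : TangentSpace (𝓡 7) q, pullForm (n := 7) π (η 0) q v = 0 → pullForm (n := 7) π (η 0) q u = 0 →
      Ψ v u = f * wedge (pullForm (n := 7) π (η 1) q) (pullForm (n := 7) π (η 2) q) v u
        + g * wedge (pullForm (n := 7) π (η 3) q) (pullForm (n := 7) π (η 4) q) v u := by
  induction hΨ using Submodule.span_induction with
  | mem x hx =>
    obtain ⟨Φ, hΦ, rfl⟩ := hx
    rw [h2] at hΦ
    obtain ⟨Φ₁, hΦ₁, Φ₂, hΦ₂, rfl⟩ := Submodule.mem_sup.1 hΦ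
    obtain ⟨f, g, rfl⟩ := Submodule.mem_span_pair.1 hΦ₂
    refine ⟨f, g, fun v u hv hu => ?_⟩
    have h3 : Φ₁ (mfderiv (𝓡 7) (𝓡 5) π q v) (mfderiv (𝓡 7) (𝓡 5) π q u) = 0 := by
      have h4 : CongrMod Φ₁ 0 {η 0 (π q)} := by
        rw [CongrMod, sub_zero, ← h1]; exact hΦ₁
      have := h4.apply_eq (v := mfderiv (𝓡 7) (𝓡 5) π q v) (u := mfderiv (𝓡 7) (𝓡 5) π q u)
        (by rintro κ rfl; exact hv) (by rintro κ rfl; exact hu)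
      exact this
    simp only [LinearMap.mk₂_apply, LinearMap.add_apply, LinearMap.smul_apply, smul_eq_mul]
    rw [h3, zero_add]
    rfl
  | zero => exact ⟨0, 0, fun v u _ _ => by simp⟩
  | add x y _ _ hx hy =>
    obtain ⟨f, g, h⟩ := hx
    obtain ⟨f', g', h'⟩ := hy
    refine ⟨f + f', g + g', fun v u hv hu => ?_⟩
    rw [LinearMap.add_apply, LinearMap.add_apply, h v u hv hu, h' v u hv hu]
    ring
  | smul a x _ hx =>
    obtain ⟨f, g, h⟩ := hx
    refine ⟨a * f, a * g, fun v u hv hu => ?_⟩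
    rw [LinearMap.smul_apply, LinearMap.smul_apply, h v u hv hu, smul_eq_mul]
    ring

variable [IsManifold (𝓡 7) ∞ N]

/-- A coframing `z` of `N` whose first form generates `π^* I¹`, for which `z³, …, z⁶` are
semi-basic for `π` and `B = ⟨z⁰, z¹, z², z³ ∧ z⁴, z⁵ ∧ z⁶⟩`. -/
structure IsFibreCoframing (π : N → M) (B : FormIdeal 7 N) (I : FormIdeal 5 M) (U : Set N)
    (z : Fin 7 → OneForm 7 N) : Prop where
  coframing : IsCoframing U z
  span_zero : ∀ q ∈ U, Submodule.span ℝ {z 0 q} = pullback1 π I q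
  deg1 : ∀ q ∈ U, B.deg1 q = Submodule.span ℝ {z 0 q, z 1 q, z 2 q}
  d_zero : ∀ q ∈ U, CongrMod (extD (z 0) q) (wedge (z 3 q) (z 4 q) + wedge (z 5 q) (z 6 q)) {z 0 q}
  mem34 : ∀ q ∈ U, wedge (z 3 q) (z 4 q) ∈ B.deg2 q
  mem56 : ∀ q ∈ U, wedge (z 5 q) (z 6 q) ∈ B.deg2 q

variable {B : FormIdeal 7 N} {U : Set N} {z : Fin 7 → OneForm 7 N}

/-- The generator of `π^* I¹` is a nonzero multiple of a pulled back contact form. -/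
theorem IsFibreCoframing.exists_smul (hz : IsFibreCoframing π B I U z) {q : N} (hq : q ∈ U)
    {η : OneForm 5 M} (h : I.deg1 (π q) = Submodule.span ℝ {η (π q)}) :
    ∃ c : ℝ, c ≠ 0 ∧ pullForm (n := 7) π η q = c • z 0 q := by
  have h1 := hz.span_zero q hq
  rw [pullback1_eq_span h] at h1
  obtain ⟨c, hc⟩ := Submodule.span_singleton_eq_span_singleton.1 h1
  exact ⟨c, c.ne_zero, hc.symm⟩

variable [IsManifold (𝓡 5) ∞ M]

/-- Vectors tangent to the fibres lie in the kernel of `dz⁰` restricted to `ker z⁰`. -/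
theorem IsFibreCoframing.extD_zero_apply (hz : IsFibreCoframing π B I U z)
    (hI : IsHyperbolicMongeAmpere I) (hπ : ContMDiff (𝓡 7) (𝓡 5) ∞ π) {q : N} (hq : q ∈ U)
    {v u : TangentSpace (𝓡 7) q} (hv : mfderiv (𝓡 7) (𝓡 5) π q v = 0) (hu : z 0 q u = 0) :
    z 0 q v = 0 ∧ extD (z 0) q v u = 0 := by
  obtain ⟨V, η, hqV, hη, hV⟩ := hI.2 (π q)
  have hsource := mem_extChartAt_source (I := 𝓡 7) q
  obtain ⟨c, hc, hcz⟩ := hz.exists_smul hq (hV _ hqV).1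
  have hv0 : z 0 q v = 0 := by
    have h1 : pullForm (n := 7) π (η 0) q v = 0 := by
      have : pullForm (n := 7) π (η 0) q v = η 0 (π q) (mfderiv (𝓡 7) (𝓡 5) π q v) := rfl
      rw [this, hv, map_zero]
    rw [hcz] at h1
    simpa [hc] using h1
  refine ⟨hv0, ?_⟩
  have hF := hz.coframing.isDualFrameAt hq hsource
  have hsm := (contDiffAt_coordRep_pullForm hη.isOpen (hη.smooth 0) hπ.contMDiffAt hsource hqV)
  have hdiff := hsm.differentiableAt (by simp)
  set y₀ := extChartAt (𝓡 7) q q with hy₀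
  set α := coordRep (pullForm (n := 7) π (η 0)) q with hα
  -- The proportionality factor is expressed as the value of α on the frame field `0`, so that it is
  -- visibly differentiable.
  have hmult : α =ᶠ[nhds y₀] fun y => α y (dualFrame (coordCoframe z q) 0 y) • coordCoframe z q 0 y := by
    have hev : ∀ᶠ q' in nhds q, q' ∈ U ∧ π q' ∈ V :=
      Filter.Eventually.and (hz.coframing.isOpen.mem_nhds hq)
        (hπ.continuous.continuousAt.preimage_mem_nhds (hη.isOpen.mem_nhds hqV))
    filter_upwards [eventually_chart hsource hev, hF.dual] with y hy hdual
    obtain ⟨q', hq's, rfl, hq'U, hq'V⟩ := hy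
    obtain ⟨c', _, hc'⟩ := hz.exists_smul hq'U (hV _ hq'V).1
    have h1 : ∀ t, α (extChartAt (𝓡 7) q q') t = c' * coordCoframe z q 0 (extChartAt (𝓡 7) q q') t := by
      intro t
      rw [hα, coordCoframe, coordRep_apply _ hq's, coordRep_apply _ hq's, hc']
      rfl
    ext1 t
    rw [smul_apply, h1, h1, hdual 0 0]
    simp
  -- In d(h z⁰) = dh ∧ z⁰ + h dz⁰ the first term vanishes since both vectors lie in ker z⁰. The left
  -- side vanishes because it is a pulled back form evaluated on a vertical vector, and h ≠ 0.
  have hcurl := curl_smul hmult (hdiff.clm_apply (hF.diff_frame 0)) (hF.diff_form 0)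
    (chartDer q q v) (chartDer q q u)
  have hinv : ∀ t : TangentSpace (𝓡 7) q, chartInv q y₀ (chartDer q q t) = t := fun t =>
    congrArg (fun L => L t) (chartInv_comp_chartDer hsource)
  have hval : ∀ t : TangentSpace (𝓡 7) q, coordCoframe z q 0 y₀ (chartDer q q t) = z 0 q t := by
    intro t
    rw [coordCoframe, coordRep_apply _ hsource, hinv]
  have hleft : curl α y₀ (chartDer q q v) (chartDer q q u) = 0 := by
    rw [hα, curl_coordRep_pullForm hη.isOpen (hη.smooth 0) hπ.contMDiffAt hsource hqV, hinv, hv]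
    simp
  have hne : α y₀ (dualFrame (coordCoframe z q) 0 y₀) ≠ 0 := by
    rw [hα, coordRep_apply _ hsource, hcz]
    have := hz.coframing.apply_frameVec hq hsource 0 0
    rw [if_pos rfl] at this
    change c * z 0 q (frameVec z q q 0) ≠ 0
    rw [this]
    simpa using hc
  have hext : extD (z 0) q v u = curl (coordCoframe z q 0) y₀ (chartDer q q v) (chartDer q q u) := rfl
  rw [hleft, hval, hval, hv0, hu, ← hext] at hcurl
  simpa [hne] using hcurl.symm

/-- The fibres of `π` are the common kernels of the semi-basic forms. -/
theorem IsFibreCoframing.mfderiv_eq_zero_iff (hz : IsFibreCoframing π B I U z)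
    (hI : IsHyperbolicMongeAmpere I) (hext : IsIntegrableExtension 2 π B I) {q : N} (hq : q ∈ U)
    (v : TangentSpace (𝓡 7) q) :
    mfderiv (𝓡 7) (𝓡 5) π q v = 0 ↔
      z 0 q v = 0 ∧ z 3 q v = 0 ∧ z 4 q v = 0 ∧ z 5 q v = 0 ∧ z 6 q v = 0 := by
  have hsource := mem_extChartAt_source (I := 𝓡 7) q
  set e := frameVec z q q with he
  have hdual := hz.coframing.apply_frameVec hq hsource
  rw [← he] at hdual
  have hfwd : ∀ v : TangentSpace (𝓡 7) q, mfderiv (𝓡 7) (𝓡 5) π q v = 0 →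
      z 0 q v = 0 ∧ z 3 q v = 0 ∧ z 4 q v = 0 ∧ z 5 q v = 0 ∧ z 6 q v = 0 := by
    intro v hv
    have h0 := fun u hu => hz.extD_zero_apply hI hext.smooth hq (u := u) hv hu
    have hv0 : z 0 q v = 0 := (h0 0 (map_zero _)).1
    -- Modulo z⁰, dz⁰ is z³ ∧ z⁴ + z⁵ ∧ z⁶, which is nondegenerate in these four variables. A vector
    -- with zero contraction on ker z⁰ is thus killed by z³, ..., z⁶.
    have h1 : ∀ u, z 0 q u = 0 →
        z 3 q v * z 4 q u - z 4 q v * z 3 q u + (z 5 q v * z 6 q u - z 6 q v * z 5 q u) = 0 := by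
      intro u hu
      have h2 := (hz.d_zero q hq).apply_eq (v := v) (u := u) (by simpa using hv0) (by simpa using hu)
      rw [(h0 u hu).2] at h2
      simpa [wedge] using h2.symm
    have h3 := h1 (e 3) (by simp [hdual])
    have h4 := h1 (e 4) (by simp [hdual])
    have h5 := h1 (e 5) (by simp [hdual])
    have h6 := h1 (e 6) (by simp [hdual])
    simp [hdual] at h3 h4 h5 h6
    exact ⟨hv0, h4, h3, h6, h5⟩
  refine ⟨hfwd v, fun hv => ?_⟩
  let D : TangentSpace (𝓡 7) q →ₗ[ℝ] TangentSpace (𝓡 5) (π q) := mfderiv (𝓡 7) (𝓡 5) π q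
  have : FiniteDimensional ℝ (TangentSpace (𝓡 7) q) :=
    inferInstanceAs (FiniteDimensional ℝ (EuclideanSpace ℝ (Fin 7)))
  have hexp : ∀ v : TangentSpace (𝓡 7) q, z 0 q v = 0 ∧ z 3 q v = 0 ∧ z 4 q v = 0 ∧ z 5 q v = 0 ∧
      z 6 q v = 0 → v ∈ Submodule.span ℝ ({e 1, e 2} : Set (TangentSpace (𝓡 7) q)) := by
    rintro v ⟨h0, h3, h4, h5, h6⟩
    rw [hz.coframing.expand hq hsource v, Fin.sum_univ_seven, h0, h3, h4, h5, h6]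
    simp only [zero_smul, zero_add, add_zero]
    exact Submodule.mem_span_pair.2 ⟨_, _, rfl⟩
  -- For the converse: the kernel of a surjection from dimension 7 to dimension 5 has dimension 2
  -- and lies in the span of `e 1` and `e 2`, so it fills that span.
  have hle : LinearMap.ker D ≤ Submodule.span ℝ ({e 1, e 2} : Set (TangentSpace (𝓡 7) q)) :=
    fun v hv => hexp v (hfwd v hv)
  have hrank : Module.finrank ℝ (LinearMap.range D) + Module.finrank ℝ (LinearMap.ker D)
      = Module.finrank ℝ (TangentSpace (𝓡 7) q) := LinearMap.finrank_range_add_finrank_ker D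
  have hrange : LinearMap.range D = ⊤ := LinearMap.range_eq_top.2 (hext.submersion q)
  have h7 : Module.finrank ℝ (TangentSpace (𝓡 7) q) = 7 :=
    (finrank_euclideanSpace_fin : Module.finrank ℝ (EuclideanSpace ℝ (Fin 7)) = 7)
  have h5 : Module.finrank ℝ (TangentSpace (𝓡 5) (π q)) = 5 :=
    (finrank_euclideanSpace_fin : Module.finrank ℝ (EuclideanSpace ℝ (Fin 5)) = 5)
  rw [hrange, finrank_top, h7, h5] at hrank
  have hspan : Module.finrank ℝ (Submodule.span ℝ ({e 1, e 2} : Set (TangentSpace (𝓡 7) q))) ≤ 2 := by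
    classical
    have := finrank_span_finset_le_card (R := ℝ) ({e 1, e 2} : Finset (TangentSpace (𝓡 7) q))
    rw [Finset.coe_pair] at this
    exact this.trans Finset.card_le_two
  have heq := Submodule.eq_of_le_of_finrank_le hle (by omega)
  have : v ∈ LinearMap.ker D := heq ▸ hexp v hv
  exact this

/-- The pulled back two-forms restricted to the complement of the degree one part. -/
theorem IsFibreCoframing.exists_apply (hz : IsFibreCoframing π B I U z)
    (hext : IsIntegrableExtension 2 π B I) {q : N} (hq : q ∈ U) {η : Fin 5 → OneForm 5 M}
    (h1 : I.deg1 (π q) = Submodule.span ℝ {η 0 (π q)})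
    (h2 : I.deg2 (π q) = wedgeSpan (I.deg1 (π q)) ⊔ Submodule.span ℝ
      {wedge (η 1 (π q)) (η 2 (π q)), wedge (η 3 (π q)) (η 4 (π q))})
    {Ψ : TwoTensor 7 q} (hΨ : Ψ ∈ B.deg2 q) :
    ∃ f g : ℝ, ∀ v u : TangentSpace (𝓡 7) q, z 0 q v = 0 → z 1 q v = 0 → z 2 q v = 0 →
      z 0 q u = 0 → z 1 q u = 0 → z 2 q u = 0 →
      Ψ v u = f * wedge (pullForm (n := 7) π (η 1) q) (pullForm (n := 7) π (η 2) q) v u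
        + g * wedge (pullForm (n := 7) π (η 3) q) (pullForm (n := 7) π (η 4) q) v u := by
  obtain ⟨W, θ, _, hqW, _, hW⟩ := hext.local_form q
  rw [(hW q hqW).2.2.1] at hΨ
  obtain ⟨R, hR, Ψ', hΨ', rfl⟩ := Submodule.mem_sup.1 hΨ
  obtain ⟨f, g, h⟩ := exists_apply_of_mem_pullback2 h1 h2 hΨ'
  obtain ⟨c, hc, hcz⟩ := hz.exists_smul hq h1
  refine ⟨f, g, fun v u hv0 hv1 hv2 hu0 hu1 hu2 => ?_⟩
  have h3 : CongrMod R 0 {z 0 q, z 1 q, z 2 q} := by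
    rw [CongrMod, sub_zero, ← hz.deg1 q hq]; exact hR
  have h4 := h3.apply_eq (v := v) (u := u) (by simp [hv0, hv1, hv2]) (by simp [hu0, hu1, hu2])
  rw [LinearMap.add_apply, LinearMap.add_apply, h4,
    h v u (by rw [hcz]; simp [hv0]) (by rw [hcz]; simp [hu0])]
  simp

/-- The values of the pulled back two-forms on a dual frame. -/
theorem IsFibreCoframing.pull_apply (hz : IsFibreCoframing π B I U z)
    (hI : IsHyperbolicMongeAmpere I) (hext : IsIntegrableExtension 2 π B I) {q : N} (hq : q ∈ U)
    {η : Fin 5 → OneForm 5 M} (h1 : I.deg1 (π q) = Submodule.span ℝ {η 0 (π q)})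
    (h2 : I.deg2 (π q) = wedgeSpan (I.deg1 (π q)) ⊔ Submodule.span ℝ
      {wedge (η 1 (π q)) (η 2 (π q)), wedge (η 3 (π q)) (η 4 (π q))})
    {e : Fin 7 → TangentSpace (𝓡 7) q} (he : ∀ i j, z i q (e j) = if i = j then 1 else 0) :
    (∀ i, pullForm (n := 7) π (η i) q (e 1) = 0 ∧ pullForm (n := 7) π (η i) q (e 2) = 0) ∧
    (∀ j k : Fin 7, (j = 3 ∨ j = 4) → (k = 5 ∨ k = 6) →
      wedge (pullForm (n := 7) π (η 1) q) (pullForm (n := 7) π (η 2) q) (e j) (e k) = 0 ∧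
      wedge (pullForm (n := 7) π (η 3) q) (pullForm (n := 7) π (η 4) q) (e j) (e k) = 0) ∧
    wedge (pullForm (n := 7) π (η 1) q) (pullForm (n := 7) π (η 2) q) (e 3) (e 4)
        * wedge (pullForm (n := 7) π (η 3) q) (pullForm (n := 7) π (η 4) q) (e 5) (e 6)
      - wedge (pullForm (n := 7) π (η 1) q) (pullForm (n := 7) π (η 2) q) (e 5) (e 6)
        * wedge (pullForm (n := 7) π (η 3) q) (pullForm (n := 7) π (η 4) q) (e 3) (e 4) ≠ 0 := by
  obtain ⟨f, g, hfg⟩ := hz.exists_apply hext hq h1 h2 (hz.mem34 q hq)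
  obtain ⟨h, k, hhk⟩ := hz.exists_apply hext hq h1 h2 (hz.mem56 q hq)
  generalize wedge (pullForm (n := 7) π (η 1) q) (pullForm (n := 7) π (η 2) q) = A at *
  generalize wedge (pullForm (n := 7) π (η 3) q) (pullForm (n := 7) π (η 4) q) = A' at *
  have key : ∀ i j : Fin 7, 3 ≤ i → 3 ≤ j →
      (wedge (z 3 q) (z 4 q) (e i) (e j) = f * A (e i) (e j) + g * A' (e i) (e j) ∧
      wedge (z 5 q) (z 6 q) (e i) (e j) = h * A (e i) (e j) + k * A' (e i) (e j)) := by
    intro i j hi hj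
    have hne : ∀ l : Fin 7, 3 ≤ l → z 0 q (e l) = 0 ∧ z 1 q (e l) = 0 ∧ z 2 q (e l) = 0 := by
      intro l hl
      rw [he, he, he]
      refine ⟨if_neg ?_, if_neg ?_, if_neg ?_⟩ <;> rintro rfl <;> exact absurd hl (by decide)
    obtain ⟨a0, a1, a2⟩ := hne i hi
    obtain ⟨b0, b1, b2⟩ := hne j hj
    exact ⟨hfg _ _ a0 a1 a2 b0 b1 b2, hhk _ _ a0 a1 a2 b0 b1 b2⟩
  obtain ⟨k1, k2⟩ := key 3 4 (by decide) (by decide)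
  obtain ⟨k3, k4⟩ := key 5 6 (by decide) (by decide)
  simp [wedge, he] at k1 k2 k3 k4
  -- On the pairs (e₃, e₄) and (e₅, e₆) the forms z³ ∧ z⁴ and z⁵ ∧ z⁶ have the identity as matrix of
  -- values. It is the product of the coefficient matrix with the matrix of values of the pulled
  -- back forms, so both determinants are nonzero.
  have hdet : (f * k - g * h) * (A (e 3) (e 4) * A' (e 5) (e 6) - A (e 5) (e 6) * A' (e 3) (e 4)) = 1 := by
    linear_combination (-(h * A (e 5) (e 6) + k * A' (e 5) (e 6))) * k1 - k4
      + (f * A (e 5) (e 6) + g * A' (e 5) (e 6)) * k2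
  have hdet' : f * k - g * h ≠ 0 := left_ne_zero_of_mul_eq_one hdet
  refine ⟨fun i => ?_, ?_, right_ne_zero_of_mul_eq_one hdet⟩
  · have hk1 := (hz.mfderiv_eq_zero_iff hI hext hq (e 1)).2 (by simp [he])
    have hk2 := (hz.mfderiv_eq_zero_iff hI hext hq (e 2)).2 (by simp [he])
    constructor
    · change η i (π q) (mfderiv (𝓡 7) (𝓡 5) π q (e 1)) = 0
      rw [hk1, map_zero]
    · change η i (π q) (mfderiv (𝓡 7) (𝓡 5) π q (e 2)) = 0
      rw [hk2, map_zero]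
  · intro i j hi hj
    have hz' : wedge (z 3 q) (z 4 q) (e i) (e j) = 0 ∧ wedge (z 5 q) (z 6 q) (e i) (e j) = 0 := by
      rcases hi with rfl | rfl <;> rcases hj with rfl | rfl <;> simp [wedge, he]
    obtain ⟨l1, l2⟩ := key i j (by rcases hi with rfl | rfl <;> decide)
      (by rcases hj with rfl | rfl <;> decide)
    rw [hz'.1] at l1
    rw [hz'.2] at l2
    constructor
    · refine (mul_eq_zero.1 (?_ : (f * k - g * h) * A (e i) (e j) = 0)).resolve_left hdet'
      linear_combination (-k) * l1 + g * l2
    · refine (mul_eq_zero.1 (?_ : (f * k - g * h) * A' (e i) (e j) = 0)).resolve_left hdet'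
      linear_combination h * l1 - f * l2

end Fibres

/-! ### Compatibility of the coframing with the fibres. -/

section FibreRelations

/-- Relations between the structure functions forced by a decomposable two-form `α ∧ β` whose
factors are basic for the foliation spanned by `e 1` and `e 2`. -/
theorem IsDualFrameAt.basic_relations {E : Type*} [NormedAddCommGroup E] [NormedSpace ℝ E]
    {s : Fin 7 → E → E →L[ℝ] ℝ} {e : Fin 7 → E → E} {y : E} (h : IsDualFrameAt s e y)
    {α β : E → E →L[ℝ] ℝ} (hα : DifferentiableAt ℝ α y) (hβ : DifferentiableAt ℝ β y)
    (hα0 : ∀ᶠ z in nhds y, α z (e 1 z) = 0 ∧ α z (e 2 z) = 0)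
    (hβ0 : ∀ᶠ z in nhds y, β z (e 1 z) = 0 ∧ β z (e 2 z) = 0)
    (hdα : ∀ a, a = 1 ∨ a = 2 → ∀ u, curl α y (e a y) u = 0)
    (hdβ : ∀ a, a = 1 ∨ a = 2 → ∀ u, curl β y (e a y) u = 0)
    (hmix : ∀ᶠ z in nhds y, ∀ j k : Fin 7, (j = 3 ∨ j = 4) → (k = 5 ∨ k = 6) →
      α z (e j z) * β z (e k z) - β z (e j z) * α z (e k z) = 0)
    {A : Fin 7 → Fin 7 → E → ℝ}
    (hA : ∀ j k, A j k = fun z => α z (e j z) * β z (e k z) - β z (e j z) * α z (e k z)) :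
    (∀ a, a = 1 ∨ a = 2 → ∀ j l : Fin 7, (j = 3 ∨ j = 4) → (l = 5 ∨ l = 6) →
      ∑ m, structureFn s e m a j y * A m l y + ∑ m, structureFn s e m l a y * A m j y = 0) ∧
    ∀ k, ∑ m, structureFn s e m 1 2 y * A m k y = 0 := by
  have hvan : ∀ a : Fin 7, a = 1 ∨ a = 2 → ∀ k, A a k =ᶠ[nhds y] (fun _ => 0) ∧
      A k a =ᶠ[nhds y] (fun _ => 0) := by
    intro a ha k
    rw [hA, hA]
    constructor <;> filter_upwards [hα0, hβ0] with z h1 h2 <;>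
      rcases ha with rfl | rfl <;> simp [h1.1, h1.2, h2.1, h2.2]
  have hd0 : ∀ {f : E → ℝ}, f =ᶠ[nhds y] (fun _ => 0) → fderiv ℝ f y = 0 := by
    intro f hf
    rw [hf.fderiv_eq]
    simp
  have hcyc : ∀ a : Fin 7, a = 1 ∨ a = 2 → ∀ b d, _ := fun a ha b d =>
    h.cyclic_wedge hα hβ (a := a) (by rcases ha with rfl | rfl; exacts [hα0.self_of_nhds.1,
      hα0.self_of_nhds.2]) (by rcases ha with rfl | rfl; exacts [hβ0.self_of_nhds.1,
      hβ0.self_of_nhds.2]) (hdα a ha) (hdβ a ha) hA b d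
  have hsum : ∀ a : Fin 7, a = 1 ∨ a = 2 → ∀ j k, ∑ m, structureFn s e m j k y * A m a y = 0 :=
    fun a ha j k => Finset.sum_eq_zero fun m _ => by rw [(hvan a ha m).2.self_of_nhds, mul_zero]
  constructor
  · intro a ha j l hj hl
    have h1 := hcyc a ha j l
    -- The mixed component vanishes on a whole neighbourhood, so its derivative along the fibre
    -- drops out and an algebraic relation remains.
    have hjl : A j l =ᶠ[nhds y] fun _ => 0 := by
      rw [hA]; exact hmix.mono fun z hz => hz j l hj hl
    rw [hsum a ha, hd0 (hvan a ha l).2, hd0 (hvan a ha j).1, hd0 hjl] at h1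
    simpa using h1
  · intro k
    have h1 := hcyc 1 (Or.inl rfl) 2 k
    rw [hsum 1 (Or.inl rfl), hsum 2 (Or.inr rfl), hd0 (hvan 1 (Or.inl rfl) k).2,
      hd0 (hvan 1 (Or.inl rfl) 2).1, hd0 (hvan 2 (Or.inr rfl) k).1] at h1
    simpa using h1

variable {N M : Type*}
  [TopologicalSpace N] [ChartedSpace (EuclideanSpace ℝ (Fin 7)) N] [IsManifold (𝓡 7) ∞ N]
  [TopologicalSpace M] [ChartedSpace (EuclideanSpace ℝ (Fin 5)) M] [IsManifold (𝓡 5) ∞ M]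
  {π : N → M} {B : FormIdeal 7 N} {I : FormIdeal 5 M} {U : Set N} {z : Fin 7 → OneForm 7 N}

/-- The pullbacks of η¹ ∧ η² and η³ ∧ η⁴ are constant along the fibres and, modulo z⁰, span the same
pencil as z³ ∧ z⁴ and z⁵ ∧ z⁶. This pencil is therefore preserved along the fibres, and so are the
spans of z³, z⁴ and of z⁵, z⁶ modulo z⁰. The vanishing of `c i 1 2` reflects the integrability of
the fibre distribution. -/
theorem IsFibreCoframing.structFn_eq_zero (hz : IsFibreCoframing π B I U z)
    (hI : IsHyperbolicMongeAmpere I) (hext : IsIntegrableExtension 2 π B I) {q : N} (hq : q ∈ U)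
    {c : Fin 7 → Fin 7 → Fin 7 → ℝ}
    (hc : ∀ i j k, c i j k = structFn z q i j k (extChartAt (𝓡 7) q q)) :
    (∀ i, 3 ≤ i → c i 1 2 = 0) ∧
    ∀ a, a = 1 ∨ a = 2 → ∀ j l : Fin 7, (j = 3 ∨ j = 4) → (l = 5 ∨ l = 6) →
      c j a l = 0 ∧ c l a j = 0 := by
  obtain ⟨V, η, hqV, hη, hV⟩ := hI.2 (π q)
  have hsource := mem_extChartAt_source (I := 𝓡 7) q
  have hF := hz.coframing.isDualFrameAt hq hsource
  set y₀ := extChartAt (𝓡 7) q q with hy₀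
  set e := dualFrame (coordCoframe z q) with he
  let α : Fin 5 → EuclideanSpace ℝ (Fin 7) → EuclideanSpace ℝ (Fin 7) →L[ℝ] ℝ :=
    fun i => coordRep (pullForm (n := 7) π (η i)) q
  have hα : ∀ i, DifferentiableAt ℝ (α i) y₀ := fun i =>
    (contDiffAt_coordRep_pullForm hη.isOpen (hη.smooth i) hext.smooth.contMDiffAt hsource
      hqV).differentiableAt (by simp)
  have hev : ∀ᶠ q' in nhds q, q' ∈ U ∧ π q' ∈ V :=
    Filter.Eventually.and (hz.coframing.isOpen.mem_nhds hq)
      (hext.smooth.continuous.continuousAt.preimage_mem_nhds (hη.isOpen.mem_nhds hqV))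
  have hpull : ∀ᶠ y in nhds y₀, (∀ i, α i y (e 1 y) = 0 ∧ α i y (e 2 y) = 0) ∧
      (∀ j k : Fin 7, (j = 3 ∨ j = 4) → (k = 5 ∨ k = 6) →
        α 1 y (e j y) * α 2 y (e k y) - α 2 y (e j y) * α 1 y (e k y) = 0 ∧
        α 3 y (e j y) * α 4 y (e k y) - α 4 y (e j y) * α 3 y (e k y) = 0) ∧
      (α 1 y (e 3 y) * α 2 y (e 4 y) - α 2 y (e 3 y) * α 1 y (e 4 y))
        * (α 3 y (e 5 y) * α 4 y (e 6 y) - α 4 y (e 5 y) * α 3 y (e 6 y))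
      - (α 1 y (e 5 y) * α 2 y (e 6 y) - α 2 y (e 5 y) * α 1 y (e 6 y))
        * (α 3 y (e 3 y) * α 4 y (e 4 y) - α 4 y (e 3 y) * α 3 y (e 4 y)) ≠ 0 := by
    filter_upwards [eventually_chart hsource hev] with y hy
    obtain ⟨q', hq's, rfl, hq'U, hq'V⟩ := hy
    have h1 := hz.pull_apply hI hext hq'U (hV _ hq'V).1 (hV _ hq'V).2.1
      (hz.coframing.apply_frameVec hq'U hq's)
    have h2 : ∀ i j, α i (extChartAt (𝓡 7) q q') (e j (extChartAt (𝓡 7) q q'))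
        = pullForm (n := 7) π (η i) q' (frameVec z q q' j) := fun i j => coordRep_apply _ hq's _
    simp only [h2]
    exact h1
  have hcurl : ∀ i a, a = 1 ∨ a = 2 → ∀ u, curl (α i) y₀ (e a y₀) u = 0 := by
    intro i a ha u
    rw [curl_coordRep_pullForm hη.isOpen (hη.smooth i) hext.smooth.contMDiffAt hsource hqV]
    have h1 : mfderiv (𝓡 7) (𝓡 5) π q (frameVec z q q a) = 0 := by
      rw [hz.mfderiv_eq_zero_iff hI hext hq]
      rcases ha with rfl | rfl <;> simp [hz.coframing.apply_frameVec hq hsource]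
    change extD (η i) (π q) (mfderiv (𝓡 7) (𝓡 5) π q (frameVec z q q a)) _ = 0
    rw [h1]
    simp
  -- This removes the index 0 from the sums below. The pulled back forms may have components along
  -- z⁰, about which nothing is known.
  have h0 : ∀ a, a = 1 ∨ a = 2 → ∀ b, b ≠ 0 → c 0 a b = 0 := by
    intro a ha b hb
    rw [hc, ← hz.coframing.extD_frameVec hq hsource]
    have hd := hz.coframing.apply_frameVec hq hsource
    refine (hz.extD_zero_apply hI hext.smooth hq ?_ ?_).2
    · rw [hz.mfderiv_eq_zero_iff hI hext hq]
      rcases ha with rfl | rfl <;> simp [hd]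
    · rw [hd, if_neg hb.symm]
  have hc' : ∀ i j k, structureFn (coordCoframe z q) e i j k y₀ = c i j k := fun i j k =>
    (hc i j k).symm
  obtain ⟨R1, R2⟩ := hF.basic_relations (hα 1) (hα 2) (hpull.mono fun y hy => hy.1 1)
    (hpull.mono fun y hy => hy.1 2) (hcurl 1) (hcurl 2)
    (hpull.mono fun y hy j k hj hk => (hy.2.1 j k hj hk).1) (fun j k => rfl)
  obtain ⟨S1, S2⟩ := hF.basic_relations (hα 3) (hα 4) (hpull.mono fun y hy => hy.1 3)
    (hpull.mono fun y hy => hy.1 4) (hcurl 3) (hcurl 4)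
    (hpull.mono fun y hy j k hj hk => (hy.2.1 j k hj hk).2) (fun j k => rfl)
  obtain ⟨h1, h2, h3⟩ := hpull.self_of_nhds
  simp only [hc'] at R1 R2 S1 S2
  obtain ⟨A, hA⟩ : ∃ A : Fin 7 → Fin 7 → ℝ, ∀ j k,
    A j k = α 1 y₀ (e j y₀) * α 2 y₀ (e k y₀) - α 2 y₀ (e j y₀) * α 1 y₀ (e k y₀) :=
    ⟨_, fun _ _ => rfl⟩
  obtain ⟨A', hA'⟩ : ∃ A : Fin 7 → Fin 7 → ℝ, ∀ j k,
    A j k = α 3 y₀ (e j y₀) * α 4 y₀ (e k y₀) - α 4 y₀ (e j y₀) * α 3 y₀ (e k y₀) :=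
    ⟨_, fun _ _ => rfl⟩
  have hs : ∀ j k, A j k = -A k j := fun j k => by rw [hA, hA]; ring
  have hs' : ∀ j k, A' j k = -A' k j := fun j k => by rw [hA', hA']; ring
  have hd : ∀ j, A j j = 0 := fun j => by rw [hA]; ring
  have hd' : ∀ j, A' j j = 0 := fun j => by rw [hA']; ring
  have hv : ∀ j, A 1 j = 0 ∧ A 2 j = 0 := fun j => by
    rw [hA, hA, (h1 1).1, (h1 1).2, (h1 2).1, (h1 2).2]; simp
  have hv' : ∀ j, A' 1 j = 0 ∧ A' 2 j = 0 := fun j => by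
    rw [hA', hA', (h1 3).1, (h1 3).2, (h1 4).1, (h1 4).2]; simp
  simp only [← hA, ← hA'] at R1 R2 S1 S2 h2 h3
  have hm : ∀ j k : Fin 7, (j = 3 ∨ j = 4) → (k = 5 ∨ k = 6) → A k j = 0 ∧ A' k j = 0 :=
    fun j k hj hk => by rw [hs, hs', (h2 j k hj hk).1, (h2 j k hj hk).2]; simp
  -- The two pulled back forms are independent on the pencil, so a relation satisfied by both of
  -- them splits into its two coefficients.
  have hsol : ∀ x y : ℝ, x * A 3 4 + y * A 5 6 = 0 → x * A' 3 4 + y * A' 5 6 = 0 → x = 0 ∧ y = 0 := by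
    intro x y e1 e2
    constructor
    · refine (mul_eq_zero.1 (?_ : (A 3 4 * A' 5 6 - A 5 6 * A' 3 4) * x = 0)).resolve_left h3
      linear_combination A' 5 6 * e1 - A 5 6 * e2
    · refine (mul_eq_zero.1 (?_ : (A 3 4 * A' 5 6 - A 5 6 * A' 3 4) * y = 0)).resolve_left h3
      linear_combination A 3 4 * e2 - A' 3 4 * e1
  have hcs : ∀ i j k, c i j k = -c i k j := fun i j k => by
    rw [hc, hc]; exact structureFn_swap _ _ _ _ _ _
  have m35 := h2 3 5 (by simp) (by simp)
  have m36 := h2 3 6 (by simp) (by simp)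
  have m45 := h2 4 5 (by simp) (by simp)
  have m46 := h2 4 6 (by simp) (by simp)
  have n35 := hm 3 5 (by simp) (by simp)
  have n36 := hm 3 6 (by simp) (by simp)
  have n45 := hm 4 5 (by simp) (by simp)
  have n46 := hm 4 6 (by simp) (by simp)
  constructor
  · have h012 : c 0 1 2 = 0 := h0 1 (Or.inl rfl) 2 (by decide)
    have r3 := R2 3; have r4 := R2 4; have r5 := R2 5; have r6 := R2 6
    have s3 := S2 3; have s4 := S2 4; have s5 := S2 5; have s6 := S2 6
    simp only [Fin.sum_univ_seven, h012, hv, hv', hd, hd', m35, m36, m45, m46, n35, n36, n45, n46,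
      mul_zero, zero_mul, zero_add, add_zero, hs 4 3, hs' 4 3, hs 6 5, hs' 6 5]
      at r3 r4 r5 r6 s3 s4 s5 s6
    have c3 := hsol (c 3 1 2) 0 (by linarith) (by linarith)
    have c4 := hsol (c 4 1 2) 0 (by linarith) (by linarith)
    have c5 := hsol 0 (c 5 1 2) (by linarith) (by linarith)
    have c6 := hsol 0 (c 6 1 2) (by linarith) (by linarith)
    intro i hi
    fin_cases i
    · exact absurd hi (by decide)
    · exact absurd hi (by decide)
    · exact absurd hi (by decide)
    · exact c3.1
    · exact c4.1
    · exact c5.2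
    · exact c6.2
  · intro a ha
    have h0a : ∀ b, b ≠ 0 → c 0 a b = 0 := h0 a ha
    have r35 := R1 a ha 3 5 (by simp) (by simp)
    have r36 := R1 a ha 3 6 (by simp) (by simp)
    have r45 := R1 a ha 4 5 (by simp) (by simp)
    have r46 := R1 a ha 4 6 (by simp) (by simp)
    have s35 := S1 a ha 3 5 (by simp) (by simp)
    have s36 := S1 a ha 3 6 (by simp) (by simp)
    have s45 := S1 a ha 4 5 (by simp) (by simp)
    have s46 := S1 a ha 4 6 (by simp) (by simp)
    simp only [Fin.sum_univ_seven, h0a 3 (by decide), h0a 4 (by decide), h0a 5 (by decide),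
      h0a 6 (by decide), neg_zero, hv, hv', hd, hd', m35, m36, m45, m46, n35, n36, n45, n46,
      mul_zero, zero_mul, zero_add, add_zero, hs 4 3, hs' 4 3, hs 6 5, hs' 6 5,
      hcs _ 5 a, hcs _ 6 a] at r35 r36 r45 r46 s35 s36 s45 s46
    have t35 := hsol (c 4 a 5) (-c 6 a 3) (by linarith) (by linarith)
    have t36 := hsol (c 4 a 6) (c 5 a 3) (by linarith) (by linarith)
    have t45 := hsol (c 3 a 5) (c 6 a 4) (by linarith) (by linarith)
    have t46 := hsol (c 3 a 6) (-c 5 a 4) (by linarith) (by linarith)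
    rintro j l (rfl | rfl) (rfl | rfl)
    · exact ⟨t45.1, t36.2⟩
    · exact ⟨t46.1, neg_eq_zero.1 t35.2⟩
    · exact ⟨t35.1, neg_eq_zero.1 t46.2⟩
    · exact ⟨t36.1, t45.2⟩

/-- The semi-basic characteristic systems are preserved along the fibres. -/
theorem IsFibreCoframing.extD_eq_zero (hz : IsFibreCoframing π B I U z)
    (hI : IsHyperbolicMongeAmpere I) (hext : IsIntegrableExtension 2 π B I) {q : N} (hq : q ∈ U)
    {v u : TangentSpace (𝓡 7) q}
    (hv : z 0 q v = 0 ∧ z 3 q v = 0 ∧ z 4 q v = 0 ∧ z 5 q v = 0 ∧ z 6 q v = 0)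
    (hu : z 0 q u = 0) :
    (z 3 q u = 0 → z 4 q u = 0 → extD (z 3) q v u = 0 ∧ extD (z 4) q v u = 0) ∧
    (z 5 q u = 0 → z 6 q u = 0 → extD (z 5) q v u = 0 ∧ extD (z 6) q v u = 0) := by
  have hsource := mem_extChartAt_source (I := 𝓡 7) q
  obtain ⟨c, hc⟩ : ∃ c : Fin 7 → Fin 7 → Fin 7 → ℝ,
      ∀ i j k, c i j k = structFn z q i j k (extChartAt (𝓡 7) q q) := ⟨_, fun _ _ _ => rfl⟩
  obtain ⟨h1, h2⟩ := hz.structFn_eq_zero hI hext hq hc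
  have hcs : ∀ i j k, c i j k = -c i k j := fun i j k => by
    rw [hc, hc]; exact structureFn_swap _ _ _ _ _ _
  have hcd : ∀ i j, c i j j = 0 := fun i j => by linarith [hcs i j j]
  have hval : ∀ i j k, extD (z i) q (frameVec z q q j) (frameVec z q q k) = c i j k :=
    fun i j k => by rw [hz.coframing.extD_frameVec hq hsource, hc]
  have ev := hz.coframing.expand hq hsource v
  have eu := hz.coframing.expand hq hsource u
  obtain ⟨hv0, hv3, hv4, hv5, hv6⟩ := hv
  rw [Fin.sum_univ_seven, hv0, hv3, hv4, hv5, hv6] at ev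
  rw [Fin.sum_univ_seven, hu] at eu
  simp only [zero_smul, zero_add, add_zero] at ev eu
  constructor
  · intro hu3 hu4
    rw [hu3, hu4] at eu
    simp only [zero_smul, add_zero] at eu
    rw [ev, eu]
    simp only [map_add, map_smul, LinearMap.add_apply, LinearMap.smul_apply, hval, smul_eq_mul, hcd,
      hcs _ 2 1, h1 3 (by decide), h1 4 (by decide), (h2 1 (Or.inl rfl) 3 5 (by simp) (by simp)).1,
      (h2 1 (Or.inl rfl) 3 6 (by simp) (by simp)).1, (h2 1 (Or.inl rfl) 4 5 (by simp) (by simp)).1,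
      (h2 1 (Or.inl rfl) 4 6 (by simp) (by simp)).1, (h2 2 (Or.inr rfl) 3 5 (by simp) (by simp)).1,
      (h2 2 (Or.inr rfl) 3 6 (by simp) (by simp)).1, (h2 2 (Or.inr rfl) 4 5 (by simp) (by simp)).1,
      (h2 2 (Or.inr rfl) 4 6 (by simp) (by simp)).1]
    simp
  · intro hu5 hu6
    rw [hu5, hu6] at eu
    simp only [zero_smul, add_zero] at eu
    rw [ev, eu]
    simp only [map_add, map_smul, LinearMap.add_apply, LinearMap.smul_apply, hval, smul_eq_mul, hcd,
      hcs _ 2 1, h1 5 (by decide), h1 6 (by decide), (h2 1 (Or.inl rfl) 3 5 (by simp) (by simp)).2,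
      (h2 1 (Or.inl rfl) 3 6 (by simp) (by simp)).2, (h2 1 (Or.inl rfl) 4 5 (by simp) (by simp)).2,
      (h2 1 (Or.inl rfl) 4 6 (by simp) (by simp)).2, (h2 2 (Or.inr rfl) 3 5 (by simp) (by simp)).2,
      (h2 2 (Or.inr rfl) 3 6 (by simp) (by simp)).2, (h2 2 (Or.inr rfl) 4 5 (by simp) (by simp)).2,
      (h2 2 (Or.inr rfl) 4 6 (by simp) (by simp)).2]
    simp

end FibreRelations

/-! ## Algebraic relations between the structure functions of a `1`-adapted coframing -/

section Algebra

/-- The quadratic part of the identity `d² ωⁱ = 0`, evaluated on three frame vectors. -/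
def bianchi (c : Fin 7 → Fin 7 → Fin 7 → ℝ) (i a b d : Fin 7) : ℝ :=
  ∑ m, c m a b * c i m d + ∑ m, c m b d * c i m a + ∑ m, c m d a * c i m b

/-- The coefficient of `ωʲ ∧ ωᵏ` in `ωᵃ ∧ ωᵇ`. -/
def wedgeCoeff (a b j k : Fin 7) : ℝ :=
  (if a = j then 1 else 0) * (if b = k then 1 else 0)
    - (if b = j then 1 else 0) * (if a = k then 1 else 0)

/-- The pointwise relations between the structure functions of a `1`-adapted coframing that come
from the definition and from the two integrable extensions. -/
structure AdaptedRelations (c : Fin 7 → Fin 7 → Fin 7 → ℝ) : Prop where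
  swap : ∀ i j k, c i j k = -c i k j
  d_omega : ∀ j k, j ≠ 0 → k ≠ 0 →
    c 0 j k = wedgeCoeff 3 4 j k + wedgeCoeff 5 6 j k + wedgeCoeff 5 2 j k
  d_omegaBar : ∀ j k, j ≠ 1 → k ≠ 1 →
    c 1 j k = wedgeCoeff 3 4 j k + wedgeCoeff 5 6 j k + wedgeCoeff 3 2 j k
  d_gamma : ∀ j k, 3 ≤ j → 3 ≤ k → c 2 j k = wedgeCoeff 3 4 j k - wedgeCoeff 5 6 j k
  fibre_left : ∀ i, i = 3 ∨ i = 4 → c i 1 2 = c i 1 6 ∧ c i 1 5 = 0 ∧ c i 1 6 = 0 ∧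
    c i 2 5 = -c i 5 6 ∧ c i 2 6 = 0
  fibre_left_three : c 5 1 2 = c 5 1 6 ∧ c 5 1 3 = 0 ∧ c 5 1 4 = 0 ∧ c 5 2 3 = -c 5 3 6 ∧
    c 5 2 4 = -c 5 4 6
  fibre_left_four : c 6 1 2 + c 2 1 2 = c 6 1 6 + c 2 1 6 ∧ c 6 1 3 + c 2 1 3 = 0 ∧
    c 6 1 4 + c 2 1 4 = 0 ∧ c 6 2 3 + c 2 2 3 = -(c 6 3 6 + c 2 3 6) ∧
    c 6 2 4 + c 2 2 4 = -(c 6 4 6 + c 2 4 6)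
  fibre_right : ∀ i, i = 5 ∨ i = 6 → c i 0 2 = c i 0 4 ∧ c i 0 3 = 0 ∧ c i 0 4 = 0 ∧
    c i 2 3 = -c i 3 4 ∧ c i 2 4 = 0
  fibre_right_one : c 3 0 2 = c 3 0 4 ∧ c 3 0 5 = 0 ∧ c 3 0 6 = 0 ∧ c 3 2 5 = c 3 4 5 ∧
    c 3 2 6 = c 3 4 6
  fibre_right_two : c 4 0 2 + c 2 0 2 = c 4 0 4 + c 2 0 4 ∧ c 4 0 5 + c 2 0 5 = 0 ∧
    c 4 0 6 + c 2 0 6 = 0 ∧ c 4 2 5 + c 2 2 5 = c 4 4 5 + c 2 4 5 ∧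
    c 4 2 6 + c 2 2 6 = c 4 4 6 + c 2 4 6

/-- The linear relations between the structure functions implied by the algebraic part of
`d² = 0`. -/
structure LinearRelations (c : Fin 7 → Fin 7 → Fin 7 → ℝ) : Prop where
  eq1_13 : c 1 1 3 = c 0 0 3 - 1
  eq1_14 : c 1 1 4 = c 0 0 4
  eq1_15 : c 1 1 5 = c 0 0 5 - 1
  eq1_16 : c 1 1 6 = c 0 0 6
  eq2_24 : c 2 2 4 = c 0 0 4 + c 2 0 4 + c 2 1 4 + 2 * c 3 5 6
  eq2_26 : c 2 2 6 = c 0 0 6 - c 2 0 6 - c 2 1 6 + 2 * c 5 3 4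
  eq3_02 : c 3 0 2 = c 3 0 4
  eq3_05 : c 3 0 5 = 0
  eq3_06 : c 3 0 6 = 0
  eq3_12 : c 3 1 2 = 0
  eq3_15 : c 3 1 5 = 0
  eq3_16 : c 3 1 6 = 0
  eq3_25 : c 3 2 5 = -c 3 5 6
  eq3_26 : c 3 2 6 = 0
  eq3_34 : c 3 3 4 = c 0 0 2 - c 1 1 2 - c 2 0 4 - c 2 1 4 - 2 * c 3 5 6 + c 5 3 4
  eq3_35 : c 3 3 5 = c 0 0 3 / 2 + c 0 0 5 / 2 + c 2 0 3 / 2 + c 2 0 5 / 2 + c 2 1 3 / 2 + c 2 1 5 / 2 - c 2 2 3 / 2 - c 2 2 5 / 2 - 1 / 2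
  eq3_36 : c 3 3 6 = c 2 0 6 + c 2 1 6 - c 5 3 4
  eq3_45 : c 3 4 5 = -c 3 5 6
  eq3_46 : c 3 4 6 = 0
  eq4_02 : c 4 0 2 = c 1 0 1 - c 2 0 2 - c 3 0 3
  eq4_04 : c 4 0 4 = c 1 0 1 - c 2 0 4 - c 3 0 3
  eq4_05 : c 4 0 5 = -c 2 0 5
  eq4_06 : c 4 0 6 = -c 2 0 6
  eq4_12 : c 4 1 2 = 0
  eq4_14 : c 4 1 4 = -c 0 0 1 - c 3 1 3
  eq4_15 : c 4 1 5 = 0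
  eq4_16 : c 4 1 6 = 0
  eq4_24 : c 4 2 4 = -c 0 0 2 - c 3 2 3 - c 5 3 4
  eq4_25 : c 4 2 5 = -c 0 0 3 / 2 - c 2 0 3 / 2 - c 2 1 3 / 2 + c 2 2 3 / 2
  eq4_26 : c 4 2 6 = 0
  eq4_45 : c 4 4 5 = -c 0 0 3 / 2 - c 2 0 3 / 2 - c 2 1 3 / 2 + c 2 2 3 / 2 + c 2 2 5
  eq4_46 : c 4 4 6 = c 0 0 6 - c 2 0 6 - c 2 1 6 + 2 * c 5 3 4
  eq4_56 : c 4 5 6 = c 0 0 3 / 2 + c 2 0 3 / 2 + c 2 1 3 / 2 - c 2 2 3 / 2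
  eq5_02 : c 5 0 2 = 0
  eq5_03 : c 5 0 3 = 0
  eq5_04 : c 5 0 4 = 0
  eq5_12 : c 5 1 2 = c 5 1 6
  eq5_13 : c 5 1 3 = 0
  eq5_14 : c 5 1 4 = 0
  eq5_23 : c 5 2 3 = -c 5 3 4
  eq5_24 : c 5 2 4 = 0
  eq5_35 : c 5 3 5 = -c 0 0 3 / 2 - c 0 0 5 / 2 + c 2 0 3 / 2 + c 2 0 5 / 2 + c 2 1 3 / 2 + c 2 1 5 / 2 + c 2 2 3 / 2 + c 2 2 5 / 2 + 1 / 2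
  eq5_36 : c 5 3 6 = c 5 3 4
  eq5_45 : c 5 4 5 = c 2 0 4 + c 2 1 4 + c 3 5 6
  eq5_46 : c 5 4 6 = 0
  eq5_56 : c 5 5 6 = -c 0 0 2 + c 1 1 2 + c 2 0 6 + c 2 1 6 + c 3 5 6 - 2 * c 5 3 4
  eq6_02 : c 6 0 2 = 0
  eq6_03 : c 6 0 3 = 0
  eq6_04 : c 6 0 4 = 0
  eq6_06 : c 6 0 6 = c 1 0 1 - c 5 0 5
  eq6_12 : c 6 1 2 = -c 0 0 1 - c 2 1 2 - c 5 1 5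
  eq6_13 : c 6 1 3 = -c 2 1 3
  eq6_14 : c 6 1 4 = -c 2 1 4
  eq6_16 : c 6 1 6 = -c 0 0 1 - c 2 1 6 - c 5 1 5
  eq6_23 : c 6 2 3 = -c 0 0 5 / 2 + c 2 0 5 / 2 + c 2 1 5 / 2 + c 2 2 5 / 2 + 1 / 2
  eq6_24 : c 6 2 4 = 0
  eq6_26 : c 6 2 6 = -c 1 1 2 - c 3 5 6 - c 5 2 5
  eq6_34 : c 6 3 4 = c 0 0 5 / 2 - c 2 0 5 / 2 - c 2 1 5 / 2 - c 2 2 5 / 2 - 1 / 2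
  eq6_36 : c 6 3 6 = c 0 0 5 / 2 - c 2 0 5 / 2 - c 2 1 5 / 2 - c 2 2 3 - c 2 2 5 / 2 - 1 / 2
  eq6_46 : c 6 4 6 = -c 0 0 4 - c 2 0 4 - c 2 1 4 - 2 * c 3 5 6

variable {c : Fin 7 → Fin 7 → Fin 7 → ℝ}

/-- The identities are quadratic in general. On these triples, however, each product contains a
coefficient that adaptedness fixes as a constant, so they are linear and combine with the fibre
relations by elimination. -/
theorem AdaptedRelations.linearRelations (h : AdaptedRelations c)
    (h0 : ∀ a b d, a ≠ 0 → b ≠ 0 → d ≠ 0 → bianchi c 0 a b d = 0)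
    (h1 : ∀ a b d, a ≠ 1 → b ≠ 1 → d ≠ 1 → bianchi c 1 a b d = 0)
    (h2 : ∀ a b d, 3 ≤ a → 3 ≤ b → 3 ≤ d → bianchi c 2 a b d = 0) : LinearRelations c := by
  obtain ⟨p9, p10, p11, p14, p15⟩ := h.fibre_left 3 (Or.inl rfl)
  obtain ⟨p17, p18, p19, p22, p23⟩ := h.fibre_left 4 (Or.inr rfl)
  obtain ⟨p33, p34, p35, p38, p39⟩ := h.fibre_left_three
  obtain ⟨p41, p42, p43, p46, p47⟩ := h.fibre_left_four
  obtain ⟨p57, p58, p59, p62, p63⟩ := h.fibre_right_one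
  obtain ⟨p65, p66, p67, p70, p71⟩ := h.fibre_right_two
  obtain ⟨p81, p82, p83, p86, p87⟩ := h.fibre_right 5 (Or.inl rfl)
  obtain ⟨p89, p90, p91, p94, p95⟩ := h.fibre_right 6 (Or.inr rfl)
  have j0_125 := h0 1 2 5 (by decide) (by decide) (by decide)
  have j0_134 := h0 1 3 4 (by decide) (by decide) (by decide)
  have j0_234 := h0 2 3 4 (by decide) (by decide) (by decide)
  have j0_235 := h0 2 3 5 (by decide) (by decide) (by decide)
  have j0_245 := h0 2 4 5 (by decide) (by decide) (by decide)
  have j0_256 := h0 2 5 6 (by decide) (by decide) (by decide)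
  have j0_345 := h0 3 4 5 (by decide) (by decide) (by decide)
  have j0_346 := h0 3 4 6 (by decide) (by decide) (by decide)
  have j1_023 := h1 0 2 3 (by decide) (by decide) (by decide)
  have j1_056 := h1 0 5 6 (by decide) (by decide) (by decide)
  have j1_234 := h1 2 3 4 (by decide) (by decide) (by decide)
  have j1_235 := h1 2 3 5 (by decide) (by decide) (by decide)
  have j1_236 := h1 2 3 6 (by decide) (by decide) (by decide)
  have j1_256 := h1 2 5 6 (by decide) (by decide) (by decide)
  have j1_356 := h1 3 5 6 (by decide) (by decide) (by decide)
  have j1_456 := h1 4 5 6 (by decide) (by decide) (by decide)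
  have j2_345 := h2 3 4 5 (by decide) (by decide) (by decide)
  have j2_346 := h2 3 4 6 (by decide) (by decide) (by decide)
  have j2_356 := h2 3 5 6 (by decide) (by decide) (by decide)
  have j2_456 := h2 4 5 6 (by decide) (by decide) (by decide)
  have hdiag : ∀ i j, c i j j = 0 := fun i j => by linarith [h.swap i j j]
  simp [h.d_gamma, wedgeCoeff] at p46 p47 p70 p71
  simp [bianchi, Fin.sum_univ_seven, h.d_omega, h.d_omegaBar, h.d_gamma, wedgeCoeff, hdiag,
    h.swap _ 1 0, h.swap _ 2 0, h.swap _ 2 1, h.swap _ 3 0, h.swap _ 3 1, h.swap _ 3 2, h.swap _ 4 0, h.swap _ 4 1, h.swap _ 4 2, h.swap _ 4 3,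
    h.swap _ 5 0, h.swap _ 5 1, h.swap _ 5 2, h.swap _ 5 3, h.swap _ 5 4, h.swap _ 6 0, h.swap _ 6 1, h.swap _ 6 2, h.swap _ 6 3, h.swap _ 6 4, h.swap _ 6 5] at j0_125 j0_134 j0_234 j0_235 j0_245 j0_256 j0_345 j0_346 j1_023 j1_056
  simp [bianchi, Fin.sum_univ_seven, h.d_omega, h.d_omegaBar, h.d_gamma, wedgeCoeff, hdiag,
    h.swap _ 1 0, h.swap _ 2 0, h.swap _ 2 1, h.swap _ 3 0, h.swap _ 3 1, h.swap _ 3 2, h.swap _ 4 0, h.swap _ 4 1, h.swap _ 4 2, h.swap _ 4 3,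
    h.swap _ 5 0, h.swap _ 5 1, h.swap _ 5 2, h.swap _ 5 3, h.swap _ 5 4, h.swap _ 6 0, h.swap _ 6 1, h.swap _ 6 2, h.swap _ 6 3, h.swap _ 6 4, h.swap _ 6 5] at j1_234 j1_235 j1_236 j1_256 j1_356 j1_456 j2_345 j2_346 j2_356 j2_456
  exact {
    eq1_13 := by linarith only [j1_356, j0_235, p22, p46]
    eq1_14 := by linarith only [j1_456, j0_245, p14, p47]
    eq1_15 := by linarith only [j1_235, j0_345, p94, p70]
    eq1_16 := by linarith only [j1_236, j0_346, p86, p71]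
    eq2_24 := by linarith only [j2_456, j0_245, p14, p47]
    eq2_26 := by linarith only [j2_346, j0_346]
    eq3_02 := by linarith only [p57]
    eq3_05 := by linarith only [p58]
    eq3_06 := by linarith only [p59]
    eq3_12 := by linarith only [p11, p9]
    eq3_15 := by linarith only [p10]
    eq3_16 := by linarith only [p11]
    eq3_25 := by linarith only [p14]
    eq3_26 := by linarith only [p15]
    eq3_34 := by linarith only [j1_234, j0_234, j1_456, j2_456]
    eq3_35 := by linarith only [j2_356, j0_345, j0_235, j2_345, p70, p22, p46]
    eq3_36 := by linarith only [j2_346, p71, p23]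
    eq3_45 := by linarith only [p62, p14]
    eq3_46 := by linarith only [p63, p15]
    eq4_02 := by linarith only [j1_023]
    eq4_04 := by linarith only [j1_023, p65]
    eq4_05 := by linarith only [p66]
    eq4_06 := by linarith only [p67]
    eq4_12 := by linarith only [p19, p17]
    eq4_14 := by linarith only [j0_134]
    eq4_15 := by linarith only [p18]
    eq4_16 := by linarith only [p19]
    eq4_24 := by linarith only [j0_234]
    eq4_25 := by linarith only [j2_356, j0_235, p22, p46]
    eq4_26 := by linarith only [p23]
    eq4_45 := by linarith only [j2_356, j0_235, p70, p22, p46]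
    eq4_46 := by linarith only [j2_346, j0_346, p71, p23]
    eq4_56 := by linarith only [j2_356, j0_235, p22, p46]
    eq5_02 := by linarith only [p83, p81]
    eq5_03 := by linarith only [p82]
    eq5_04 := by linarith only [p83]
    eq5_12 := by linarith only [p33]
    eq5_13 := by linarith only [p34]
    eq5_14 := by linarith only [p35]
    eq5_23 := by linarith only [p86]
    eq5_24 := by linarith only [p87]
    eq5_35 := by linarith only [j0_345, j0_235, j2_356, j2_345, p94, p22, p46]
    eq5_36 := by linarith only [p38, p86]
    eq5_45 := by linarith only [j2_456, p95, p47]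
    eq5_46 := by linarith only [p39, p87]
    eq5_56 := by linarith only [j1_256, j0_256, j2_346, j0_346]
    eq6_02 := by linarith only [p91, p89]
    eq6_03 := by linarith only [p90]
    eq6_04 := by linarith only [p91]
    eq6_06 := by linarith only [j1_056]
    eq6_12 := by linarith only [j0_125]
    eq6_13 := by linarith only [p42]
    eq6_14 := by linarith only [p43]
    eq6_16 := by linarith only [j0_125, p41]
    eq6_23 := by linarith only [j0_345, j2_345, p94]
    eq6_24 := by linarith only [p95]
    eq6_26 := by linarith only [j1_256]
    eq6_34 := by linarith only [j0_345, j2_345]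
    eq6_36 := by linarith only [j0_345, j2_345, p46, p94]
    eq6_46 := by linarith only [j2_456, j0_245, p47, p95, p14]
  }

/-- The linear relations between the structure functions implied by the relation between
`d² ω⁰ = 0` and `d² ω̄⁰ = 0` along `ω⁰ ∧ ωʲ ∧ ωᵏ` and `ω̄⁰ ∧ ωʲ ∧ ωᵏ`. -/
structure SecondRelations (c : Fin 7 → Fin 7 → Fin 7 → ℝ) : Prop where
  eq2_14 : c 2 1 4 = -c 2 0 4
  eq2_16 : c 2 1 6 = -c 2 0 6
  eq2_15 : c 2 1 5 = -c 2 0 5 - c 2 0 3 - c 2 1 3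
  eq5_34 : c 5 3 4 = c 3 5 6 - c 0 0 2 + c 1 1 2

/-- Products of unknowns do occur on both sides, but `c 0 0 k` and `c 1 1 k` differ by constants for
k ≥ 3, so the products cancel in the difference and linear relations remain. -/
theorem AdaptedRelations.secondRelations (h : AdaptedRelations c) (l : LinearRelations c)
    (hJ : ∀ a b, 3 ≤ a → 3 ≤ b → bianchi c 0 0 a b = bianchi c 1 1 a b) : SecondRelations c := by
  have e1 := hJ 3 4 (by decide) (by decide)
  have e2 := hJ 3 5 (by decide) (by decide)
  have e3 := hJ 3 6 (by decide) (by decide)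
  have e4 := hJ 4 5 (by decide) (by decide)
  have hdiag : ∀ i j, c i j j = 0 := fun i j => by linarith [h.swap i j j]
  simp [bianchi, Fin.sum_univ_seven, h.d_omega, h.d_omegaBar, h.d_gamma, wedgeCoeff, hdiag,
    h.swap _ 1 0, h.swap _ 2 0, h.swap _ 2 1, h.swap _ 3 0, h.swap _ 3 1, h.swap _ 3 2, h.swap _
    4 0, h.swap _ 4 1, h.swap _ 4 2, h.swap _ 4 3, h.swap _ 5 0, h.swap _ 5 1, h.swap _ 5 2,
    h.swap _ 5 3, h.swap _ 5 4, h.swap _ 6 0, h.swap _ 6 1, h.swap _ 6 2, h.swap _ 6 3, h.swap _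
    6 4, h.swap _ 6 5] at e1 e2 e3 e4
  simp only [l.eq1_13, l.eq1_14, l.eq1_15, l.eq1_16, l.eq2_24, l.eq2_26, l.eq3_02, l.eq3_05, l.eq3_06,
    l.eq3_12, l.eq3_15, l.eq3_16, l.eq3_25, l.eq3_26, l.eq3_34, l.eq3_35, l.eq3_36, l.eq3_45,
    l.eq3_46, l.eq4_02, l.eq4_04, l.eq4_05, l.eq4_06, l.eq4_12, l.eq4_14, l.eq4_15, l.eq4_16,
    l.eq4_24, l.eq4_25, l.eq4_26, l.eq4_45, l.eq4_46, l.eq4_56, l.eq5_02, l.eq5_03, l.eq5_04,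
    l.eq5_12, l.eq5_13, l.eq5_14, l.eq5_23, l.eq5_24, l.eq5_35, l.eq5_36, l.eq5_45, l.eq5_46,
    l.eq5_56, l.eq6_02, l.eq6_03, l.eq6_04, l.eq6_06, l.eq6_12, l.eq6_13, l.eq6_14, l.eq6_16,
    l.eq6_23, l.eq6_24, l.eq6_26, l.eq6_34, l.eq6_36, l.eq6_46] at e1 e2 e3 e4
  ring_nf at e1 e2 e3 e4
  exact {
    eq2_14 := by linarith
    eq2_16 := by linarith
    eq2_15 := by linarith
    eq5_34 := by linarith }

/-- The combination is the one in which the derivatives of the coefficients of dγ cancel. The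
conclusion says that the ω⁰ ∧ γ and ω̄⁰ ∧ γ coefficients of dγ determine the same γ-component of ϖ.
-/
theorem AdaptedRelations.eq_of_bianchi_gamma (h : AdaptedRelations c) (l : LinearRelations c)
    (s : SecondRelations c)
    (hJ : bianchi c 2 1 5 6 + bianchi c 2 0 5 6 + bianchi c 2 0 3 6 + bianchi c 2 1 3 6 + bianchi c 2
    1 4 5 + bianchi c 2 0 4 5 - bianchi c 2 0 3 4 - bianchi c 2 1 3 4 = 0) :
    c 2 1 2 = c 1 0 1 - c 0 0 1 - c 2 0 2 := by
  have hdiag : ∀ i j, c i j j = 0 := fun i j => by linarith [h.swap i j j]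
  simp [bianchi, Fin.sum_univ_seven, h.d_omega, h.d_omegaBar, h.d_gamma, wedgeCoeff, hdiag,
    h.swap _ 1 0, h.swap _ 2 0, h.swap _ 2 1, h.swap _ 3 0, h.swap _ 3 1, h.swap _ 3 2, h.swap _
    4 0, h.swap _ 4 1, h.swap _ 4 2, h.swap _ 4 3, h.swap _ 5 0, h.swap _ 5 1, h.swap _ 5 2,
    h.swap _ 5 3, h.swap _ 5 4, h.swap _ 6 0, h.swap _ 6 1, h.swap _ 6 2, h.swap _ 6 3, h.swap _
    6 4, h.swap _ 6 5] at hJ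
  simp only [l.eq1_13, l.eq1_14, l.eq1_15, l.eq1_16, l.eq2_24, l.eq2_26, l.eq3_02, l.eq3_05, l.eq3_06,
    l.eq3_12, l.eq3_15, l.eq3_16, l.eq3_25, l.eq3_26, l.eq3_34, l.eq3_35, l.eq3_36, l.eq3_45,
    l.eq3_46, l.eq4_02, l.eq4_04, l.eq4_05, l.eq4_06, l.eq4_12, l.eq4_14, l.eq4_15, l.eq4_16,
    l.eq4_24, l.eq4_25, l.eq4_26, l.eq4_45, l.eq4_46, l.eq4_56, l.eq5_02, l.eq5_03, l.eq5_04,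
    l.eq5_12, l.eq5_13, l.eq5_14, l.eq5_23, l.eq5_24, l.eq5_35, l.eq5_36, l.eq5_45, l.eq5_46,
    l.eq5_56, l.eq6_02, l.eq6_03, l.eq6_04, l.eq6_06, l.eq6_12, l.eq6_13, l.eq6_14, l.eq6_16,
    l.eq6_23, l.eq6_24, l.eq6_26, l.eq6_34, l.eq6_36, l.eq6_46, s.eq2_14, s.eq2_15, s.eq2_16, s.eq5_34] at hJ
  ring_nf at hJ
  linarith

end Algebra

/-! ## Constant linear changes of coframing -/

section Transform

variable {n : ℕ} {X : Type*} [TopologicalSpace X] [ChartedSpace (EuclideanSpace ℝ (Fin n)) X]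
  [IsManifold (𝓡 n) ∞ X] {U : Set X} {w : Fin n → OneForm n X}

theorem SmoothOn.sum_smul (hw : ∀ i, SmoothOn U (w i)) (a : Fin n → ℝ) :
    SmoothOn U (fun x => ∑ j, a j • w j x) :=
  ContMDiffOn.sum_section fun j _ => ContMDiffOn.const_smul_section (hw j)

/-- The coframing `A w`, for a constant matrix `A`. -/
def transform (A : Matrix (Fin n) (Fin n) ℝ) (w : Fin n → OneForm n X) : Fin n → OneForm n X :=
  fun i x => ∑ j, A i j • w j x

theorem extD_sum_smul (hU : IsOpen U) (hw : ∀ i, SmoothOn U (w i)) (a : Fin n → ℝ) {q : X}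
    (hq : q ∈ U) : extD (fun x => ∑ j, a j • w j x) q = ∑ j, a j • extD (w j) q := by
  have h1 : coordRep (fun x => ∑ j, a j • w j x) q = fun y => ∑ j, a j • coordRep (w j) q y := by
    ext y v
    simp only [sum_apply, smul_apply]
    change (∑ j, a j • w j ((extChartAt (𝓡 n) q).symm y)) (mfderiv 𝓘(ℝ, EuclideanSpace ℝ (Fin n))
      (𝓡 n) (extChartAt (𝓡 n) q).symm y v) = _
    simp only [sum_apply, smul_apply]
    rfl
  have h2 : ∀ j, DifferentiableAt ℝ (coordRep (w j) q) (extChartAt (𝓡 n) q q) := fun j =>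
    ((hw j).contDiffAt_self hU hq).differentiableAt (by simp)
  have h3 : fderiv ℝ (coordRep (fun x => ∑ j, a j • w j x) q) (extChartAt (𝓡 n) q q)
      = ∑ j, a j • fderiv ℝ (coordRep (w j) q) (extChartAt (𝓡 n) q q) := by
    rw [h1]
    exact (HasFDerivAt.fun_sum fun j _ => (h2 j).hasFDerivAt.const_smul (a j)).fderiv
  ext v u
  rw [extD_apply, curl, h3]
  simp only [LinearMap.sum_apply, LinearMap.smul_apply, extD_apply, curl, sum_apply, smul_apply,
    smul_eq_mul, mul_sub, Finset.sum_sub_distrib]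

theorem IsCoframing.transform (hw : IsCoframing U w) {A : Matrix (Fin n) (Fin n) ℝ}
    (hA : A.det ≠ 0) : IsCoframing U (transform A w) := by
  refine ⟨hw.isOpen, fun i => SmoothOn.sum_smul hw.smooth (A i), fun q hq => ?_⟩
  have h := hw.independent q hq
  rw [Fintype.linearIndependent_iff] at h ⊢
  intro g hg
  have h1 : Matrix.vecMul g A = 0 := by
    ext j
    refine h _ ?_ j
    rw [← hg]
    simp only [Backlund.transform, Matrix.vecMul, dotProduct, Finset.smul_sum, Finset.sum_smul, mul_smul]
    exact Finset.sum_comm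
  exact fun i => congrFun (Matrix.eq_zero_of_vecMul_eq_zero hA h1) i

theorem extD_transform (hw : IsCoframing U w) (A : Matrix (Fin n) (Fin n) ℝ) {q : X} (hq : q ∈ U)
    (i : Fin n) : extD (transform A w i) q = ∑ j, A i j • extD (w j) q :=
  extD_sum_smul hw.isOpen hw.smooth (A i) hq

end Transform

/-! ## The fibre coframings of a `1`-adapted coframing -/

section Wedge

variable {n : ℕ} {X : Type*} [TopologicalSpace X] [ChartedSpace (EuclideanSpace ℝ (Fin n)) X] {x : X}

@[simp]
theorem wedge_apply (κ β : Covector n x) (v u : TangentSpace (𝓡 n) x) :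
    wedge κ β v u = κ v * β u - β v * κ u := rfl

/-- This and its mirror image serve to discard terms with a factor in B¹. -/
theorem wedge_mem_wedgeSpan_left {W : Submodule ℝ (Covector n x)} {κ : Covector n x} (hκ : κ ∈ W)
    (β : Covector n x) : wedge κ β ∈ wedgeSpan W :=
  Submodule.subset_span ⟨κ, hκ, β, rfl⟩

theorem wedge_mem_wedgeSpan_right {W : Submodule ℝ (Covector n x)} {κ : Covector n x} (hκ : κ ∈ W)
    (β : Covector n x) : wedge β κ ∈ wedgeSpan W := by
  have h : wedge β κ = -wedge κ β := by
    ext v u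
    simp
  rw [h]
  exact Submodule.neg_mem _ (wedge_mem_wedgeSpan_left hκ β)

theorem wedge_add_right (κ β β' : Covector n x) : wedge κ (β + β') = wedge κ β + wedge κ β' := by
  ext v u
  simp only [wedge_apply, LinearMap.add_apply, add_apply]
  ring

theorem wedgeSpan_mono {W W' : Submodule ℝ (Covector n x)} (h : W ≤ W') :
    wedgeSpan W ≤ wedgeSpan W' :=
  Submodule.span_mono fun _ ⟨κ, hκ, β, hβ⟩ => ⟨κ, h hκ, β, hβ⟩

end Wedge

section Transvection

variable {N : Type*} [TopologicalSpace N] [ChartedSpace (EuclideanSpace ℝ (Fin 7)) N]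

theorem transform_transvection (w : Fin 7 → OneForm 7 N) (i : Fin 7) :
    transform (Matrix.transvection i 2 1) w = Function.update w i (fun x => w 2 x + w i x) := by
  funext k x
  simp only [transform, Matrix.transvection, Matrix.add_apply, add_smul, Finset.sum_add_distrib]
  rcases eq_or_ne k i with rfl | hk
  · simp [Matrix.one_apply, Matrix.single_apply, add_comm]
  · simp [Matrix.one_apply, Matrix.single_apply, hk, hk.symm]

theorem det_transvection_ne_zero {i : Fin 7} (hi : i ≠ 2) :
    (Matrix.transvection i 2 (1 : ℝ)).det ≠ 0 := by
  rw [Matrix.det_transvection_of_ne _ _ hi]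
  exact one_ne_zero

end Transvection

section Adapted

variable {N M M' : Type*}
  [TopologicalSpace N] [ChartedSpace (EuclideanSpace ℝ (Fin 7)) N] [IsManifold (𝓡 7) ∞ N]
  [TopologicalSpace M] [ChartedSpace (EuclideanSpace ℝ (Fin 5)) M] [IsManifold (𝓡 5) ∞ M]
  [TopologicalSpace M'] [ChartedSpace (EuclideanSpace ℝ (Fin 5)) M'] [IsManifold (𝓡 5) ∞ M']
  {𝔅 : RankTwoBacklund N M M'} {U : Set N} {w : Fin 7 → OneForm 7 N} {q : N}

theorem RankTwoBacklund.IsOneAdapted.d_omega_congr (hw : 𝔅.IsOneAdapted U w) (hq : q ∈ U) :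
    CongrMod (extD (w 0) q)
      (wedge (w 3 q) (w 4 q) + wedge (w 5 q) (w 6 q) + wedge (w 5 q) (w 2 q)) {w 0 q} := by
  simpa using hw.d_omega q hq

theorem RankTwoBacklund.IsOneAdapted.d_omegaBar_congr (hw : 𝔅.IsOneAdapted U w) (hq : q ∈ U) :
    CongrMod (extD (w 1) q)
      (wedge (w 3 q) (w 4 q) + wedge (w 5 q) (w 6 q) + wedge (w 3 q) (w 2 q)) {w 1 q} := by
  simpa using hw.d_omegaBar q hq

theorem RankTwoBacklund.IsOneAdapted.mem_deg1 (hw : 𝔅.IsOneAdapted U w) (hq : q ∈ U) :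
    w 0 q ∈ 𝔅.B.deg1 q ∧ w 1 q ∈ 𝔅.B.deg1 q ∧ w 2 q ∈ 𝔅.B.deg1 q := by
  rw [← hw.span_gamma q hq]
  refine ⟨Submodule.subset_span ?_, Submodule.subset_span ?_, Submodule.subset_span ?_⟩ <;> simp

theorem RankTwoBacklund.wedgeSpan_le_deg2 (𝔅 : RankTwoBacklund N M M') (q : N) :
    wedgeSpan (𝔅.B.deg1 q) ≤ 𝔅.B.deg2 q := by
  obtain ⟨W, θ, _, hqW, _, h⟩ := 𝔅.extension.local_form q
  rw [(h q hqW).2.2.1]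
  exact le_sup_left

/-- Since B is closed, it contains dω⁰ and dγ. Modulo forms with a factor in B¹ these are the sum
and the difference of ω¹ ∧ ω² and ω³ ∧ ω⁴, so B contains each of the two. -/
theorem RankTwoBacklund.IsOneAdapted.mem_deg2 (hw : 𝔅.IsOneAdapted U w) (hq : q ∈ U) :
    wedge (w 3 q) (w 4 q) ∈ 𝔅.B.deg2 q ∧ wedge (w 5 q) (w 6 q) ∈ 𝔅.B.deg2 q := by
  have hle := 𝔅.wedgeSpan_le_deg2 q
  obtain ⟨m0, m1, m2⟩ := hw.mem_deg1 hq
  have h0 := 𝔅.closed U (w 0) hw.coframing.isOpen (hw.coframing.smooth 0)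
    (fun q' hq' => (hw.mem_deg1 hq').1) q hq
  have h2 := 𝔅.closed U (w 2) hw.coframing.isOpen (hw.coframing.smooth 2)
    (fun q' hq' => (hw.mem_deg1 hq').2.2) q hq
  have c0 := hle (wedgeSpan_mono (Submodule.span_le.2 (by simpa using m0)) (hw.d_omega_congr hq))
  have c2 := hle (wedgeSpan_mono (Submodule.span_le.2
    (by simp [Set.insert_subset_iff, m0, m1, m2])) (hw.d_gamma q hq))
  have c52 := hle (wedge_mem_wedgeSpan_right m2 (w 5 q))
  have hsum : wedge (w 3 q) (w 4 q) + wedge (w 5 q) (w 6 q) ∈ 𝔅.B.deg2 q := by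
    have := Submodule.sub_mem _ (Submodule.sub_mem _ h0 c0) c52
    convert this using 1
    abel
  have hdiff : wedge (w 3 q) (w 4 q) - wedge (w 5 q) (w 6 q) ∈ 𝔅.B.deg2 q := by
    have := Submodule.sub_mem _ h2 c2
    convert this using 1
    abel
  constructor
  · have := Submodule.smul_mem _ (1 / 2 : ℝ) (Submodule.add_mem _ hsum hdiff)
    convert this using 1
    module
  · have := Submodule.smul_mem _ (1 / 2 : ℝ) (Submodule.sub_mem _ hsum hdiff)
    convert this using 1
    module

theorem extD_add_gamma (hw : IsCoframing U w) (hq : q ∈ U) (i : Fin 7) :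
    extD (fun x => w 2 x + w i x) q = extD (w 2) q + extD (w i) q := by
  have h := extD_transform hw (Matrix.transvection i 2 1) hq i
  rw [transform_transvection, Function.update_self] at h
  rw [h]
  simp only [Matrix.transvection, Matrix.add_apply, add_smul, Finset.sum_add_distrib]
  simp [Matrix.one_apply, Matrix.single_apply, add_comm]

theorem IsCoframing.reindex (hw : IsCoframing U w) (e : Equiv.Perm (Fin 7)) :
    IsCoframing U (w ∘ e) :=
  ⟨hw.isOpen, fun i => hw.smooth (e i), fun q hq => (hw.independent q hq).comp e e.injective⟩

/-- Replacing ω⁴ by γ + ω⁴ absorbs the term ω³ ∧ γ of dω⁰. The semi-basic forms for π are thus ω⁰,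
ω¹, ω², ω³ and γ + ω⁴. -/
theorem RankTwoBacklund.IsOneAdapted.isFibreCoframing_left (hw : 𝔅.IsOneAdapted U w) :
    IsFibreCoframing 𝔅.π 𝔅.B 𝔅.I U (Function.update w 6 (fun x => w 2 x + w 6 x)) := by
  refine ⟨?_, hw.span_omega, fun q hq => (hw.span_gamma q hq).symm, fun q hq => ?_,
    fun q hq => (hw.mem_deg2 hq).1, fun q hq => ?_⟩
  · rw [← transform_transvection]
    exact hw.coframing.transform (det_transvection_ne_zero (by decide))
  · change CongrMod (extD (w 0) q)
      (wedge (w 3 q) (w 4 q) + wedge (w 5 q) (w 2 q + w 6 q)) {w 0 q}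
    have h : wedge (w 3 q) (w 4 q) + wedge (w 5 q) (w 2 q + w 6 q)
        = wedge (w 3 q) (w 4 q) + wedge (w 5 q) (w 6 q) + wedge (w 5 q) (w 2 q) := by
      rw [wedge_add_right]
      abel
    rw [h]
    exact hw.d_omega_congr hq
  · change wedge (w 5 q) (w 2 q + w 6 q) ∈ _
    rw [wedge_add_right]
    exact Submodule.add_mem _ (𝔅.wedgeSpan_le_deg2 q
      (wedge_mem_wedgeSpan_right (hw.mem_deg1 hq).2.2 (w 5 q))) (hw.mem_deg2 hq).2

/-- For the other extension it is ω² that absorbs γ, because of the term ω¹ ∧ γ in dω̄⁰. The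
transposition puts ω̄⁰ in first place. -/
theorem RankTwoBacklund.IsOneAdapted.isFibreCoframing_right (hw : 𝔅.IsOneAdapted U w) :
    IsFibreCoframing 𝔅.π' 𝔅.B 𝔅.I' U
      (Function.update w 4 (fun x => w 2 x + w 4 x) ∘ Equiv.swap 0 1) := by
  refine ⟨?_, hw.span_omegaBar, fun q hq => ?_, fun q hq => ?_, fun q hq => ?_,
    fun q hq => (hw.mem_deg2 hq).2⟩
  · rw [← transform_transvection]
    exact (hw.coframing.transform (det_transvection_ne_zero (by decide))).reindex _
  · rw [← hw.span_gamma q hq]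
    exact congrArg _ (Set.insert_comm _ _ _)
  · change CongrMod (extD (w 1) q)
      (wedge (w 3 q) (w 2 q + w 4 q) + wedge (w 5 q) (w 6 q)) {w 1 q}
    have h : wedge (w 3 q) (w 2 q + w 4 q) + wedge (w 5 q) (w 6 q)
        = wedge (w 3 q) (w 4 q) + wedge (w 5 q) (w 6 q) + wedge (w 3 q) (w 2 q) := by
      rw [wedge_add_right]
      abel
    rw [h]
    exact hw.d_omegaBar_congr hq
  · change wedge (w 3 q) (w 2 q + w 4 q) ∈ _
    rw [wedge_add_right]
    exact Submodule.add_mem _ (𝔅.wedgeSpan_le_deg2 q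
      (wedge_mem_wedgeSpan_right (hw.mem_deg1 hq).2.2 (w 3 q))) (hw.mem_deg2 hq).1

end Adapted

/-! ## The structure functions of a `1`-adapted coframing -/

section AdaptedStructure

variable {N M M' : Type*}
  [TopologicalSpace N] [ChartedSpace (EuclideanSpace ℝ (Fin 7)) N] [IsManifold (𝓡 7) ∞ N]
  [TopologicalSpace M] [ChartedSpace (EuclideanSpace ℝ (Fin 5)) M] [IsManifold (𝓡 5) ∞ M]
  [TopologicalSpace M'] [ChartedSpace (EuclideanSpace ℝ (Fin 5)) M'] [IsManifold (𝓡 5) ∞ M']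
  {𝔅 : RankTwoBacklund N M M'} {U : Set N} {w : Fin 7 → OneForm 7 N} {p q : N}

theorem RankTwoBacklund.IsOneAdapted.extD_left (hw : 𝔅.IsOneAdapted U w) (hq : q ∈ U)
    {v u : TangentSpace (𝓡 7) q}
    (hv : w 0 q v = 0 ∧ w 3 q v = 0 ∧ w 4 q v = 0 ∧ w 5 q v = 0 ∧ w 2 q v + w 6 q v = 0)
    (hu : w 0 q u = 0) :
    (w 3 q u = 0 → w 4 q u = 0 → extD (w 3) q v u = 0 ∧ extD (w 4) q v u = 0) ∧
    (w 5 q u = 0 → w 2 q u + w 6 q u = 0 →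
      extD (w 5) q v u = 0 ∧ extD (w 2) q v u + extD (w 6) q v u = 0) := by
  have h := hw.isFibreCoframing_left.extD_eq_zero 𝔅.mongeAmpere 𝔅.extension hq hv hu
  refine ⟨h.1, fun h5 h6 => ⟨(h.2 h5 h6).1, ?_⟩⟩
  have h' : extD (fun x => w 2 x + w 6 x) q v u = 0 := (h.2 h5 h6).2
  rwa [extD_add_gamma hw.coframing hq] at h'

theorem RankTwoBacklund.IsOneAdapted.extD_right (hw : 𝔅.IsOneAdapted U w) (hq : q ∈ U)
    {v u : TangentSpace (𝓡 7) q}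
    (hv : w 1 q v = 0 ∧ w 3 q v = 0 ∧ w 2 q v + w 4 q v = 0 ∧ w 5 q v = 0 ∧ w 6 q v = 0)
    (hu : w 1 q u = 0) :
    (w 3 q u = 0 → w 2 q u + w 4 q u = 0 →
      extD (w 3) q v u = 0 ∧ extD (w 2) q v u + extD (w 4) q v u = 0) ∧
    (w 5 q u = 0 → w 6 q u = 0 → extD (w 5) q v u = 0 ∧ extD (w 6) q v u = 0) := by
  have h := hw.isFibreCoframing_right.extD_eq_zero 𝔅.mongeAmpere' 𝔅.extension' hq hv hu
  refine ⟨fun h3 h4 => ⟨(h.1 h3 h4).1, ?_⟩, h.2⟩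
  have h' : extD (fun x => w 2 x + w 4 x) q v u = 0 := (h.1 h3 h4).2
  rwa [extD_add_gamma hw.coframing hq] at h'

theorem RankTwoBacklund.IsOneAdapted.adaptedRelations (hw : 𝔅.IsOneAdapted U w) (hq : q ∈ U)
    (hqp : q ∈ (extChartAt (𝓡 7) p).source) :
    AdaptedRelations (fun i j k => structFn w p i j k (extChartAt (𝓡 7) p q)) := by
  obtain ⟨c, hc⟩ : ∃ c : Fin 7 → Fin 7 → Fin 7 → ℝ,
      ∀ i j k, c i j k = structFn w p i j k (extChartAt (𝓡 7) p q) := ⟨_, fun _ _ _ => rfl⟩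
  simp only [← hc]
  obtain ⟨e, he⟩ : ∃ e : Fin 7 → TangentSpace (𝓡 7) q, ∀ j, e j = frameVec w p q j :=
    ⟨_, fun _ => rfl⟩
  have hd : ∀ i j, w i q (e j) = if i = j then 1 else 0 := fun i j => by
    rw [he]; exact hw.coframing.apply_frameVec hq hqp i j
  have hval : ∀ i j k, extD (w i) q (e j) (e k) = c i j k := fun i j k => by
    rw [he, he, hc]; exact hw.coframing.extD_frameVec hq hqp i j k
  have hswap : ∀ i j k, c i j k = -c i k j := fun i j k => by
    rw [hc, hc]; exact structureFn_swap _ _ _ _ _ _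
  have hdiag : ∀ i j, c i j j = 0 := fun i j => by linarith [hswap i j j]
  have hL := fun v u hv hu => hw.extD_left hq (v := v) (u := u) hv hu
  have hR := fun v u hv hu => hw.extD_right hq (v := v) (u := u) hv hu
  -- In the frame dual to `w`, the fibres of `π` are spanned by `e 1` and `e 2 - e 6`, and those of
  -- `π'` by `e 0` and `e 2 - e 4`. The relations come from pairing these with the frame vectors the
  -- two lemmas allow.
  have l1 := fun u => hL (e 1) u (by simp [hd])
  have l2 := fun u => hL (e 2 - e 6) u (by simp [hd])
  have r1 := fun u => hR (e 0) u (by simp [hd])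
  have r2 := fun u => hR (e 2 - e 4) u (by simp [hd])
  have l12 := l1 (e 2 - e 6) (by simp [hd])
  have l15 := (l1 (e 5) (by simp [hd])).1
  have l16 := (l1 (e 6) (by simp [hd])).1
  have l13 := (l1 (e 3) (by simp [hd])).2
  have l14 := (l1 (e 4) (by simp [hd])).2
  have l25 := (l2 (e 5) (by simp [hd])).1
  have l26 := (l2 (e 6) (by simp [hd])).1
  have l23 := (l2 (e 3) (by simp [hd])).2
  have l24 := (l2 (e 4) (by simp [hd])).2
  have r12 := r1 (e 2 - e 4) (by simp [hd])
  have r15 := (r1 (e 5) (by simp [hd])).1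
  have r16 := (r1 (e 6) (by simp [hd])).1
  have r13 := (r1 (e 3) (by simp [hd])).2
  have r14 := (r1 (e 4) (by simp [hd])).2
  have r25 := (r2 (e 5) (by simp [hd])).1
  have r26 := (r2 (e 6) (by simp [hd])).1
  have r23 := (r2 (e 3) (by simp [hd])).2
  have r24 := (r2 (e 4) (by simp [hd])).2
  simp [hd, hval, hdiag] at l12 l13 l14 l15 l16 l23 l24 l25 l26 r12 r13 r14 r15 r16 r23 r24 r25 r26
  constructor
  · exact hswap
  · intro j k hj hk
    rw [← hval, (hw.d_omega_congr hq).apply_eq (by simp [hd, hj.symm]) (by simp [hd, hk.symm])]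
    simp only [LinearMap.add_apply, wedge_apply, hd, wedgeCoeff]
  · intro j k hj hk
    rw [← hval, (hw.d_omegaBar_congr hq).apply_eq (by simp [hd, hj.symm]) (by simp [hd, hk.symm])]
    simp only [LinearMap.add_apply, wedge_apply, hd, wedgeCoeff]
  · intro j k hj hk
    have hne : ∀ i : Fin 7, 3 ≤ i → 0 ≠ i ∧ 1 ≠ i ∧ 2 ≠ i := by decide
    rw [← hval, (hw.d_gamma q hq).apply_eq (by simp [hd, hne j hj]) (by simp [hd, hne k hk])]
    simp only [LinearMap.sub_apply, wedge_apply, hd, wedgeCoeff]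
  · have s5 := hswap 3 5 6
    have s5' := hswap 4 5 6
    rintro i (rfl | rfl) <;> refine ⟨?_, ?_, ?_, ?_, ?_⟩ <;> linarith
  · have s3 := hswap 5 3 6
    have s4 := hswap 5 4 6
    refine ⟨?_, ?_, ?_, ?_, ?_⟩ <;> linarith
  · have s3 := hswap 6 3 6
    have s4 := hswap 6 4 6
    have s3' := hswap 2 3 6
    have s4' := hswap 2 4 6
    refine ⟨?_, ?_, ?_, ?_, ?_⟩ <;> linarith
  · have s3 := hswap 5 3 4
    have s3' := hswap 6 3 4
    rintro i (rfl | rfl) <;> refine ⟨?_, ?_, ?_, ?_, ?_⟩ <;> linarith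
  · refine ⟨?_, ?_, ?_, ?_, ?_⟩ <;> linarith
  · refine ⟨?_, ?_, ?_, ?_, ?_⟩ <;> linarith

theorem fderiv_eq_of_eventually_eq_add_const {E : Type*} [NormedAddCommGroup E] [NormedSpace ℝ E]
    {f g : E → ℝ} {y : E} {C : ℝ} (h : ∀ᶠ z in nhds y, f z = g z + C) :
    fderiv ℝ f y = fderiv ℝ g y := by
  have h' : f =ᶠ[nhds y] fun z => g z + C := h
  rw [h'.fderiv_eq, fderiv_add_const]

theorem fderiv_eq_zero_of_eventually_eq_const {E : Type*} [NormedAddCommGroup E] [NormedSpace ℝ E]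
    {f : E → ℝ} {y : E} {C : ℝ} (h : ∀ᶠ z in nhds y, f z = C) : fderiv ℝ f y = 0 := by
  have h' : f =ᶠ[nhds y] fun _ => C := h
  rw [h'.fderiv_eq, fderiv_fun_const]
  rfl

theorem eventually_structFn {P : (Fin 7 → Fin 7 → Fin 7 → ℝ) → Prop} (hU : IsOpen U)
    (hq : q ∈ U) (hqp : q ∈ (extChartAt (𝓡 7) p).source)
    (h : ∀ q' ∈ U, q' ∈ (extChartAt (𝓡 7) p).source →
      P (fun i j k => structFn w p i j k (extChartAt (𝓡 7) p q'))) :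
    ∀ᶠ y in nhds (extChartAt (𝓡 7) p q), P (fun i j k => structFn w p i j k y) := by
  filter_upwards [eventually_chart hqp (hU.mem_nhds hq)] with y hy
  obtain ⟨z, hz, rfl, hzU⟩ := hy
  exact h z hzU hz

/-- The identity d² = 0 with its derivative terms isolated, so that relations valid near the point
can be used to eliminate them. -/
theorem IsCoframing.bianchi_eq (hw : IsCoframing U w) (hq : q ∈ U)
    (hqp : q ∈ (extChartAt (𝓡 7) p).source) (i a b d : Fin 7) :
    bianchi (fun i j k => structFn w p i j k (extChartAt (𝓡 7) p q)) i a b d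
      = -fderiv ℝ (structFn w p i b d) (extChartAt (𝓡 7) p q)
          (dualFrame (coordCoframe w p) a (extChartAt (𝓡 7) p q))
        - fderiv ℝ (structFn w p i d a) (extChartAt (𝓡 7) p q)
          (dualFrame (coordCoframe w p) b (extChartAt (𝓡 7) p q))
        - fderiv ℝ (structFn w p i a b) (extChartAt (𝓡 7) p q)
          (dualFrame (coordCoframe w p) d (extChartAt (𝓡 7) p q)) := by
  have h := (hw.isDualFrameAt hq hqp).jacobi ((hw.contDiffAt hq hqp i).of_le (WithTop.coe_le_coe.2 le_top)) a b d
  simp only [bianchi, structFn] at h ⊢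
  linarith

/-- The coefficients occurring under the derivatives are constants on a neighbourhood, so the
quadratic part of d² = 0 vanishes by itself. -/
theorem RankTwoBacklund.IsOneAdapted.linearRelations (hw : 𝔅.IsOneAdapted U w) (hq : q ∈ U)
    (hqp : q ∈ (extChartAt (𝓡 7) p).source) :
    LinearRelations (fun i j k => structFn w p i j k (extChartAt (𝓡 7) p q)) := by
  have hev := eventually_structFn hw.coframing.isOpen hq hqp
    fun q' hq' hqp' => hw.adaptedRelations hq' hqp'
  have z0 : ∀ j k : Fin 7, j ≠ 0 → k ≠ 0 →
      fderiv ℝ (structFn w p 0 j k) (extChartAt (𝓡 7) p q) = 0 := fun j k hj hk =>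
    fderiv_eq_zero_of_eventually_eq_const (hev.mono fun y hy => hy.d_omega j k hj hk)
  have z1 : ∀ j k : Fin 7, j ≠ 1 → k ≠ 1 →
      fderiv ℝ (structFn w p 1 j k) (extChartAt (𝓡 7) p q) = 0 := fun j k hj hk =>
    fderiv_eq_zero_of_eventually_eq_const (hev.mono fun y hy => hy.d_omegaBar j k hj hk)
  have z2 : ∀ j k : Fin 7, 3 ≤ j → 3 ≤ k →
      fderiv ℝ (structFn w p 2 j k) (extChartAt (𝓡 7) p q) = 0 := fun j k hj hk =>
    fderiv_eq_zero_of_eventually_eq_const (hev.mono fun y hy => hy.d_gamma j k hj hk)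
  refine (hw.adaptedRelations hq hqp).linearRelations (fun a b d ha hb hd => ?_)
    (fun a b d ha hb hd => ?_) fun a b d ha hb hd => ?_
  · rw [hw.coframing.bianchi_eq hq hqp, z0 b d hb hd, z0 d a hd ha, z0 a b ha hb]
    simp
  · rw [hw.coframing.bianchi_eq hq hqp, z1 b d hb hd, z1 d a hd ha, z1 a b ha hb]
    simp
  · rw [hw.coframing.bianchi_eq hq hqp, z2 b d hb hd, z2 d a hd ha, z2 a b ha hb]
    simp

/-- The ω⁰ ∧ ωʲ ∧ ωᵏ component of d²ω⁰ = 0 and the ω̄⁰ ∧ ωʲ ∧ ωᵏ component of d²ω̄⁰ = 0 contain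
derivatives of `c 0 0 k` and `c 1 1 k`. The linear relations, which hold near the point, show that
these functions differ by constants, so the quadratic parts agree. -/
theorem RankTwoBacklund.IsOneAdapted.secondRelations (hw : 𝔅.IsOneAdapted U w) (hq : q ∈ U)
    (hqp : q ∈ (extChartAt (𝓡 7) p).source) :
    SecondRelations (fun i j k => structFn w p i j k (extChartAt (𝓡 7) p q)) := by
  have hev := eventually_structFn hw.coframing.isOpen hq hqp
    fun q' hq' hqp' => hw.adaptedRelations hq' hqp'
  have hev' := eventually_structFn hw.coframing.isOpen hq hqp
    fun q' hq' hqp' => hw.linearRelations hq' hqp'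
  have hne : ∀ i : Fin 7, 3 ≤ i → i ≠ 0 ∧ i ≠ 1 := by decide
  have hcase : ∀ k : Fin 7, 3 ≤ k → k = 3 ∨ k = 4 ∨ k = 5 ∨ k = 6 := by decide
  have z : ∀ k : Fin 7, 3 ≤ k → fderiv ℝ (structFn w p 1 1 k) (extChartAt (𝓡 7) p q)
      = fderiv ℝ (structFn w p 0 0 k) (extChartAt (𝓡 7) p q) := by
    intro k hk
    rcases hcase k hk with rfl | rfl | rfl | rfl
    · exact fderiv_eq_of_eventually_eq_add_const (C := -1) (hev'.mono fun y hy => hy.eq1_13)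
    · exact fderiv_eq_of_eventually_eq_add_const (C := 0)
        (hev'.mono fun y hy => hy.eq1_14.trans (add_zero _).symm)
    · exact fderiv_eq_of_eventually_eq_add_const (C := -1) (hev'.mono fun y hy => hy.eq1_15)
    · exact fderiv_eq_of_eventually_eq_add_const (C := 0)
        (hev'.mono fun y hy => hy.eq1_16.trans (add_zero _).symm)
  refine (hw.adaptedRelations hq hqp).secondRelations (hw.linearRelations hq hqp) ?_
  intro a b ha hb
  have z0 : fderiv ℝ (structFn w p 0 a b) (extChartAt (𝓡 7) p q) = 0 :=
    fderiv_eq_zero_of_eventually_eq_const (hev.mono fun y hy =>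
      hy.d_omega a b (hne a ha).1 (hne b hb).1)
  have z1 : fderiv ℝ (structFn w p 1 a b) (extChartAt (𝓡 7) p q) = 0 :=
    fderiv_eq_zero_of_eventually_eq_const (hev.mono fun y hy =>
      hy.d_omegaBar a b (hne a ha).2 (hne b hb).2)
  rw [hw.coframing.bianchi_eq hq hqp, hw.coframing.bianchi_eq hq hqp, z0, z1,
    fderiv_structFn_swap w p 0 b 0, fderiv_structFn_swap w p 1 b 1, z a ha, z b hb]
  simp

/-- Put S k = `c 2 0 k + c 2 1 k`. Near the point S 4 = S 6 = 0 and S 5 = -S 3. The sum of the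
components of d²γ = 0 along e₀ and e₁ with (e₅, e₆), (e₃, e₆), (e₄, e₅), minus the one with (e₃,
e₄), contains only derivatives of S 4, S 6 and S 3 + S 5, so it is algebraic. -/
theorem RankTwoBacklund.IsOneAdapted.gammaRelation (hw : 𝔅.IsOneAdapted U w) (hq : q ∈ U)
    (hqp : q ∈ (extChartAt (𝓡 7) p).source) :
    structFn w p 2 1 2 (extChartAt (𝓡 7) p q) = structFn w p 1 0 1 (extChartAt (𝓡 7) p q)
      - structFn w p 0 0 1 (extChartAt (𝓡 7) p q) - structFn w p 2 0 2 (extChartAt (𝓡 7) p q) := by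
  have hev := eventually_structFn hw.coframing.isOpen hq hqp
    fun q' hq' hqp' => hw.adaptedRelations hq' hqp'
  have hev' := eventually_structFn hw.coframing.isOpen hq hqp
    fun q' hq' hqp' => hw.secondRelations hq' hqp'
  have hF := hw.coframing.isDualFrameAt hq hqp
  have hd : ∀ j k, DifferentiableAt ℝ (structFn w p 2 j k) (extChartAt (𝓡 7) p q) := fun j k =>
    differentiableAt_structureFn hF ((hw.coframing.contDiffAt hq hqp 2).of_le (WithTop.coe_le_coe.2 le_top)) j k
  have z2 : ∀ j k : Fin 7, 3 ≤ j → 3 ≤ k →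
      fderiv ℝ (structFn w p 2 j k) (extChartAt (𝓡 7) p q) = 0 := fun j k hj hk =>
    fderiv_eq_zero_of_eventually_eq_const (hev.mono fun y hy => hy.d_gamma j k hj hk)
  have f4 : fderiv ℝ (structFn w p 2 1 4) (extChartAt (𝓡 7) p q)
      = -fderiv ℝ (structFn w p 2 0 4) (extChartAt (𝓡 7) p q) := by
    rw [← fderiv_neg]
    exact Filter.EventuallyEq.fderiv_eq (hev'.mono fun y hy => hy.eq2_14)
  have f6 : fderiv ℝ (structFn w p 2 1 6) (extChartAt (𝓡 7) p q)
      = -fderiv ℝ (structFn w p 2 0 6) (extChartAt (𝓡 7) p q) := by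
    rw [← fderiv_neg]
    exact Filter.EventuallyEq.fderiv_eq (hev'.mono fun y hy => hy.eq2_16)
  have f5 : fderiv ℝ (structFn w p 2 1 5) (extChartAt (𝓡 7) p q)
      = -fderiv ℝ (structFn w p 2 0 5) (extChartAt (𝓡 7) p q)
        - fderiv ℝ (structFn w p 2 0 3) (extChartAt (𝓡 7) p q)
        - fderiv ℝ (structFn w p 2 1 3) (extChartAt (𝓡 7) p q) := by
    rw [← fderiv_neg, ← fderiv_sub (hd 0 5).neg (hd 0 3),
      ← fderiv_sub ((hd 0 5).neg.sub (hd 0 3)) (hd 1 3)]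
    exact Filter.EventuallyEq.fderiv_eq (hev'.mono fun y hy => hy.eq2_15)
  refine (hw.adaptedRelations hq hqp).eq_of_bianchi_gamma (hw.linearRelations hq hqp)
    (hw.secondRelations hq hqp) ?_
  simp only [hw.coframing.bianchi_eq hq hqp]
  rw [z2 5 6 (by decide) (by decide), z2 3 6 (by decide) (by decide),
    z2 4 5 (by decide) (by decide), z2 3 4 (by decide) (by decide),
    fderiv_structFn_swap w p 2 6 1, fderiv_structFn_swap w p 2 6 0,
    fderiv_structFn_swap w p 2 5 1, fderiv_structFn_swap w p 2 5 0,
    fderiv_structFn_swap w p 2 4 1, fderiv_structFn_swap w p 2 4 0, f4, f5, f6]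
  simp only [neg_apply, sub_apply, zero_apply]
  ring

end AdaptedStructure

/-! ## Existence of the torsion functions -/

section Torsion

variable {N : Type*} [TopologicalSpace N] [ChartedSpace (EuclideanSpace ℝ (Fin 7)) N]

theorem structureEquationsAt_iff {w : Fin 7 → OneForm 7 N} {p : N} {T : TorsionCoefficients} :
    StructureEquationsAt w p T ↔ ∃ φ ϖ α β : Covector 7 p,
      (extD (w 0) p = -wedge φ (w 0 p) + (wedge (w 3 p) (w 4 p) + wedge (w 5 p) (w 6 p + w 2 p)
        + wedge (T.P₀ • w 1 p + T.K • w 2 p + T.P₁ • w 3 p + T.P₂ • w 4 p + T.P₃ • w 5 p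
          + T.P₄ • w 6 p) (w 0 p))) ∧
      (extD (w 1) p = -wedge φ (w 1 p) + (wedge (w 3 p) (w 4 p + w 2 p) + wedge (w 5 p) (w 6 p)
        + wedge (T.P₀ • w 0 p - T.K • w 2 p + T.Q₁ • w 3 p + T.Q₂ • w 4 p + T.Q₃ • w 5 p
          + T.Q₄ • w 6 p) (w 1 p))) ∧
      (extD (w 2) p = -(wedge ϖ (w 0 p) - wedge ϖ (w 1 p) + wedge φ (w 2 p))
        + (wedge (w 3 p) (w 4 p) - wedge (w 5 p) (w 6 p)
        + wedge (T.C₁ • w 3 p + T.C₂ • w 4 p + T.C₃ • w 5 p + T.C₄ • w 6 p) (w 0 p + w 1 p))) ∧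
      (extD (w 3) p = 0 + (T.T1_0 • wedge (w 0 p) (w 1 p)
        + wedge (w 0 p) (T.T1_1 • w 3 p + T.T1_2 • (w 4 p + w 2 p))
        + wedge (w 1 p) (T.Tb1_1 • w 3 p + T.Tb1_2 • w 4 p)
        + wedge (w 2 p) (T.R1_1 • w 3 p + T.R1_2 • w 4 p)
        + T.S₁ • wedge (w 5 p) (w 2 p + w 4 p + w 6 p)
        + T.T1_12 • wedge (w 3 p) (w 4 p) + T.T1_13 • wedge (w 3 p) (w 5 p)
        + T.T1_14 • wedge (w 3 p) (w 6 p))) ∧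
      (extD (w 4) p = -(-wedge ϖ (w 0 p) + wedge α (w 3 p) + wedge φ (w 4 p))
        + (T.T2_0 • wedge (w 0 p) (w 1 p)
        + wedge (w 0 p) (T.C₃ • w 5 p + T.C₄ • w 6 p + T.T2_2 • (w 4 p + w 2 p))
        + T.Tb2_2 • wedge (w 1 p) (w 4 p)
        + wedge (w 2 p) (T.C₂ • w 0 p + T.R2_2 • w 4 p)
        + T.S₂ • wedge (w 5 p) (w 2 p + w 4 p + w 6 p))) ∧
      (extD (w 5) p = 0 + (T.T3_0 • wedge (w 1 p) (w 0 p)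
        + wedge (w 1 p) (T.Tb3_3 • w 5 p + T.Tb3_4 • (w 6 p + w 2 p))
        + wedge (w 0 p) (T.T3_3 • w 5 p + T.T3_4 • w 6 p)
        + wedge (w 2 p) (T.R3_3 • w 5 p + T.R3_4 • w 6 p)
        + T.S₃ • wedge (w 3 p) (w 2 p + w 4 p + w 6 p)
        + T.T3_13 • wedge (w 3 p) (w 5 p) + T.T3_23 • wedge (w 4 p) (w 5 p)
        + T.T3_34 • wedge (w 5 p) (w 6 p))) ∧
      (extD (w 6) p = -(wedge ϖ (w 1 p) + wedge β (w 5 p) + wedge φ (w 6 p))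
        + ((-T.T2_0) • wedge (w 1 p) (w 0 p)
        + wedge (w 1 p) (T.C₁ • w 3 p + T.C₂ • w 4 p + T.Tb4_4 • (w 6 p + w 2 p))
        + T.T4_4 • wedge (w 0 p) (w 6 p)
        + wedge (w 2 p) (T.C₄ • w 1 p + T.R4_4 • w 6 p)
        + T.S₄ • wedge (w 3 p) (w 2 p + w 4 p + w 6 p))) := by
  constructor
  · rintro ⟨φ, ϖ, α, β, h⟩
    exact ⟨φ, ϖ, α, β, congrFun h 0, congrFun h 1, congrFun h 2, congrFun h 3, congrFun h 4,
      congrFun h 5, congrFun h 6⟩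
  · rintro ⟨φ, ϖ, α, β, h0, h1, h2, h3, h4, h5, h6⟩
    refine ⟨φ, ϖ, α, β, funext fun i => ?_⟩
    match i with
    | 0 => exact h0
    | 1 => exact h1
    | 2 => exact h2
    | 3 => exact h3
    | 4 => exact h4
    | 5 => exact h5
    | 6 => exact h6

variable {w : Fin 7 → OneForm 7 N} {p q : N}

/-- A coframing whose structure functions satisfy the relations implied by `d² = 0` satisfies the
structure equations. -/
theorem exists_hasTorsionAt {c : Fin 7 → Fin 7 → Fin 7 → ℝ} (hc : AdaptedRelations c)
    (hl : LinearRelations c) (hs : SecondRelations c) (hg : c 2 1 2 = c 1 0 1 - c 0 0 1 - c 2 0 2)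
    (hd : ∀ i, ∀ v u : TangentSpace (𝓡 7) q,
      extD (w i) q v u = ∑ j, ∑ k, w j q v * (w k q u * c i j k)) :
    ∃ τ, HasTorsionAt w q τ := by
  have hdiag : ∀ i j, c i j j = 0 := fun i j => by linarith [hc.swap i j j]
  -- Each value is a combination of coefficients in which the pseudo-connection cancels. For `τ 10`
  -- = T²₀ the coefficients of ω⁰ ∧ ω̄⁰ in dγ, dω² and dω⁴ are added: the contributions of ϖ sum to
  -- zero and T²₀ is counted twice.
  obtain ⟨τ, h0, h1, h2, h3, h4, h5, h6, h7, h8, h9, h10, h11, h12, h13, h14, h15, h16, h17, h18,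
      h19⟩ : ∃ τ : Fin 20 → ℝ, τ 0 = -c 2 0 3 / 2 - c 2 1 3 / 2 ∧ τ 1 = c 2 2 3 - c 0 0 3 ∧ τ 2 = 2 * c 3 5 6 ∧ τ 3 = c
      2 2 5 - c 0 0 5 ∧ τ 4 = 2 * c 1 1 2 + 2 * c 3 5 6 - 2 * c 0 0 2 ∧ τ 5 = c 3 2 3 ∧ τ 6 =
      c 3 2 4 ∧ τ 7 = c 5 2 5 ∧ τ 8 = c 5 2 6 ∧ τ 9 = c 3 0 1 ∧ τ 10 = c 2 0 1 / 2 + c 4 0 1 /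
      2 + c 6 0 1 / 2 ∧ τ 11 = -c 5 0 1 ∧ τ 12 = c 3 0 3 ∧ τ 13 = c 3 0 4 ∧ τ 14 = c 3 1 3 ∧ τ
      15 = c 3 1 4 ∧ τ 16 = c 5 1 5 ∧ τ 17 = c 5 1 6 ∧ τ 18 = c 5 0 5 ∧ τ 19 = c 5 0 6 :=
    ⟨![-c 2 0 3 / 2 - c 2 1 3 / 2, c 2 2 3 - c 0 0 3, 2 * c 3 5 6, c 2 2 5 - c 0 0 5, 2 * c 1 1
      2 + 2 * c 3 5 6 - 2 * c 0 0 2, c 3 2 3, c 3 2 4, c 5 2 5, c 5 2 6, c 3 0 1, c 2 0 1 / 2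
      + c 4 0 1 / 2 + c 6 0 1 / 2, -c 5 0 1, c 3 0 3, c 3 0 4, c 3 1 3, c 3 1 4, c 5 1 5, c 5
      1 6, c 5 0 5, c 5 0 6],
      rfl, rfl, rfl, rfl, rfl, rfl, rfl, rfl, rfl, rfl, rfl, rfl, rfl, rfl, rfl, rfl, rfl, rfl, rfl,
      rfl⟩
  have hv : ∀ v : TangentSpace (𝓡 7) q, ∃ x : Fin 7 → ℝ, ∀ j, w j q v = x j :=
    fun v => ⟨_, fun _ => rfl⟩
  -- The pseudo-connection is solved from the coefficients: φ from dω⁰, dω̄⁰ and dγ, ϖ from dγ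
  -- together with dω² and dω⁴, then α from dω² and β from dω⁴. The ω¹-component of α and the
  -- ω³-component of β have no effect and are set to zero.
  refine ⟨τ, structureEquationsAt_iff.2 ⟨
      (-c 1 0 1) • w 0 q + (c 0 0 1) • w 1 q + (c 0 0 2 / 2 + c 1 1 2 / 2) • w 2 q
      + (c 2 2 3) • w 3 q + (c 0 0 4 + 2 * c 3 5 6) • w 4 q + (c 2 2 5) • w 5 q
      + (c 0 0 6 + 2 * c 1 1 2 + 2 * c 3 5 6 - 2 * c 0 0 2) • w 6 q,
      (c 2 0 1 / 2 + c 4 0 1 / 2 - c 6 0 1 / 2) • w 0 q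
      + (c 2 0 1 / 2 + c 6 0 1 / 2 - c 4 0 1 / 2) • w 1 q + (c 2 0 2 - c 1 0 1) • w 2 q
      + (c 2 0 3 / 2 - c 2 1 3 / 2) • w 3 q + (c 2 0 4) • w 4 q
      + (c 2 0 3 / 2 + c 2 0 5 + c 2 1 3 / 2) • w 5 q + (c 2 0 6) • w 6 q,
      (c 2 1 3 / 2 - c 2 0 3 / 2 - c 4 0 3) • w 0 q + (-c 4 1 3) • w 1 q + (-c 4 2 3) • w 2 q
      + (c 2 2 3 + c 4 3 4) • w 4 q + (c 4 3 5) • w 5 q + (c 4 3 6) • w 6 q,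
      (-c 6 0 5) • w 0 q + (c 2 0 3 / 2 + c 2 0 5 + c 2 1 3 / 2 - c 6 1 5) • w 1 q
      + (-c 6 2 5) • w 2 q + (-c 6 3 5) • w 3 q + (-c 6 4 5) • w 4 q
      + (c 2 2 5 + c 6 5 6) • w 6 q,
      ?_, ?_, ?_, ?_, ?_, ?_, ?_⟩⟩
  all_goals
    ext v u
    obtain ⟨x, hx⟩ := hv v
    obtain ⟨y, hy⟩ := hv u
    simp only [hd, LinearMap.add_apply, LinearMap.sub_apply, LinearMap.neg_apply,
      LinearMap.smul_apply, LinearMap.zero_apply, wedge_apply, add_apply, sub_apply, smul_apply,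
      smul_eq_mul, hx, hy, fullTorsion, h0, h1, h2, h3, h4, h5, h6, h7, h8, h9, h10, h11, h12, h13,
      h14, h15, h16, h17, h18, h19]
    simp [Fin.sum_univ_seven, hc.d_omega, hc.d_omegaBar, hc.d_gamma, wedgeCoeff, hdiag,
      hc.swap _ 1 0, hc.swap _ 2 0, hc.swap _ 2 1, hc.swap _ 3 0, hc.swap _ 3 1, hc.swap _ 3 2,
    hc.swap _ 4 0, hc.swap _ 4 1, hc.swap _ 4 2, hc.swap _ 4 3, hc.swap _ 5 0, hc.swap _ 5 1,
    hc.swap _ 5 2, hc.swap _ 5 3, hc.swap _ 5 4, hc.swap _ 6 0, hc.swap _ 6 1, hc.swap _ 6 2,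
    hc.swap _ 6 3, hc.swap _ 6 4, hc.swap _ 6 5]
    try simp only [hl.eq1_13, hl.eq1_14, hl.eq1_15, hl.eq1_16, hl.eq2_24, hl.eq2_26, hl.eq3_02, hl.eq3_05,
    hl.eq3_06, hl.eq3_12, hl.eq3_15, hl.eq3_16, hl.eq3_25, hl.eq3_26, hl.eq3_34, hl.eq3_35,
    hl.eq3_36, hl.eq3_45, hl.eq3_46, hl.eq4_02, hl.eq4_04, hl.eq4_05, hl.eq4_06, hl.eq4_12,
    hl.eq4_14, hl.eq4_15, hl.eq4_16, hl.eq4_24, hl.eq4_25, hl.eq4_26, hl.eq4_45, hl.eq4_46,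
    hl.eq4_56, hl.eq5_02, hl.eq5_03, hl.eq5_04, hl.eq5_12, hl.eq5_13, hl.eq5_14, hl.eq5_23,
    hl.eq5_24, hl.eq5_35, hl.eq5_36, hl.eq5_45, hl.eq5_46, hl.eq5_56, hl.eq6_02, hl.eq6_03,
    hl.eq6_04, hl.eq6_06, hl.eq6_12, hl.eq6_13, hl.eq6_14, hl.eq6_16, hl.eq6_23, hl.eq6_24,
    hl.eq6_26, hl.eq6_34, hl.eq6_36, hl.eq6_46,
      hs.eq2_14, hs.eq2_15, hs.eq2_16, hs.eq5_34, hg]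
    ring

variable [IsManifold (𝓡 7) ∞ N] {U : Set N}

theorem IsCoframing.extD_apply_eq_sum (hw : IsCoframing U w) (hq : q ∈ U)
    (hqp : q ∈ (extChartAt (𝓡 7) p).source) (i : Fin 7) (v u : TangentSpace (𝓡 7) q) :
    extD (w i) q v u = ∑ j, ∑ k, w j q v * (w k q u * structFn w p i j k (extChartAt (𝓡 7) p q)) := by
  conv_lhs => rw [hw.expand hq hqp v, hw.expand hq hqp u]
  simp only [map_sum, map_smul, LinearMap.sum_apply, LinearMap.smul_apply, smul_eq_mul,
    hw.extD_frameVec hq hqp, Finset.mul_sum]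
  rw [Finset.sum_comm]
  exact Finset.sum_congr rfl fun j _ => Finset.sum_congr rfl fun k _ => mul_left_comm _ _ _

end Torsion

/-! ## The action of the structure group on the torsion functions -/

section Action

/-- The element of the structure group with parameters `r, a, b` and `c = r k`. -/
def groupElement (r a b k : ℝ) : Matrix (Fin 7) (Fin 7) ℝ :=
  !![r, 0, 0, 0, 0, 0, 0;
     0, r, 0, 0, 0, 0, 0;
     r * k, -(r * k), r, 0, 0, 0, 0;
     0, 0, 0, 1, 0, 0, 0;
     -(r * k), 0, 0, a, r, 0, 0;
     0, 0, 0, 0, 0, 1, 0;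
     0, r * k, 0, 0, 0, b, r]

/-- In terms of k = c / r instead of c, the action on the torsion is polynomial. -/
theorem mem_structureGroup_iff {g : Matrix (Fin 7) (Fin 7) ℝ} :
    g ∈ structureGroup ↔ ∃ r a b k : ℝ, r ≠ 0 ∧ g = groupElement r a b k := by
  constructor
  · rintro ⟨r, a, b, c, hr, rfl⟩
    refine ⟨r, a, b, c / r, hr, ?_⟩
    rw [groupElement, mul_div_cancel₀ _ hr]
  · rintro ⟨r, a, b, k, hr, rfl⟩
    exact ⟨r, a, b, r * k, hr, rfl⟩

theorem det_groupElement_ne_zero {r : ℝ} (hr : r ≠ 0) (a b k : ℝ) :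
    (groupElement r a b k).det ≠ 0 := by
  have h : (groupElement r a b k).BlockTriangular OrderDual.toDual := by
    intro i j hij
    have hij' : i < j := hij
    revert hij'
    fin_cases i <;> fin_cases j <;> first | exact fun h => absurd h (by decide) | exact fun _ => rfl
  rw [Matrix.det_of_isLowerTriangular _ h, Fin.prod_univ_seven]
  simp [groupElement, hr]

/-- The torsion functions of `ω · g` in terms of the torsion functions `τ` of `ω`, for the element
`g` of the structure group with parameters `r, a, b` and `c = r k`. -/
def torsionAct (r a b k : ℝ) (τ : Fin 20 → ℝ) : Fin 20 → ℝ :=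
  ![τ 0,
    τ 1 + τ 2 * a - 2 * k,
    τ 2 * r,
    τ 3 + τ 4 * b + 2 * k,
    τ 4 * r,
    τ 5 * r + τ 6 * a * r,
    τ 6 * r ^ 2,
    τ 7 * r + τ 8 * b * r,
    τ 8 * r ^ 2,
    τ 9 * r ^ 2 + τ 15 * k * r ^ 2 - τ 6 * k ^ 2 * r ^ 2 - τ 13 * k * r ^ 2,
    τ 5 * k ^ 2 * r / 2 + τ 6 * a * k ^ 2 * r / 2 + τ 12 * k * r / 2 + τ 13 * a * k * r / 2 + τ 10 * r + τ 11 * b * r / 2 + τ 16 * k * r / 2 + τ 17 * b * k * r / 2 - τ 7 * k ^ 2 * r / 2 - τ 8 * b * k ^ 2 * r / 2 - τ 9 * a * r / 2 - τ 18 * k * r / 2 - τ 19 * b * k * r / 2 - τ 14 * k * r / 2 - τ 15 * a * k * r / 2,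
    τ 11 * r ^ 2 + τ 17 * k * r ^ 2 - τ 8 * k ^ 2 * r ^ 2 - τ 19 * k * r ^ 2,
    τ 5 * k * r + τ 6 * a * k * r + τ 12 * r + τ 13 * a * r - τ 2 * k * r / 2,
    τ 6 * k * r ^ 2 + τ 13 * r ^ 2,
    τ 4 * k * r / 2 + τ 14 * r + τ 15 * a * r - τ 5 * k * r - τ 6 * a * k * r,
    τ 15 * r ^ 2 - τ 6 * k * r ^ 2,
    τ 4 * k * r / 2 + τ 16 * r + τ 17 * b * r - τ 7 * k * r - τ 8 * b * k * r,
    τ 17 * r ^ 2 - τ 8 * k * r ^ 2,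
    τ 7 * k * r + τ 8 * b * k * r + τ 18 * r + τ 19 * b * r - τ 2 * k * r / 2,
    τ 8 * k * r ^ 2 + τ 19 * r ^ 2]

variable {N : Type*} [TopologicalSpace N] [ChartedSpace (EuclideanSpace ℝ (Fin 7)) N]

theorem transform_groupElement (z : Fin 7 → OneForm 7 N) (r a b k : ℝ) (q : N) :
    transform (groupElement r a b k) z 0 q = r • z 0 q ∧
    transform (groupElement r a b k) z 1 q = r • z 1 q ∧
    transform (groupElement r a b k) z 2 q = (r * k) • z 0 q + (-(r * k)) • z 1 q + r • z 2 q ∧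
    transform (groupElement r a b k) z 3 q = z 3 q ∧
    transform (groupElement r a b k) z 4 q = (-(r * k)) • z 0 q + a • z 3 q + r • z 4 q ∧
    transform (groupElement r a b k) z 5 q = z 5 q ∧
    transform (groupElement r a b k) z 6 q = (r * k) • z 1 q + b • z 5 q + r • z 6 q := by
  simp [transform, groupElement, Fin.sum_univ_seven]

variable [IsManifold (𝓡 7) ∞ N] {U : Set N} {z w : Fin 7 → OneForm 7 N} {q : N}

theorem extD_groupElement (hz : IsCoframing U z) (hq : q ∈ U) (r a b k : ℝ) :
    extD (transform (groupElement r a b k) z 0) q = r • extD (z 0) q ∧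
    extD (transform (groupElement r a b k) z 1) q = r • extD (z 1) q ∧
    extD (transform (groupElement r a b k) z 2) q
      = (r * k) • extD (z 0) q + (-(r * k)) • extD (z 1) q + r • extD (z 2) q ∧
    extD (transform (groupElement r a b k) z 3) q = extD (z 3) q ∧
    extD (transform (groupElement r a b k) z 4) q
      = (-(r * k)) • extD (z 0) q + a • extD (z 3) q + r • extD (z 4) q ∧
    extD (transform (groupElement r a b k) z 5) q = extD (z 5) q ∧
    extD (transform (groupElement r a b k) z 6) q
      = (r * k) • extD (z 1) q + b • extD (z 5) q + r • extD (z 6) q := by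
  simp [extD_transform hz _ hq, groupElement, Fin.sum_univ_seven]

set_option maxHeartbeats 1000000 in
-- Here `z` plays the role of ω · g, so that g z is the original coframing ω with torsion `τ`.
-- Substituting g z into its structure equations and restoring their normal form changes φ, ϖ, α, β
-- by torsion-dependent multiples of the coframe, and the torsion left over is `torsionAct`.
theorem HasTorsionAt.of_transform (hz : IsCoframing U z) (hq : q ∈ U) {r : ℝ} (hr : r ≠ 0)
    {a b k : ℝ} {τ : Fin 20 → ℝ} (h : HasTorsionAt (transform (groupElement r a b k) z) q τ) :
    HasTorsionAt z q (torsionAct r a b k τ) := by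
  obtain ⟨τ', hτ', h0, h1, h2, h3, h4, h5, h6, h7, h8, h9, h10, h11, h12, h13, h14, h15, h16, h17,
      h18, h19⟩ : ∃ τ', torsionAct r a b k τ = τ' ∧
      τ' 0 = τ 0 ∧ τ' 1 = τ 1 + τ 2 * a - 2 * k ∧ τ' 2 = τ 2 * r ∧ τ' 3 = τ 3 + τ 4 * b + 2 * k
      ∧ τ' 4 = τ 4 * r ∧ τ' 5 = τ 5 * r + τ 6 * a * r ∧ τ' 6 = τ 6 * r ^ 2 ∧ τ' 7 = τ 7 * r + τ
      8 * b * r ∧ τ' 8 = τ 8 * r ^ 2 ∧ τ' 9 = τ 9 * r ^ 2 + τ 15 * k * r ^ 2 - τ 6 * k ^ 2 * r ^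
      2 - τ 13 * k * r ^ 2 ∧ τ' 10 = τ 5 * k ^ 2 * r / 2 + τ 6 * a * k ^ 2 * r / 2 + τ 12 * k *
      r / 2 + τ 13 * a * k * r / 2 + τ 10 * r + τ 11 * b * r / 2 + τ 16 * k * r / 2 + τ 17 * b *
      k * r / 2 - τ 7 * k ^ 2 * r / 2 - τ 8 * b * k ^ 2 * r / 2 - τ 9 * a * r / 2 - τ 18 * k * r
      / 2 - τ 19 * b * k * r / 2 - τ 14 * k * r / 2 - τ 15 * a * k * r / 2 ∧ τ' 11 = τ 11 * r ^
      2 + τ 17 * k * r ^ 2 - τ 8 * k ^ 2 * r ^ 2 - τ 19 * k * r ^ 2 ∧ τ' 12 = τ 5 * k * r + τ 6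
      * a * k * r + τ 12 * r + τ 13 * a * r - τ 2 * k * r / 2 ∧ τ' 13 = τ 6 * k * r ^ 2 + τ 13 *
      r ^ 2 ∧ τ' 14 = τ 4 * k * r / 2 + τ 14 * r + τ 15 * a * r - τ 5 * k * r - τ 6 * a * k * r
      ∧ τ' 15 = τ 15 * r ^ 2 - τ 6 * k * r ^ 2 ∧ τ' 16 = τ 4 * k * r / 2 + τ 16 * r + τ 17 * b *
      r - τ 7 * k * r - τ 8 * b * k * r ∧ τ' 17 = τ 17 * r ^ 2 - τ 8 * k * r ^ 2 ∧ τ' 18 = τ 7 *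
      k * r + τ 8 * b * k * r + τ 18 * r + τ 19 * b * r - τ 2 * k * r / 2 ∧ τ' 19 = τ 8 * k * r
      ^ 2 + τ 19 * r ^ 2 :=
    ⟨_, rfl, rfl, rfl, rfl, rfl, rfl, rfl, rfl, rfl, rfl, rfl, rfl, rfl, rfl, rfl, rfl, rfl, rfl, rfl,
      rfl, rfl⟩
  rw [hτ']
  obtain ⟨φ, ϖ, α, β, e0, e1, e2, e3, e4, e5, e6⟩ := structureEquationsAt_iff.1 h
  obtain ⟨f0, f1, f2, f3, f4, f5, f6⟩ := transform_groupElement z r a b k q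
  obtain ⟨d0, d1, d2, d3, d4, d5, d6⟩ := extD_groupElement hz hq r a b k
  rw [d0, f0, f1, f2, f3, f4, f5, f6] at e0
  rw [d1, f0, f1, f2, f3, f4, f5, f6] at e1
  rw [d2, f0, f1, f2, f3, f4, f5, f6] at e2
  rw [d3, f0, f1, f2, f3, f4, f5, f6] at e3
  rw [d4, f0, f1, f2, f3, f4, f5, f6] at e4
  rw [d5, f0, f1, f2, f3, f4, f5, f6] at e5
  rw [d6, f0, f1, f2, f3, f4, f5, f6] at e6
  -- In the transformed dω² and dω⁴ the new forms α and β occur multiplied by r; the defining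
  -- equations are therefore divided by r ≠ 0.
  obtain ⟨α', hα'⟩ : ∃ α' : Covector 7 q, r • α' = α + a • φ + (
      (τ 4 * a * k * r / 4 + 2 * τ 5 * a * k * r + τ 6 * a ^ 2 * k * r + 2 * τ 12 * a * r + τ 13
      * a ^ 2 * r - τ 2 * a * k * r / 4 - k * r) • z 0 q + (τ 4 * a * k * r / 4 + 2 * τ 14 * a *
      r + τ 15 * a ^ 2 * r - τ 2 * a * k * r / 4 - 2 * τ 5 * a * k * r - τ 6 * a ^ 2 * k * r) •
      z 1 q + (τ 2 * a * r / 4 + τ 4 * a * r / 4 + 2 * τ 5 * a * r + τ 6 * a ^ 2 * r) • z 2 q +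
      (τ 2 * a * r / 2) • z 4 q + (τ 0 * a + τ 1 * a + τ 2 * a ^ 2 / 2 + τ 3 * a / 2 + τ 4 * a *
      b / 2 + a / 2) • z 5 q + (τ 4 * a * r / 2) • z 6 q) :=
    ⟨r⁻¹ • _, smul_inv_smul₀ hr _⟩
  obtain ⟨β', hβ'⟩ : ∃ β' : Covector 7 q, r • β' = β + b • φ + (
      (τ 4 * b * k * r / 4 + 2 * τ 7 * b * k * r + τ 8 * b ^ 2 * k * r + 2 * τ 18 * b * r + τ 19
      * b ^ 2 * r - τ 2 * b * k * r / 4) • z 0 q + (τ 4 * b * k * r / 4 + 2 * τ 16 * b * r + τ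
      17 * b ^ 2 * r - τ 2 * b * k * r / 4 - 2 * τ 7 * b * k * r - τ 8 * b ^ 2 * k * r - k * r)
      • z 1 q + (τ 2 * b * r / 4 + τ 4 * b * r / 4 + 2 * τ 7 * b * r + τ 8 * b ^ 2 * r) • z 2 q
      + (τ 0 * b + τ 1 * b / 2 + τ 2 * a * b / 2 + τ 3 * b + τ 4 * b ^ 2 / 2 + b) • z 3 q + (τ 2
      * b * r / 2) • z 4 q + (τ 4 * b * r / 2) • z 6 q) :=
    ⟨r⁻¹ • _, smul_inv_smul₀ hr _⟩
  have hval : ∀ v : TangentSpace (𝓡 7) q, ∃ x : Fin 7 → ℝ, ∀ j, z j q v = x j :=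
    fun v => ⟨_, fun _ => rfl⟩
  refine structureEquationsAt_iff.2 ⟨φ + (
      (3 * τ 2 * k * r / 4 + τ 4 * k * r / 4) • z 0 q + (-τ 2 * k * r / 4 - 3 * τ 4 * k * r / 4)
      • z 1 q + (-k) • z 3 q + (k) • z 5 q),
      ϖ + ((τ 5 * k ^ 2 * r / 2 + τ 6 * a * k ^ 2 * r / 2 + τ 7 * k ^ 2 * r / 2 + τ 8 * b * k ^ 2 * r
      / 2 + τ 12 * k * r / 2 + τ 13 * a * k * r / 2 + τ 18 * k * r / 2 + τ 19 * b * k * r / 2 -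
      τ 2 * k ^ 2 * r / 2 - τ 9 * a * r / 2 - τ 11 * b * r / 2 - τ 14 * k * r / 2 - τ 15 * a * k
      * r / 2 - τ 16 * k * r / 2 - τ 17 * b * k * r / 2) • z 0 q + (τ 4 * k ^ 2 * r / 2 + τ 9 *
      a * r / 2 + τ 11 * b * r / 2 + τ 14 * k * r / 2 + τ 15 * a * k * r / 2 + τ 16 * k * r / 2
      + τ 17 * b * k * r / 2 - τ 5 * k ^ 2 * r / 2 - τ 6 * a * k ^ 2 * r / 2 - τ 7 * k ^ 2 * r /
      2 - τ 8 * b * k ^ 2 * r / 2 - τ 12 * k * r / 2 - τ 13 * a * k * r / 2 - τ 18 * k * r / 2 -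
      τ 19 * b * k * r / 2) • z 1 q + (τ 2 * k * r / 2 + τ 4 * k * r / 2) • z 2 q + (τ 1 * k + τ
      2 * a * k + k - k ^ 2) • z 3 q + (τ 2 * k * r) • z 4 q + (τ 3 * k + τ 4 * b * k + k ^ 2) •
      z 5 q + (τ 4 * k * r) • z 6 q),
      α', β', ?_⟩
  have hext : ∀ Ψ Ψ' : TwoTensor 7 q, Ψ = Ψ' ↔ ∀ v u, Ψ v u = Ψ' v u := fun Ψ Ψ' =>
    ⟨fun h v u => by rw [h], fun h => by ext v u; exact h v u⟩
  simp only [hext, ← forall_and] at e0 e1 e2 e3 e4 e5 e6 ⊢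
  intro v u
  obtain ⟨x, hx⟩ := hval v
  obtain ⟨y, hy⟩ := hval u
  have av := congrArg (fun κ : Covector 7 q => κ v) hα'
  have au := congrArg (fun κ : Covector 7 q => κ u) hα'
  have bv := congrArg (fun κ : Covector 7 q => κ v) hβ'
  have bu := congrArg (fun κ : Covector 7 q => κ u) hβ'
  specialize e0 v u
  specialize e1 v u
  specialize e2 v u
  specialize e3 v u
  specialize e4 v u
  specialize e5 v u
  specialize e6 v u
  simp only [LinearMap.add_apply, LinearMap.sub_apply, LinearMap.neg_apply,
    LinearMap.smul_apply, LinearMap.zero_apply, wedge_apply, add_apply, sub_apply, smul_apply,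
    smul_eq_mul, hx, hy, fullTorsion, h0, h1, h2, h3, h4, h5, h6, h7, h8, h9, h10, h11, h12, h13,
    h14, h15, h16, h17, h18, h19] at e0 e1 e2 e3 e4 e5 e6 av au bv bu ⊢
  generalize extD (z 0) q v u = D0 at *
  generalize extD (z 1) q v u = D1 at *
  generalize extD (z 2) q v u = D2 at *
  generalize extD (z 3) q v u = D3 at *
  generalize extD (z 4) q v u = D4 at *
  generalize extD (z 5) q v u = D5 at *
  generalize extD (z 6) q v u = D6 at *
  refine ⟨?_, ?_, ?_, ?_, ?_, ?_, ?_⟩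
  · apply mul_left_cancel₀ hr
    linear_combination e0
  · apply mul_left_cancel₀ hr
    linear_combination e1
  · apply mul_left_cancel₀ hr
    -- The third row of g contributes multiples of dz⁰ and dz¹, which are removed with the first two
    -- equations. The rows of ω² and ω⁴ are treated in the same way.
    linear_combination e2 - k * e0 + k * e1
  · linear_combination e3
  · apply mul_left_cancel₀ hr
    linear_combination e4 + k * e0 - a * e3 + y 3 * av - x 3 * au
  · linear_combination e5
  · apply mul_left_cancel₀ hr
    linear_combination e6 - k * e1 - b * e5 + y 5 * bv - x 5 * bu

end Action

/-! ## Uniqueness of the torsion functions and the orbits of the structure group -/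

section Orbits

variable {N : Type*} [TopologicalSpace N] [ChartedSpace (EuclideanSpace ℝ (Fin 7)) N]

/-- Torsion is unique because each function is a combination of coefficients from which φ, ϖ, α, β
cancel. The first identity is a second expression for P₄, taken from dω³ alone, through which the
integrability of ω³ detects P₄. -/
theorem HasTorsionAt.eq_of_dual {w : Fin 7 → OneForm 7 N} {q : N} {τ : Fin 20 → ℝ}
    (h : HasTorsionAt w q τ) {e : Fin 7 → TangentSpace (𝓡 7) q}
    (he : ∀ i j, w i q (e j) = if i = j then 1 else 0) {c : Fin 7 → Fin 7 → Fin 7 → ℝ}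
    (hc : ∀ i j k, extD (w i) q (e j) (e k) = c i j k) :
    c 5 3 4 = τ 4 / 2 ∧ τ 0 = -c 2 0 3 / 2 - c 2 1 3 / 2 ∧ τ 1 = c 2 2 3 - c 0 0 3 ∧ τ 2 = 2 *
      c 3 5 6 ∧ τ 3 = c 2 2 5 - c 0 0 5 ∧ τ 4 = 2 * c 1 1 2 + 2 * c 3 5 6 - 2 * c 0 0 2 ∧ τ 5 =
      c 3 2 3 ∧ τ 6 = c 3 2 4 ∧ τ 7 = c 5 2 5 ∧ τ 8 = c 5 2 6 ∧ τ 9 = c 3 0 1 ∧ τ 10 = c 2 0 1 /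
      2 + c 4 0 1 / 2 + c 6 0 1 / 2 ∧ τ 11 = -c 5 0 1 ∧ τ 12 = c 3 0 3 ∧ τ 13 = c 3 0 4 ∧ τ 14 =
      c 3 1 3 ∧ τ 15 = c 3 1 4 ∧ τ 16 = c 5 1 5 ∧ τ 17 = c 5 1 6 ∧ τ 18 = c 5 0 5 ∧ τ 19 = c 5 0
      6 := by
  obtain ⟨φ, ϖ, α, β, h0, h1, h2, h3, h4, h5, h6⟩ := structureEquationsAt_iff.1 h
  have e002 := LinearMap.congr_fun₂ h0 (e 0) (e 2)
  have e003 := LinearMap.congr_fun₂ h0 (e 0) (e 3)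
  have e005 := LinearMap.congr_fun₂ h0 (e 0) (e 5)
  have e112 := LinearMap.congr_fun₂ h1 (e 1) (e 2)
  have e201 := LinearMap.congr_fun₂ h2 (e 0) (e 1)
  have e203 := LinearMap.congr_fun₂ h2 (e 0) (e 3)
  have e213 := LinearMap.congr_fun₂ h2 (e 1) (e 3)
  have e223 := LinearMap.congr_fun₂ h2 (e 2) (e 3)
  have e225 := LinearMap.congr_fun₂ h2 (e 2) (e 5)
  have e301 := LinearMap.congr_fun₂ h3 (e 0) (e 1)
  have e303 := LinearMap.congr_fun₂ h3 (e 0) (e 3)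
  have e304 := LinearMap.congr_fun₂ h3 (e 0) (e 4)
  have e313 := LinearMap.congr_fun₂ h3 (e 1) (e 3)
  have e314 := LinearMap.congr_fun₂ h3 (e 1) (e 4)
  have e323 := LinearMap.congr_fun₂ h3 (e 2) (e 3)
  have e324 := LinearMap.congr_fun₂ h3 (e 2) (e 4)
  have e356 := LinearMap.congr_fun₂ h3 (e 5) (e 6)
  have e401 := LinearMap.congr_fun₂ h4 (e 0) (e 1)
  have e501 := LinearMap.congr_fun₂ h5 (e 0) (e 1)
  have e505 := LinearMap.congr_fun₂ h5 (e 0) (e 5)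
  have e506 := LinearMap.congr_fun₂ h5 (e 0) (e 6)
  have e515 := LinearMap.congr_fun₂ h5 (e 1) (e 5)
  have e516 := LinearMap.congr_fun₂ h5 (e 1) (e 6)
  have e525 := LinearMap.congr_fun₂ h5 (e 2) (e 5)
  have e526 := LinearMap.congr_fun₂ h5 (e 2) (e 6)
  have e601 := LinearMap.congr_fun₂ h6 (e 0) (e 1)
  have e534 := LinearMap.congr_fun₂ h5 (e 3) (e 4)
  simp [he, hc, fullTorsion] at e002 e003 e005 e112 e201 e203 e213 e223 e225
  simp [he, hc, fullTorsion] at e301 e303 e304 e313 e314 e323 e324 e356 e401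
  simp [he, hc, fullTorsion] at e501 e505 e506 e515 e516 e525 e526 e601 e534
  refine ⟨?_, ?_, ?_, ?_, ?_, ?_, ?_, ?_, ?_, ?_, ?_, ?_, ?_, ?_, ?_, ?_, ?_, ?_, ?_, ?_, ?_⟩ <;> linarith

theorem transform_transform (A B : Matrix (Fin 7) (Fin 7) ℝ) (w : Fin 7 → OneForm 7 N) :
    transform A (transform B w) = transform (A * B) w := by
  funext i x
  simp only [transform, Matrix.mul_apply, Finset.smul_sum, Finset.sum_smul, mul_smul]
  exact Finset.sum_comm

theorem transform_one (w : Fin 7 → OneForm 7 N) : transform 1 w = w := by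
  funext i x
  simp [transform, Matrix.one_apply]

variable [IsManifold (𝓡 7) ∞ N] {U : Set N} {w : Fin 7 → OneForm 7 N} {q : N}

theorem HasTorsionAt.unique (hw : IsCoframing U w) (hq : q ∈ U) {τ τ' : Fin 20 → ℝ}
    (h : HasTorsionAt w q τ) (h' : HasTorsionAt w q τ') : τ = τ' := by
  have he := hw.apply_frameVec hq (mem_extChartAt_source (I := 𝓡 7) q)
  obtain ⟨_, k0, k1, k2, k3, k4, k5, k6, k7, k8, k9, k10, k11, k12, k13, k14, k15, k16, k17, k18,
      k19⟩ := h.eq_of_dual he fun _ _ _ => rfl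
  obtain ⟨_, l0, l1, l2, l3, l4, l5, l6, l7, l8, l9, l10, l11, l12, l13, l14, l15, l16, l17, l18,
      l19⟩ := h'.eq_of_dual he fun _ _ _ => rfl
  funext i
  fin_cases i
  · exact k0.trans l0.symm
  · exact k1.trans l1.symm
  · exact k2.trans l2.symm
  · exact k3.trans l3.symm
  · exact k4.trans l4.symm
  · exact k5.trans l5.symm
  · exact k6.trans l6.symm
  · exact k7.trans l7.symm
  · exact k8.trans l8.symm
  · exact k9.trans l9.symm
  · exact k10.trans l10.symm
  · exact k11.trans l11.symm
  · exact k12.trans l12.symm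
  · exact k13.trans l13.symm
  · exact k14.trans l14.symm
  · exact k15.trans l15.symm
  · exact k16.trans l16.symm
  · exact k17.trans l17.symm
  · exact k18.trans l18.symm
  · exact k19.trans l19.symm

/-- The orbits of the structure group in the space of torsion values. -/
theorem torsionOrbit_eq (hw : IsCoframing U w) (hq : q ∈ U) {τ : Fin 20 → ℝ}
    (h : HasTorsionAt w q τ) :
    torsionOrbit w q = {τ' | ∃ r a b k : ℝ, r ≠ 0 ∧ τ' = torsionAct r a b k τ} := by
  have key : ∀ r a b k : ℝ, r ≠ 0 → IsCoframing U (coframeAct w (groupElement r a b k)) ∧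
      HasTorsionAt (coframeAct w (groupElement r a b k)) q (torsionAct r a b k τ) := by
    intro r a b k hr
    have hdet := det_groupElement_ne_zero hr a b k
    have hz : IsCoframing U (coframeAct w (groupElement r a b k)) :=
      hw.transform (A := (groupElement r a b k)⁻¹)
        (by rw [Matrix.det_nonsing_inv, Ring.inverse_eq_inv']; exact inv_ne_zero hdet)
    -- Since ω · g = g⁻¹ ω, applying g to it returns the original coframing, whose torsion is known.
    have ht : transform (groupElement r a b k) (coframeAct w (groupElement r a b k)) = w := by
      change transform _ (transform (groupElement r a b k)⁻¹ w) = w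
      rw [transform_transform, Matrix.mul_nonsing_inv _ hdet.isUnit, transform_one]
    exact ⟨hz, HasTorsionAt.of_transform hz hq hr (ht.symm ▸ h)⟩
  ext τ'
  constructor
  · rintro ⟨g, hg, hτ'⟩
    obtain ⟨r, a, b, k, hr, rfl⟩ := mem_structureGroup_iff.1 hg
    obtain ⟨hz, hact⟩ := key r a b k hr
    exact ⟨r, a, b, k, hr, hτ'.unique hz hq hact⟩
  · rintro ⟨r, a, b, k, hr, rfl⟩
    exact ⟨_, mem_structureGroup_iff.2 ⟨r, a, b, k, hr, rfl⟩, (key r a b k hr).2⟩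

end Orbits

/-! ## The dimension of the orbits -/

section Dimension

/-- Each term of the action containing a or b has one of the ten vanishing functions as a factor.
The orbit is then covered by a C¹ map of the two parameters r and k. -/
theorem dimH_setOf_torsionAct_le {τ : Fin 20 → ℝ} (h2 : τ 2 = 0) (h4 : τ 4 = 0) (h6 : τ 6 = 0)
    (h8 : τ 8 = 0) (h9 : τ 9 = 0) (h11 : τ 11 = 0) (h13 : τ 13 = 0) (h15 : τ 15 = 0)
    (h17 : τ 17 = 0) (h19 : τ 19 = 0) :
    dimH {τ' | ∃ r a b k : ℝ, r ≠ 0 ∧ τ' = torsionAct r a b k τ} ≤ 2 := by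
  have hF : ContDiff ℝ 1 (fun x : ℝ × ℝ => torsionAct x.1 0 0 x.2 τ) := by
    refine contDiff_pi.2 fun i => ?_
    fin_cases i <;> simp only [torsionAct] <;> simp <;> fun_prop
  have hsub : {τ' | ∃ r a b k : ℝ, r ≠ 0 ∧ τ' = torsionAct r a b k τ}
      ⊆ Set.range (fun x : ℝ × ℝ => torsionAct x.1 0 0 x.2 τ) := by
    rintro _ ⟨r, a, b, k, _, rfl⟩
    refine ⟨(r, k), ?_⟩
    simp [torsionAct, h2, h4, h6, h8, h9, h11, h13, h15, h17, h19]
  refine (dimH_mono hsub).trans (hF.dimH_range_le.trans ?_)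
  simp

/-- A set that projects onto a set with nonempty interior in three of the coordinates has dimension
at least three. -/
theorem three_le_dimH {ι : Type*} [Fintype ι] {S : Set (ι → ℝ)} {i j l : ι} {X : ℝ} (hX : X ≠ 0)
    (h : ∀ ρ s t : ℝ, 0 < ρ → ∃ x ∈ S, x i = ρ * X ∧ x j = s ∧ x l = t) : 3 ≤ dimH S := by
  let f : (ι → ℝ) → Fin 3 → ℝ := fun x m => x (![i, j, l] m)
  have hf : LipschitzWith 1 f := LipschitzWith.of_dist_le_mul fun x y => by
    rw [NNReal.coe_one, one_mul, dist_pi_le_iff dist_nonneg]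
    exact fun m => dist_le_pi_dist x y _
  -- The image contains the open half-space where the first coordinate has the sign of `X`; the
  -- coordinate projection is 1-Lipschitz and cannot raise the dimension.
  have hV : {y : Fin 3 → ℝ | 0 < y 0 * X⁻¹} ⊆ f '' S := by
    intro y hy
    obtain ⟨x, hxS, h0, h1, h2⟩ := h (y 0 * X⁻¹) (y 1) (y 2) hy
    refine ⟨x, hxS, funext fun m => ?_⟩
    fin_cases m
    · exact h0.trans (inv_mul_cancel_right₀ hX _)
    · exact h1
    · exact h2
  have hopen : IsOpen {y : Fin 3 → ℝ | 0 < y 0 * X⁻¹} :=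
    isOpen_lt continuous_const (by fun_prop)
  have hne : (interior (f '' S)).Nonempty :=
    ⟨fun _ => X, interior_maximal hV hopen (by simp [hX])⟩
  have h3 := Real.dimH_of_nonempty_interior hne
  rw [Module.finrank_fin_fun] at h3
  calc (3 : ENNReal) = dimH (f '' S) := by rw [h3]; norm_num
    _ ≤ dimH S := hf.dimH_image_le S

/-- A nonzero function among the ten would allow three coordinates of the orbit to be prescribed
independently: itself up to a positive factor through r, a second one through a or b, and P₁ or P₃
through k. The functions are treated in an order in which those already known to vanish simplify the
formulas for the next. -/
theorem eq_zero_of_dimH_le {τ : Fin 20 → ℝ}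
    (h : dimH {τ' | ∃ r a b k : ℝ, r ≠ 0 ∧ τ' = torsionAct r a b k τ} ≤ 2) :
    (τ 2 = 0 ∧ τ 4 = 0) ∧ (τ 6 = 0 ∧ τ 13 = 0 ∧ τ 15 = 0 ∧ τ 9 = 0) ∧
      (τ 8 = 0 ∧ τ 19 = 0 ∧ τ 17 = 0 ∧ τ 11 = 0) := by
  set S := {τ' | ∃ r a b k : ℝ, r ≠ 0 ∧ τ' = torsionAct r a b k τ} with hS
  have hmem : ∀ r a b k : ℝ, r ≠ 0 → torsionAct r a b k τ ∈ S := fun r a b k hr =>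
    ⟨r, a, b, k, hr, rfl⟩
  have key : ∀ (i j l : Fin 20) (X : ℝ),
      (X ≠ 0 → ∀ ρ s t : ℝ, 0 < ρ → ∃ x ∈ S, x i = ρ * X ∧ x j = s ∧ x l = t) → X = 0 := by
    intro i j l X hX
    by_contra hne
    have h3 := (three_le_dimH hne (hX hne)).trans h
    norm_num at h3
  -- With b = 0, the value of P₃ determines k, and then the value of P₁ determines a, whose
  -- coefficient is P₂. For P₄ the roles of P₁, a and P₃, b are exchanged.
  have h2 : τ 2 = 0 := key 2 1 3 _ fun hX ρ s t hρ =>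
    ⟨_, hmem ρ ((s - τ 1 + (t - τ 3)) / τ 2) 0 ((t - τ 3) / 2) hρ.ne', mul_comm _ _,
      by simp [torsionAct]; field_simp; ring, by simp [torsionAct]; ring⟩
  have h4 : τ 4 = 0 := key 4 3 1 _ fun hX ρ s t hρ =>
    ⟨_, hmem ρ 0 ((s - τ 3 - (τ 1 - t)) / τ 4) ((τ 1 - t) / 2) hρ.ne', mul_comm _ _,
      by simp [torsionAct]; field_simp; ring, by simp [torsionAct]; ring⟩
  -- The eight remaining functions scale with r² rather than r. Since P₂ is now known to vanish, the
  -- third coordinate P₁ becomes P₁ - 2 k and fixes k.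
  have hsq : ∀ ρ : ℝ, 0 < ρ → ∃ r : ℝ, r ≠ 0 ∧ r ^ 2 = ρ := fun ρ hρ =>
    ⟨√ρ, (Real.sqrt_pos.2 hρ).ne', Real.sq_sqrt hρ.le⟩
  have key2 : ∀ (i j : Fin 20) (X : ℝ), (X ≠ 0 → ∀ r s k : ℝ, r ≠ 0 → ∃ a b,
      torsionAct r a b k τ i = r ^ 2 * X ∧ torsionAct r a b k τ j = s) → X = 0 := by
    intro i j X hX
    refine key i j 1 X fun hne ρ s t hρ => ?_
    obtain ⟨r, hr, rfl⟩ := hsq ρ hρ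
    obtain ⟨a, b, hi, hj⟩ := hX hne r s ((τ 1 - t) / 2) hr
    refine ⟨_, hmem r a b _ hr, hi, hj, ?_⟩
    simp [torsionAct, h2]
    ring
  have h6 : τ 6 = 0 := key2 6 5 _ fun hX r s k hr =>
    ⟨(s / r - τ 5) / τ 6, 0, by simp [torsionAct]; ring, by simp [torsionAct]; field_simp; ring⟩
  have h8 : τ 8 = 0 := key2 8 7 _ fun hX r s k hr =>
    ⟨0, (s / r - τ 7) / τ 8, by simp [torsionAct]; ring, by simp [torsionAct]; field_simp; ring⟩
  have h13 : τ 13 = 0 := key2 13 12 _ fun hX r s k hr =>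
    ⟨(s / r - τ 12 - τ 5 * k) / τ 13, 0, by simp [torsionAct, h6]; ring,
      by simp [torsionAct, h6, h2]; field_simp; ring⟩
  have h15 : τ 15 = 0 := key2 15 14 _ fun hX r s k hr =>
    ⟨(s / r - τ 14 + τ 5 * k) / τ 15, 0, by simp [torsionAct, h6]; ring,
      by simp [torsionAct, h6, h4]; field_simp; ring⟩
  have h19 : τ 19 = 0 := key2 19 18 _ fun hX r s k hr =>
    ⟨0, (s / r - τ 18 - τ 7 * k) / τ 19, by simp [torsionAct, h8]; ring,
      by simp [torsionAct, h8, h2]; field_simp; ring⟩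
  have h17 : τ 17 = 0 := key2 17 16 _ fun hX r s k hr =>
    ⟨0, (s / r - τ 16 + τ 7 * k) / τ 17, by simp [torsionAct, h8]; ring,
      by simp [torsionAct, h8, h4]; field_simp; ring⟩
  -- Once the functions treated above vanish, a enters T²₀ only through -T¹₀ a r / 2, and b only
  -- through T³₀ b r / 2. Solving for a here, and for b in the next step, gives the witnesses.
  have h9 : τ 9 = 0 := key2 9 10 _ fun hX r s k hr =>
    ⟨(torsionAct r 0 0 k τ 10 - s) * 2 / (r * τ 9), 0,
      by simp [torsionAct, h6, h13, h15]; ring,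
      by simp [torsionAct, h6, h8, h13, h15, h17, h19]; field_simp; ring⟩
  have h11 : τ 11 = 0 := key2 11 10 _ fun hX r s k hr =>
    ⟨0, (s - torsionAct r 0 0 k τ 10) * 2 / (r * τ 11),
      by simp [torsionAct, h8, h17, h19]; ring,
      by simp [torsionAct, h6, h8, h13, h15, h17, h19]; field_simp; ring⟩
  exact ⟨⟨h2, h4⟩, ⟨h6, h13, h15, h9⟩, h8, h19, h17, h11⟩

end Dimension

/-! ### Integrability of ω¹ and ω³ in terms of the torsion. -/

section Integrability

variable {N : Type*} [TopologicalSpace N] [ChartedSpace (EuclideanSpace ℝ (Fin 7)) N]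
  {w : Fin 7 → OneForm 7 N} {q : N} {τ : Fin 20 → ℝ}

theorem congrMod_of_eq_wedge {x : N} {σ κ : Covector 7 x} {Ψ : TwoTensor 7 x}
    (h : Ψ = wedge σ κ) : CongrMod Ψ 0 {σ} := by
  rw [CongrMod, sub_zero, h]
  exact wedge_mem_wedgeSpan_left (Submodule.mem_span_singleton_self σ) κ

/-- Every surviving term of the equation for dω¹ has ω¹ as a factor, and `κ` collects the cofactors.
The vanishing of P₄ only serves to shorten `κ`, since P₄ occurs in dω¹ solely next to ω¹. -/
theorem HasTorsionAt.congrMod_three (h : HasTorsionAt w q τ) (h2 : τ 2 = 0) (h4 : τ 4 = 0)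
    (h6 : τ 6 = 0) (h9 : τ 9 = 0) (h13 : τ 13 = 0) (h15 : τ 15 = 0) :
    CongrMod (extD (w 3) q) 0 {w 3 q} := by
  obtain ⟨φ, ϖ, α, β, -, -, -, e3, -⟩ := structureEquationsAt_iff.1 h
  refine congrMod_of_eq_wedge (κ := (-τ 12) • w 0 q + (-τ 14) • w 1 q + (-τ 5) • w 2 q
    + (-(τ 1 + τ 3 + 1) / 2) • w 5 q) ?_
  rw [e3]
  ext v u
  simp [fullTorsion, h2, h4, h6, h9, h13, h15]
  ring

theorem HasTorsionAt.congrMod_five (h : HasTorsionAt w q τ) (h2 : τ 2 = 0) (h4 : τ 4 = 0)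
    (h8 : τ 8 = 0) (h11 : τ 11 = 0) (h17 : τ 17 = 0) (h19 : τ 19 = 0) :
    CongrMod (extD (w 5) q) 0 {w 5 q} := by
  obtain ⟨φ, ϖ, α, β, -, -, -, -, -, e5, -⟩ := structureEquationsAt_iff.1 h
  refine congrMod_of_eq_wedge (κ := (-τ 18) • w 0 q + (-τ 16) • w 1 q + (-τ 7) • w 2 q
    + (-(τ 1 + τ 3 + 1) / 2) • w 3 q) ?_
  rw [e5]
  ext v u
  simp [fullTorsion, h2, h4, h8, h11, h17, h19]
  ring

variable [IsManifold (𝓡 7) ∞ N] {U : Set N}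

/-- Up to constant factors, the ten functions are coefficients of dω¹ on pairs of frame vectors in
ker ω¹, or of dω³ on pairs in ker ω³. -/
theorem HasTorsionAt.eq_zero_of_congrMod (hw : IsCoframing U w) (hq : q ∈ U)
    (h : HasTorsionAt w q τ) (h3 : CongrMod (extD (w 3) q) 0 {w 3 q})
    (h5 : CongrMod (extD (w 5) q) 0 {w 5 q}) :
    (τ 2 = 0 ∧ τ 4 = 0) ∧ (τ 6 = 0 ∧ τ 13 = 0 ∧ τ 15 = 0 ∧ τ 9 = 0) ∧
      (τ 8 = 0 ∧ τ 19 = 0 ∧ τ 17 = 0 ∧ τ 11 = 0) := by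
  have he := hw.apply_frameVec hq (mem_extChartAt_source (I := 𝓡 7) q)
  obtain ⟨c, hc⟩ : ∃ c : Fin 7 → Fin 7 → Fin 7 → ℝ, ∀ i j k,
      extD (w i) q (frameVec w q q j) (frameVec w q q k) = c i j k := ⟨_, fun _ _ _ => rfl⟩
  have hz : ∀ i j k, CongrMod (extD (w i) q) 0 {w i q} → i ≠ j → i ≠ k → c i j k = 0 := by
    intro i j k hi hj hk
    rw [← hc, hi.apply_eq (by simp [he, hj]) (by simp [he, hk])]
    rfl
  obtain ⟨k534, -, -, k2, -, -, -, k6, -, k8, k9, -, k11, -, k13, -, k15, -, k17, -, k19⟩ :=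
    h.eq_of_dual he hc
  rw [hz 5 _ _ h5 (by decide) (by decide)] at k534 k8 k11 k17 k19
  rw [hz 3 _ _ h3 (by decide) (by decide)] at k2 k6 k9 k13 k15
  refine ⟨⟨?_, ?_⟩, ⟨?_, ?_, ?_, ?_⟩, ?_, ?_, ?_, ?_⟩ <;> linarith

end Integrability

/-! ### Existence of torsion for 1-adapted coframings. -/

section Existence

variable {N M M' : Type*}
  [TopologicalSpace N] [ChartedSpace (EuclideanSpace ℝ (Fin 7)) N] [IsManifold (𝓡 7) ∞ N]
  [TopologicalSpace M] [ChartedSpace (EuclideanSpace ℝ (Fin 5)) M] [IsManifold (𝓡 5) ∞ M]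
  [TopologicalSpace M'] [ChartedSpace (EuclideanSpace ℝ (Fin 5)) M'] [IsManifold (𝓡 5) ∞ M']
  {𝔅 : RankTwoBacklund N M M'} {U : Set N} {w : Fin 7 → OneForm 7 N} {q : N}

theorem RankTwoBacklund.IsOneAdapted.exists_hasTorsionAt (hw : 𝔅.IsOneAdapted U w) (hq : q ∈ U) :
    ∃ τ, HasTorsionAt w q τ := by
  have hqq := mem_extChartAt_source (I := 𝓡 7) q
  exact Backlund.exists_hasTorsionAt (hw.adaptedRelations hq hqq) (hw.linearRelations hq hqq)
    (hw.secondRelations hq hqq) (hw.gammaRelation hq hqq)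
    fun i v u => hw.coframing.extD_apply_eq_sum hq hqq i v u

end Existence

end Backlund

end

theorem proposition5p3 {N M M' : Type*}
    [TopologicalSpace N] [ChartedSpace (EuclideanSpace ℝ (Fin 7)) N] [IsManifold (𝓡 7) ∞ N]
    [TopologicalSpace M] [ChartedSpace (EuclideanSpace ℝ (Fin 5)) M] [IsManifold (𝓡 5) ∞ M]
    [TopologicalSpace M'] [ChartedSpace (EuclideanSpace ℝ (Fin 5)) M'] [IsManifold (𝓡 5) ∞ M']
    (𝔅 : Backlund.RankTwoBacklund N M M') (h𝔅 : 𝔅.IsTypeB₁) :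
    (∀ (U : Set N) (w : Fin 7 → Backlund.OneForm 7 N), 𝔅.IsOneAdapted U w →
        ∀ p ∈ U, dimH (Backlund.torsionOrbit w p) ≤ 2) ↔
      (∀ (U : Set N) (w : Fin 7 → Backlund.OneForm 7 N), 𝔅.IsOneAdapted U w →
        Backlund.IsIntegrableOn (w 3) U ∧ Backlund.IsIntegrableOn (w 5) U) := by
  constructor
  · intro h U w hw
    refine forall₂_and.mp fun q hq ↦ ?_
    obtain ⟨τ, hτ⟩ := hw.exists_hasTorsionAt hq
    have hd := h U w hw q hq
    rw [Backlund.torsionOrbit_eq hw.coframing hq hτ] at hd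
    obtain ⟨⟨h2, h4⟩, ⟨h6, h13, h15, h9⟩, h8, h19, h17, h11⟩ := Backlund.eq_zero_of_dimH_le hd
    exact ⟨hτ.congrMod_three h2 h4 h6 h9 h13 h15, hτ.congrMod_five h2 h4 h8 h11 h17 h19⟩
  · intro h U w hw p hp
    obtain ⟨τ, hτ⟩ := hw.exists_hasTorsionAt hp
    obtain ⟨h3, h5⟩ := h U w hw
    obtain ⟨⟨h2, h4⟩, ⟨h6, h13, h15, h9⟩, h8, h19, h17, h11⟩ :=
      hτ.eq_zero_of_congrMod hw.coframing hp (h3 p hp) (h5 p hp)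
    rw [Backlund.torsionOrbit_eq hw.coframing hp hτ]
    exact Backlund.dimH_setOf_torsionAct_le h2 h4 h6 h8 h9 h11 h13 h15 h17 h19
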